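/- **Conventions.** For a category $\mathcal V$ with finite products, $\mathcal V\text{-}\mathbf{Cat}$ is the category of small $\mathcal V$-enriched categories (for the cartesian product) and $\mathcal V$-enriched functors; it again has finite products, and a finite-product-preserving functor $F:\mathcal V\to\mathcal W$ induces a finite-product-preserving functor $F_*:\mathcal V\text{-}\mathbf{Cat}\to\mathcal W\text{-}\mathbf{Cat}$. Put $0\text{-}\mathbf{Cat}=\mathbf{Set}$ and $(n+1)\text{-}\mathbf{Cat}=(n\text{-}\mathbf{Cat})\text{-}\mathbf{Cat}$; let $S_0:1\text{-}\mathbf{Cat}\to 0\text{-}\mathbf{Cat}$ be the objects functor and $S_{n+1}=(S_n)_*:(n+2)\text{-}\mathbf{Cat}\to(n+1)\text{-}\mathbf{Cat}$. Let $\omega\text{-}\mathbf{Cat}$ be the (strict) limit of $\cdots\to(n+1)\text{-}\mathbf{Cat}\xrightarrow{S_n}n\text{-}\mathbf{Cat}\to\cdots\xrightarrow{S_0}0\text{-}\mathbf{Cat}$. Let $\mathbb G_\omega$ be the category with objects $0,1,2,\dots$ and arrows generated by $\sigma_k,\tau_k:k\to k-1$ ($k\ge1$) subject to $\sigma_{k-1}\sigma_k=\sigma_{k-1}\tau_k$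 and $\tau_{k-1}\sigma_k=\tau_{k-1}\tau_k$ ($k\ge2$); let $\mathbb G_n$ be its full subcategory on $0,\dots,n$. Put $\mathcal G_\omega=[\mathbb G_\omega,\mathbf{Set}]$ (globular sets), $\mathcal G_n=[\mathbb G_n,\mathbf{Set}]$ ($n$-globular sets), and let $R_n:\mathcal G_{n+1}\to\mathcal G_n$ be restriction. A $\mathcal V$-graph is a set $X_0$ with a family $(X(x,x'))_{x,x'\in X_0}$ of objects of $\mathcal V$, with the evident maps, and $\mathcal G_n$-graphs are equivalent to $(n+1)$-globular sets (vertices are $0$-cells, $k$-cells of the $X(x,x')$ are $(k+1)$-cells). Let $U_0:\mathbf{Set}\to\mathcal G_0$ be the canonical isomorphism, and let $U_{n+1}:(n+1)\text{-}\mathbf{Cat}\to\mathcal G_{n+1}$ send an $(n\text{-}\mathbf{Cat})$-category to the $(n+1)$-globular set of the $\mathcal G_n$-graph obtained by applying $U_n$ to its hom-objects. Canonically $U_nS_n= R_nU_{n+1}$, and so the $U_n$ induce a forgetful functor $U_\omega:\omega\text{-}\mathbf{Cat}\to\mathcal G_\omega$. An adjunction is monadic if its comparison functor to the category of algebras of the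 induced monad is an equivalence. A monad $(T,\eta,\mu)$ is cartesian if $T$ preserves pullbacks and all naturality squares of $\eta$ and $\mu$ are pullbacks; it is finitary if $T$ preserves (small) filtered colimits. A weak map of monads $(\mathcal E,T)\to(\mathcal E',T')$ is a functor $Q:\mathcal E\to\mathcal E'$ with a natural isomorphism $\psi:T'Q\to QT$ such that $\psi\circ\eta'Q=Q\eta$ and $\psi\circ\mu'Q=Q\mu\circ\psi T\circ T'\psi$; it induces the functor $\mathcal E^T\to\mathcal E'^{T'}$, $(X,h)\mapsto(QX,\,Qh\circ\psi_X)$. **Theorem.** 1. The forgetful functor $U_\omega:\omega\text{-}\mathbf{Cat}\to\mathcal G_\omega$ has a left adjoint, the adjunction is monadic, and the induced monad $T$ on $\mathcal G_\omega$ is cartesian and finitary. 2. For every $n\in\mathbb N$, the forgetful functor $U_n:n\text{-}\mathbf{Cat}\to\mathcal G_n$ has a left adjoint $F_n$, the adjunction is monadic, and the induced monad $T_n$ on $\mathcal G_n$ is cartesian and finitary. 3. For every $n\in\mathbb N$, $R_n$ carries the structure of a weak map of monads $(\mathcal G_{n+1},T_{n+1})\to(\mathcal G_n,T_n)$, and $S_n$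 is the induced functor $\mathcal G_{n+1}^{T_{n+1}}\to\mathcal G_n^{T_n}$: writing $K_n:n\text{-}\mathbf{Cat}\to\mathcal G_n^{T_n}$ for the comparison functors, $K_n\circ S_n$ is naturally isomorphic to the composite of $K_{n+1}$ with the induced functor, by an isomorphism lying over the canonical identification $U_nS_n= R_nU_{n+1}$. -/

import Mathlib

open CategoryTheory MonoidalCategory CartesianMonoidalCategory Limits

universe u

namespace StrictHigherCat

noncomputable section

section Aux

variable {V : Type (u + 1)} [Category.{u} V] [CartesianMonoidalCategory V]

theorem prod_id_comp_aux {A B A₀ B₀ : V} {i : 𝟙_ V ⟶ A₀} {j : 𝟙_ V ⟶ B₀} {m : A₀ ⊗ A ⟶ A}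
    {n : B₀ ⊗ B ⟶ B} (hm : (λ_ A).inv ≫ i ▷ A ≫ m = 𝟙 A) (hn : (λ_ B).inv ≫ j ▷ B ≫ n = 𝟙 B) :
    (λ_ (A ⊗ B)).inv ≫ lift i j ▷ (A ⊗ B) ≫
      lift ((fst A₀ B₀ ⊗ₘ fst A B) ≫ m) ((snd A₀ B₀ ⊗ₘ snd A B) ≫ n) = 𝟙 (A ⊗ B) := by
  have h1 : (λ_ (A ⊗ B)).inv ≫ lift i j ▷ (A ⊗ B) ≫ (fst A₀ B₀ ⊗ₘ fst A B) =
      fst A B ≫ (λ_ A).inv ≫ i ▷ A := by ext <;> simp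
  have h2 : (λ_ (A ⊗ B)).inv ≫ lift i j ▷ (A ⊗ B) ≫ (snd A₀ B₀ ⊗ₘ snd A B) =
      snd A B ≫ (λ_ B).inv ≫ j ▷ B := by ext <;> simp
  ext
  · simpa [hm] using h1 =≫ m
  · simpa [hn] using h2 =≫ n

theorem prod_comp_id_aux {A B A₀ B₀ : V} {i : 𝟙_ V ⟶ A₀} {j : 𝟙_ V ⟶ B₀} {m : A ⊗ A₀ ⟶ A}
    {n : B ⊗ B₀ ⟶ B} (hm : (ρ_ A).inv ≫ A ◁ i ≫ m = 𝟙 A) (hn : (ρ_ B).inv ≫ B ◁ j ≫ n = 𝟙 B) :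
    (ρ_ (A ⊗ B)).inv ≫ (A ⊗ B) ◁ lift i j ≫
      lift ((fst A B ⊗ₘ fst A₀ B₀) ≫ m) ((snd A B ⊗ₘ snd A₀ B₀) ≫ n) = 𝟙 (A ⊗ B) := by
  have h1 : (ρ_ (A ⊗ B)).inv ≫ (A ⊗ B) ◁ lift i j ≫ (fst A B ⊗ₘ fst A₀ B₀) =
      fst A B ≫ (ρ_ A).inv ≫ A ◁ i := by ext <;> simp
  have h2 : (ρ_ (A ⊗ B)).inv ≫ (A ⊗ B) ◁ lift i j ≫ (snd A B ⊗ₘ snd A₀ B₀) =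
      snd A B ≫ (ρ_ B).inv ≫ B ◁ j := by ext <;> simp
  ext
  · simpa [hm] using h1 =≫ m
  · simpa [hn] using h2 =≫ n

theorem prod_assoc_aux {A₁ A₂ A₃ A₁₂ A₂₃ A B₁ B₂ B₃ B₁₂ B₂₃ B : V}
    {m₁₂ : A₁ ⊗ A₂ ⟶ A₁₂} {m : A₁₂ ⊗ A₃ ⟶ A} {m₂₃ : A₂ ⊗ A₃ ⟶ A₂₃} {m' : A₁ ⊗ A₂₃ ⟶ A}
    {n₁₂ : B₁ ⊗ B₂ ⟶ B₁₂} {n : B₁₂ ⊗ B₃ ⟶ B} {n₂₃ : B₂ ⊗ B₃ ⟶ B₂₃} {n' : B₁ ⊗ B₂₃ ⟶ B}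
    (hm : (α_ A₁ A₂ A₃).inv ≫ m₁₂ ▷ A₃ ≫ m = A₁ ◁ m₂₃ ≫ m')
    (hn : (α_ B₁ B₂ B₃).inv ≫ n₁₂ ▷ B₃ ≫ n = B₁ ◁ n₂₃ ≫ n') :
    (α_ (A₁ ⊗ B₁) (A₂ ⊗ B₂) (A₃ ⊗ B₃)).inv ≫
      lift ((fst A₁ B₁ ⊗ₘ fst A₂ B₂) ≫ m₁₂) ((snd A₁ B₁ ⊗ₘ snd A₂ B₂) ≫ n₁₂) ▷ (A₃ ⊗ B₃) ≫
      lift ((fst A₁₂ B₁₂ ⊗ₘ fst A₃ B₃) ≫ m) ((snd A₁₂ B₁₂ ⊗ₘ snd A₃ B₃) ≫ n) =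
    (A₁ ⊗ B₁) ◁ lift ((fst A₂ B₂ ⊗ₘ fst A₃ B₃) ≫ m₂₃) ((snd A₂ B₂ ⊗ₘ snd A₃ B₃) ≫ n₂₃) ≫
      lift ((fst A₁ B₁ ⊗ₘ fst A₂₃ B₂₃) ≫ m') ((snd A₁ B₁ ⊗ₘ snd A₂₃ B₂₃) ≫ n') := by
  have e1 : (α_ (A₁ ⊗ B₁) (A₂ ⊗ B₂) (A₃ ⊗ B₃)).inv ≫
      lift ((fst A₁ B₁ ⊗ₘ fst A₂ B₂) ≫ m₁₂) ((snd A₁ B₁ ⊗ₘ snd A₂ B₂) ≫ n₁₂) ▷ (A₃ ⊗ B₃) ≫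
      (fst A₁₂ B₁₂ ⊗ₘ fst A₃ B₃) =
      (fst A₁ B₁ ⊗ₘ (fst A₂ B₂ ⊗ₘ fst A₃ B₃)) ≫ (α_ A₁ A₂ A₃).inv ≫ m₁₂ ▷ A₃ := by
    rw [associator_inv_naturality_assoc]
    simp only [← tensorHom_id, tensorHom_comp_tensorHom, lift_fst, Category.id_comp,
      Category.comp_id]
  have e2 : (α_ (A₁ ⊗ B₁) (A₂ ⊗ B₂) (A₃ ⊗ B₃)).inv ≫
      lift ((fst A₁ B₁ ⊗ₘ fst A₂ B₂) ≫ m₁₂) ((snd A₁ B₁ ⊗ₘ snd A₂ B₂) ≫ n₁₂) ▷ (A₃ ⊗ B₃) ≫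
      (snd A₁₂ B₁₂ ⊗ₘ snd A₃ B₃) =
      (snd A₁ B₁ ⊗ₘ (snd A₂ B₂ ⊗ₘ snd A₃ B₃)) ≫ (α_ B₁ B₂ B₃).inv ≫ n₁₂ ▷ B₃ := by
    rw [associator_inv_naturality_assoc]
    simp only [← tensorHom_id, tensorHom_comp_tensorHom, lift_snd, Category.id_comp,
      Category.comp_id]
  ext
  · have := e1 =≫ m
    simp only [Category.assoc, hm] at this
    simp only [Category.assoc, lift_fst, this]
    simp [← id_tensorHom, tensorHom_comp_tensorHom_assoc]
  · have := e2 =≫ n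
    simp only [Category.assoc, hn] at this
    simp only [Category.assoc, lift_snd, this]
    simp [← id_tensorHom, tensorHom_comp_tensorHom_assoc]

theorem prod_lift_aux {A₁ A₂ A₁' A₂' A B₁ B₂ B : V}
    {m : A₁ ⊗ A₂ ⟶ A} {n : B₁ ⊗ B₂ ⟶ B}
    (f₁ : A₁' ⟶ A₁) (f₂ : A₂' ⟶ A₂) (g₁ : A₁' ⟶ B₁) (g₂ : A₂' ⟶ B₂) :
    lift ((f₁ ⊗ₘ f₂) ≫ m) ((g₁ ⊗ₘ g₂) ≫ n) = (lift f₁ g₁ ⊗ₘ lift f₂ g₂) ≫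
      lift ((fst A₁ B₁ ⊗ₘ fst A₂ B₂) ≫ m) ((snd A₁ B₁ ⊗ₘ snd A₂ B₂) ≫ n) := by
  simp only [comp_lift, tensorHom_comp_tensorHom_assoc, lift_fst, lift_snd]

end Aux

/-- A small category enriched in the cartesian category `V`. -/
structure VCat (V : Type (u + 1)) [Category.{u} V] [CartesianMonoidalCategory V] :
    Type (u + 1) where
  carrier : Type u
  [str : EnrichedCategory V carrier]

namespace VCat

attribute [instance] VCat.str

variable {V : Type (u + 1)} [Category.{u} V] [CartesianMonoidalCategory V]
  {W : Type (u + 1)} [Category.{u} W] [CartesianMonoidalCategory W]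

/-- The category of small `V`-enriched categories and `V`-enriched functors. -/
instance : Category.{u} (VCat.{u} V) where
  Hom C D := EnrichedFunctor V C.carrier D.carrier
  id C := EnrichedFunctor.id V C.carrier
  comp F G := EnrichedFunctor.comp V F G
  id_comp _ := EnrichedFunctor.ext V (fun _ => rfl)
    fun _ _ => (Category.comp_id _).trans (Category.id_comp _)
  comp_id _ := EnrichedFunctor.ext V (fun _ => rfl)
    fun _ _ => (Category.comp_id _).trans (Category.comp_id _)
  assoc _ _ _ := EnrichedFunctor.ext V (fun _ => rfl)
    fun _ _ => (Category.comp_id _).trans (Category.assoc _ _ _)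

theorem hom_ext {C D : VCat.{u} V} {F G : C ⟶ D} (h : ∀ x, F.obj x = G.obj x)
    (h' : ∀ x y, F.map x y ≫ eqToHom (by rw [h, h]) = G.map x y) : F = G :=
  EnrichedFunctor.ext V h h'

/-- The terminal `V`-category. -/
def terminal : VCat.{u} V where
  carrier := PUnit
  str :=
    { Hom := fun _ _ => 𝟙_ V
      id := fun _ => 𝟙 _
      comp := fun _ _ _ => toUnit _
      id_comp := fun _ _ => toUnit_unique _ _
      comp_id := fun _ _ => toUnit_unique _ _
      assoc := fun _ _ _ _ => toUnit_unique _ _ }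

/-- The binary product of two `V`-categories: pairs of objects, products of hom-objects, and
componentwise identities and composition. -/
def prod (C D : VCat.{u} V) : VCat.{u} V where
  carrier := C.carrier × D.carrier
  str :=
    { Hom := fun x y => (x.1 ⟶[V] y.1) ⊗ (x.2 ⟶[V] y.2)
      id := fun x => lift (eId V x.1) (eId V x.2)
      comp := fun x y z =>
        lift ((fst _ _ ⊗ₘ fst _ _) ≫ eComp V x.1 y.1 z.1)
          ((snd _ _ ⊗ₘ snd _ _) ≫ eComp V x.2 y.2 z.2)
      id_comp := fun _ _ => prod_id_comp_aux (e_id_comp V _ _) (e_id_comp V _ _)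
      comp_id := fun _ _ => prod_comp_id_aux (e_comp_id V _ _) (e_comp_id V _ _)
      assoc := fun _ _ _ _ => prod_assoc_aux (e_assoc V _ _ _ _) (e_assoc V _ _ _ _) }

/-- First projection. -/
def prodFst (C D : VCat.{u} V) : prod C D ⟶ C :=
  EnrichedFunctor.mk (V := V) (C := (prod C D).carrier) (D := C.carrier)
    Prod.fst (fun _ _ => fst _ _) (fun _ => lift_fst _ _) (fun _ _ _ => lift_fst _ _)

/-- Second projection. -/
def prodSnd (C D : VCat.{u} V) : prod C D ⟶ D :=
  EnrichedFunctor.mk (V := V) (C := (prod C D).carrier) (D := D.carrier)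
    Prod.snd (fun _ _ => snd _ _) (fun _ => lift_snd _ _) (fun _ _ _ => lift_snd _ _)

/-- The pairing of two enriched functors. -/
def prodLift {B C D : VCat.{u} V} (F : B ⟶ C) (G : B ⟶ D) : B ⟶ prod C D :=
  EnrichedFunctor.mk (V := V) (C := B.carrier) (D := (prod C D).carrier)
    (fun x => (F.obj x, G.obj x)) (fun x y => lift (F.map x y) (G.map x y))
    (fun x => (comp_lift _ _ _).trans
      (congrArg₂ lift (EnrichedFunctor.map_id F x) (EnrichedFunctor.map_id G x)))
    (fun x y z => (comp_lift _ _ _).trans ((congrArg₂ lift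
        (EnrichedFunctor.map_comp F x y z) (EnrichedFunctor.map_comp G x y z)).trans
        (prod_lift_aux _ _ _ _)))

/-- The terminal `V`-category is terminal. -/
def isTerminalTerminal : IsTerminal (terminal : VCat.{u} V) :=
  IsTerminal.ofUniqueHom
    (fun C => EnrichedFunctor.mk (V := V) (C := C.carrier)
      (D := (terminal : VCat.{u} V).carrier) (fun _ => PUnit.unit) (fun _ _ => toUnit _)
      (fun _ => toUnit_unique _ _) (fun _ _ _ => toUnit_unique _ _))
    (fun _ _ => hom_ext (fun _ => rfl) (fun _ _ => toUnit_unique _ _))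

theorem map_of_eq {C D : VCat.{u} V} {F G : C ⟶ D} (h : F = G) (x y : C.carrier) :
    F.map x y ≫ eqToHom (by rw [h]) = G.map x y := by
  subst h
  exact Category.comp_id _

theorem prod_hom_ext {B C D : VCat.{u} V} {F G : B ⟶ prod C D}
    (h₁ : F ≫ prodFst C D = G ≫ prodFst C D) (h₂ : F ≫ prodSnd C D = G ≫ prodSnd C D) :
    F = G := by
  have ho : F.obj = G.obj := funext fun x => Prod.ext
    (congrArg (fun H => EnrichedFunctor.obj H x) h₁)
    (congrArg (fun H => EnrichedFunctor.obj H x) h₂)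
  obtain ⟨Fo, Fm, _, _⟩ := F
  obtain ⟨Go, Gm, _, _⟩ := G
  obtain rfl : Fo = Go := ho
  refine hom_ext (fun _ => rfl) fun x y => (Category.comp_id _).trans ?_
  exact CartesianMonoidalCategory.hom_ext _ _
    ((Category.comp_id _).symm.trans (map_of_eq h₁ x y))
    ((Category.comp_id _).symm.trans (map_of_eq h₂ x y))

/-- The product `V`-category is a product. -/
def isLimitProd (C D : VCat.{u} V) :
    IsLimit (BinaryFan.mk (prodFst C D) (prodSnd C D)) :=
  BinaryFan.isLimitMk
    (fun s => prodLift s.fst s.snd)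
    (fun _ => hom_ext (fun _ => rfl) (fun _ _ => (Category.comp_id _).trans (lift_fst _ _)))
    (fun _ => hom_ext (fun _ => rfl) (fun _ _ => (Category.comp_id _).trans (lift_snd _ _)))
    (fun _ _ h₁ h₂ => prod_hom_ext
      (h₁.trans (hom_ext (fun _ => rfl) (fun _ _ => (Category.comp_id _).trans (lift_fst _ _).symm)))
      (h₂.trans (hom_ext (fun _ => rfl) (fun _ _ => (Category.comp_id _).trans (lift_snd _ _).symm))))

/-- `VCat V` with its chosen finite products. -/
instance : CartesianMonoidalCategory (VCat.{u} V) :=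
  CartesianMonoidalCategory.ofChosenFiniteProducts
    ⟨_, isTerminalTerminal⟩ (fun C D => ⟨_, isLimitProd C D⟩)

section ChangeBase

variable (F : V ⥤ W) [F.Monoidal]

/-- Change of base on an enriched category: apply `F` to every hom-object. -/
def changeBaseObj (C : VCat.{u} V) : VCat.{u} W where
  carrier := TransportEnrichment F C.carrier

/-- Change of base on an enriched functor. -/
def changeBaseMap {C D : VCat.{u} V} (G : C ⟶ D) : changeBaseObj F C ⟶ changeBaseObj F D :=
  EnrichedFunctor.mk (V := W) (C := TransportEnrichment F C.carrier)
    (D := TransportEnrichment F D.carrier) G.obj (fun x y => F.map (G.map x y))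
    (fun x => by
      refine (Category.assoc _ _ _).trans (congrArg (Functor.LaxMonoidal.ε F ≫ ·) ?_)
      exact (F.map_comp _ _).symm.trans (congrArg F.map (EnrichedFunctor.map_id G x)))
    (fun x y z => by
      refine (Category.assoc _ _ _).trans ((congrArg (Functor.LaxMonoidal.μ F _ _ ≫ ·)
        ((F.map_comp _ _).symm.trans
          ((congrArg F.map (EnrichedFunctor.map_comp G x y z)).trans (F.map_comp _ _)))).trans ?_)
      exact (Functor.LaxMonoidal.μ_natural_assoc F _ _ _).symm)

end ChangeBase

/-- Change of base along a functor `F` that preserves finite products (and so is monoidal for the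
cartesian structures): objects are unchanged and `F` is applied to every hom-object. -/
def changeBase (F : V ⥤ W) [PreservesFiniteProducts F] : VCat.{u} V ⥤ VCat.{u} W :=
  letI := Functor.Monoidal.ofChosenFiniteProducts F
  { obj := changeBaseObj F
    map := changeBaseMap F
    map_id := fun C => hom_ext (F := changeBaseMap F (𝟙 C)) (G := 𝟙 (changeBaseObj F C))
      (fun _ => rfl) (fun _ _ => (Category.comp_id _).trans (F.map_id _))
    map_comp := fun G H => hom_ext (F := changeBaseMap F (G ≫ H))
      (G := changeBaseMap F G ≫ changeBaseMap F H)
      (fun _ => rfl) (fun _ _ => (Category.comp_id _).trans (F.map_comp _ _)) }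

theorem inv_comp_aux {A A' B B' C C' : V} (a : A ⟶ A') (b : B ⟶ B') (c : C ⟶ C')
    [IsIso a] [IsIso b] [IsIso c] (m : A ⊗ B ⟶ C) (m' : A' ⊗ B' ⟶ C')
    (h : m ≫ c = (a ⊗ₘ b) ≫ m') : m' ≫ inv c = (inv a ⊗ₘ inv b) ≫ m := by
  rw [IsIso.comp_inv_eq, Category.assoc, h, tensorHom_comp_tensorHom_assoc]
  simp

/-- An enriched functor which is the identity on objects and invertible on hom-objects is an
isomorphism. -/
theorem isIso_mk {X : Type u} (s t : EnrichedCategory V X)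
    (F : @EnrichedFunctor V _ _ X s X t) 
    (hF : @EnrichedFunctor.obj V _ _ X s X t F = id)
    (h : ∀ x y, IsIso (@EnrichedFunctor.map V _ _ X s X t F x y)) :
    @IsIso (VCat.{u} V) _ (@VCat.mk V _ _ X s) (@VCat.mk V _ _ X t) F := by
  obtain ⟨o, m, hi, hc⟩ := F
  obtain rfl : o = id := hF
  have h' : ∀ x y, IsIso (m x y) := h
  let G : @VCat.mk V _ _ X t ⟶ @VCat.mk V _ _ X s :=
    @EnrichedFunctor.mk V _ _ X t X s id (fun x y => inv (m x y))
      (fun x => (IsIso.comp_inv_eq _).2 (hi x).symm)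
      (fun x y z => inv_comp_aux _ _ _ _ _ (hc x y z))
  exact ⟨G,
    hom_ext (fun _ => rfl) (fun x y => (Category.comp_id _).trans (IsIso.hom_inv_id (m x y))),
    hom_ext (fun _ => rfl) (fun x y => (Category.comp_id _).trans (IsIso.inv_hom_id (m x y)))⟩

instance (F : V ⥤ W) [PreservesFiniteProducts F] : PreservesFiniteProducts (changeBase F) := by
  have h0 : PreservesLimit (Functor.empty.{0} (VCat.{u} V)) (changeBase F) := by
    refine preservesLimit_of_preserves_limit_cone isTerminalTerminal
      ((isLimitMapConeEmptyConeEquiv _ _).symm ?_)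
    have : IsIso (isTerminalTerminal.from ((changeBase F).obj terminal)) :=
      isIso_mk (X := PUnit) ((changeBase F).obj terminal).str
        (terminal : VCat.{u} W).str (isTerminalTerminal.from ((changeBase F).obj terminal)) rfl
        (fun _ _ => inferInstanceAs (IsIso (CartesianMonoidalCategory.terminalComparison F)))
    exact isTerminalTerminal.ofIso (asIso (isTerminalTerminal.from _)).symm
  have h1 : PreservesLimitsOfShape (Discrete PEmpty.{1}) (changeBase F) :=
    preservesLimitsOfShape_pempty_of_preservesTerminal _
  have h2 : PreservesLimitsOfShape (Discrete WalkingPair) (changeBase F) := by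
    refine ⟨fun {K} => ?_⟩
    suffices PreservesLimit (pair (K.obj ⟨.left⟩) (K.obj ⟨.right⟩)) (changeBase F) from
      preservesLimit_of_iso_diagram _ (diagramIsoPair K).symm
    generalize K.obj ⟨.left⟩ = C, K.obj ⟨.right⟩ = D
    refine preservesLimit_of_preserves_limit_cone (isLimitProd C D)
      ((isLimitMapConeBinaryFanEquiv _ _ _).symm ?_)
    have : IsIso ((isLimitProd ((changeBase F).obj C) ((changeBase F).obj D)).lift
        (BinaryFan.mk ((changeBase F).map (prodFst C D)) ((changeBase F).map (prodSnd C D)))) :=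
      isIso_mk (X := C.carrier × D.carrier) ((changeBase F).obj (prod C D)).str
        (prod ((changeBase F).obj C) ((changeBase F).obj D)).str
        (prodLift ((changeBase F).map (prodFst C D)) ((changeBase F).map (prodSnd C D))) rfl
        (fun x y => inferInstanceAs
          (IsIso (CartesianMonoidalCategory.prodComparison F (x.1 ⟶[V] y.1) (x.2 ⟶[V] y.2))))
    exact IsLimit.ofPointIso (isLimitProd _ _)
  exact .of_preserves_binary_and_terminal _

/-- The objects functor. -/
def objects : VCat.{u} (Type u) ⥤ Type u where
  obj C := C.carrier
  map F := TypeCat.ofHom F.obj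

instance : PreservesFiniteProducts objects.{u} := by
  have h0 : PreservesLimit (Functor.empty.{0} (VCat.{u} (Type u))) objects.{u} := by
    refine preservesLimit_of_preserves_limit_cone isTerminalTerminal
      ((isLimitMapConeEmptyConeEquiv _ _).symm ?_)
    exact Types.isTerminalPUnit
  have h1 : PreservesLimitsOfShape (Discrete PEmpty.{1}) objects.{u} :=
    preservesLimitsOfShape_pempty_of_preservesTerminal _
  have h2 : PreservesLimitsOfShape (Discrete WalkingPair) objects.{u} := by
    refine ⟨fun {K} => ?_⟩
    suffices PreservesLimit (pair (K.obj ⟨.left⟩) (K.obj ⟨.right⟩)) objects.{u} from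
      preservesLimit_of_iso_diagram _ (diagramIsoPair K).symm
    generalize K.obj ⟨.left⟩ = C, K.obj ⟨.right⟩ = D
    refine preservesLimit_of_preserves_limit_cone (isLimitProd C D)
      ((isLimitMapConeBinaryFanEquiv _ _ _).symm ?_)
    exact Types.binaryProductLimit C.carrier D.carrier
  exact .of_preserves_binary_and_terminal _

end VCat

/-! ### Strict `n`-categories -/

/-- A (large, locally small) category with chosen finite products. -/
structure CartCat : Type (u + 2) where
  carrier : Type (u + 1)
  [cat : Category.{u} carrier]
  [cart : CartesianMonoidalCategory carrier]

/-- `0-Cat = Set` and `(n+1)-Cat = (n-Cat)-Cat`, as categories with finite products. -/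
def cartNCat : ℕ → CartCat.{u}
  | 0 => ⟨Type u⟩
  | n + 1 =>
    letI := (cartNCat n).cat
    letI := (cartNCat n).cart
    ⟨VCat.{u} (cartNCat n).carrier⟩

/-- The category of strict `n`-categories and strict `n`-functors. -/
def NCat (n : ℕ) : Type (u + 1) := (cartNCat.{u} n).carrier

instance (n : ℕ) : Category.{u} (NCat.{u} n) := (cartNCat.{u} n).cat

instance (n : ℕ) : CartesianMonoidalCategory (NCat.{u} n) := (cartNCat.{u} n).cart

theorem NCat_zero : NCat.{u} 0 = Type u := rfl

theorem NCat_succ (n : ℕ) : NCat.{u} (n + 1) = VCat.{u} (NCat.{u} n) := rfl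

/-- The truncation functor `S_n : (n+1)-Cat ⥤ n-Cat`, together with the fact that it preserves
finite products: `S_0` is the objects functor, and `S_{n+1}` is change of base along `S_n`. -/
def truncAux : ∀ n : ℕ, { S : NCat.{u} (n + 1) ⥤ NCat.{u} n // PreservesFiniteProducts S }
  | 0 => ⟨VCat.objects.{u}, inferInstanceAs (PreservesFiniteProducts VCat.objects.{u})⟩
  | n + 1 =>
    haveI := (truncAux n).2
    ⟨VCat.changeBase (V := NCat.{u} (n + 1)) (W := NCat.{u} n) (truncAux n).1,
      inferInstanceAs (PreservesFiniteProducts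
        (VCat.changeBase (V := NCat.{u} (n + 1)) (W := NCat.{u} n) (truncAux n).1))⟩

/-- The truncation functor `S_n : (n+1)-Cat ⥤ n-Cat`. -/
def S (n : ℕ) : NCat.{u} (n + 1) ⥤ NCat.{u} n := (truncAux n).1

instance (n : ℕ) : PreservesFiniteProducts (S.{u} n) := (truncAux n).2

theorem S_zero : S.{u} 0 = VCat.objects.{u} := rfl

theorem S_succ (n : ℕ) : S.{u} (n + 1) = VCat.changeBase (S.{u} n) := rfl

/-! ### Globular sets -/

/-- The objects `0, 1, 2, …` of the globe category. -/
structure Globe where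
  dim : ℕ

/-- Morphisms of the globe category, generated by `σ_n, τ_n : n ⟶ n - 1` subject to
`σ σ = σ τ` and `τ σ = τ τ`. A composite of generators `m ⟶ n` with `n < m` is determined by its last
factor `σ_{n+1}` or `τ_{n+1}`: these are `src` and `tgt`. -/
inductive GlobeHom : ℕ → ℕ → Type
  | id (n : ℕ) : GlobeHom n n
  | src {m n : ℕ} (h : n < m) : GlobeHom m n
  | tgt {m n : ℕ} (h : n < m) : GlobeHom m n

namespace GlobeHom

theorem le : ∀ {m n : ℕ}, GlobeHom m n → n ≤ m
  | _, _, id _ => le_rfl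
  | _, _, src h => h.le
  | _, _, tgt h => h.le

/-- Composition, in diagrammatic order. -/
def comp {l m : ℕ} (f : GlobeHom l m) : ∀ {n : ℕ}, GlobeHom m n → GlobeHom l n
  | _, id _ => f
  | _, src h => src (h.trans_le f.le)
  | _, tgt h => tgt (h.trans_le f.le)

/-- Lowering all dimensions by one. -/
def pred : ∀ {m n : ℕ}, GlobeHom (m + 1) (n + 1) → GlobeHom m n
  | m, _, id _ => id m
  | _, _, src h => src (Nat.lt_of_succ_lt_succ h)
  | _, _, tgt h => tgt (Nat.lt_of_succ_lt_succ h)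

theorem id_comp : ∀ {m n : ℕ} (f : GlobeHom m n), (id m).comp f = f
  | _, _, id _ => rfl
  | _, _, src _ => rfl
  | _, _, tgt _ => rfl

theorem comp_assoc {k l m : ℕ} (f : GlobeHom k l) (g : GlobeHom l m) :
    ∀ {n : ℕ} (h : GlobeHom m n), (f.comp g).comp h = f.comp (g.comp h)
  | _, id _ => rfl
  | _, src _ => rfl
  | _, tgt _ => rfl

theorem pred_comp {l m : ℕ} (f : GlobeHom (l + 1) (m + 1)) :
    ∀ {n : ℕ} (g : GlobeHom (m + 1) (n + 1)), (f.comp g).pred = f.pred.comp g.pred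
  | _, id _ => rfl
  | _, src _ => rfl
  | _, tgt _ => rfl

end GlobeHom

/-- The globe category `𝔾`. -/
instance : Category Globe where
  Hom X Y := GlobeHom X.dim Y.dim
  id X := GlobeHom.id X.dim
  comp f g := GlobeHom.comp f g
  id_comp f := GlobeHom.id_comp f
  comp_id _ := rfl
  assoc f g h := GlobeHom.comp_assoc f g h

/-- The full subcategory `𝔾_n` of `𝔾` on the objects `0, …, n`. -/
abbrev GlobeLE (n : ℕ) : Type := ObjectProperty.FullSubcategory fun X : Globe => X.dim ≤ n

/-- Globular sets. -/
abbrev GlobSet : Type (u + 1) := Globe ⥤ Type u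

/-- `n`-globular sets. -/
abbrev NGlobSet (n : ℕ) : Type (u + 1) := GlobeLE n ⥤ Type u

/-- The inclusion `𝔾_n ⥤ 𝔾_{n+1}`. -/
def globeIncl (n : ℕ) : GlobeLE n ⥤ GlobeLE (n + 1) :=
  ObjectProperty.ιOfLE fun _ h => Nat.le_succ_of_le h

/-- The restriction functor `R_n` from `(n+1)`-globular sets to `n`-globular sets. -/
def R (n : ℕ) : NGlobSet.{u} (n + 1) ⥤ NGlobSet.{u} n :=
  (Functor.whiskeringLeft _ _ _).obj (globeIncl n)

/-! ### Graphs enriched in a category -/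

/-- A `V`-graph: a set of vertices and an object of `V` for every pair of vertices. -/
structure Gph (V : Type (u + 1)) : Type (u + 1) where
  vertex : Type u
  hom : vertex → vertex → V

namespace Gph

/-- A map of `V`-graphs. -/
@[ext]
structure Hom {V : Type (u + 1)} [Category.{u} V] (X Y : Gph.{u} V) : Type u where
  obj : X.vertex → Y.vertex
  map (x y : X.vertex) : X.hom x y ⟶ Y.hom (obj x) (obj y)

variable {V W : Type (u + 1)} [Category.{u} V] [Category.{u} W]

instance : Category.{u} (Gph.{u} V) where
  Hom := Hom
  id X := ⟨fun x => x, fun _ _ => 𝟙 _⟩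
  comp f g := ⟨fun x => g.obj (f.obj x), fun x y => f.map x y ≫ g.map _ _⟩
  id_comp _ := by ext <;> simp
  comp_id _ := by ext <;> simp
  assoc _ _ _ := by ext <;> simp

/-- The functor `V-Gph ⥤ W-Gph` induced by `F : V ⥤ W`. -/
def map (F : V ⥤ W) : Gph.{u} V ⥤ Gph.{u} W where
  obj X := ⟨X.vertex, fun x y => F.obj (X.hom x y)⟩
  map f := ⟨f.obj, fun x y => F.map (f.map x y)⟩
  map_id _ := congrArg (Hom.mk _) (funext fun _ => funext fun _ => F.map_id _)
  map_comp _ _ := congrArg (Hom.mk _) (funext fun _ => funext fun _ => F.map_comp _ _)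

end Gph

/-- The underlying `V`-graph of a `V`-category. -/
def VCat.toGph (V : Type (u + 1)) [Category.{u} V] [CartesianMonoidalCategory V] :
    VCat.{u} V ⥤ Gph.{u} V where
  obj C := ⟨C.carrier, fun x y => x ⟶[V] y⟩
  map F := ⟨F.obj, F.map⟩


/-! ### From graphs enriched in `n`-globular sets to `(n+1)`-globular sets -/

/-- The object of `𝔾_n` of dimension `k`. -/
abbrev globe {n : ℕ} (k : ℕ) (h : k ≤ n) : GlobeLE n := ⟨⟨k⟩, h⟩

/-- The morphism of `𝔾_n` given by a morphism of `𝔾`. -/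
abbrev globeHom {n k l : ℕ} {hk : k ≤ n} {hl : l ≤ n} (f : GlobeHom k l) :
    globe k hk ⟶ globe l hl :=
  ObjectProperty.homMk f

namespace Gph

variable {n : ℕ}

/-- The cells of the `(n+1)`-globular set of a graph `X` enriched in `n`-globular sets: `0`-cells
are vertices, and `(k+1)`-cells from `x` to `y` are `k`-cells of `X(x, y)`. -/
def Cell (X : Gph.{u} (NGlobSet.{u} n)) : ∀ k : ℕ, k ≤ n + 1 → Type u
  | 0, _ => X.vertex
  | k + 1, h => Σ x y : X.vertex, (X.hom x y).obj (globe k (Nat.le_of_succ_le_succ h))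

/-- The structure maps between the cells. -/
def cellMap (X : Gph.{u} (NGlobSet.{u} n)) : ∀ {k l : ℕ} (hk : k ≤ n + 1) (hl : l ≤ n + 1),
    GlobeHom k l → X.Cell k hk → X.Cell l hl
  | 0, 0, _, _, _, c => c
  | 0, _ + 1, _, _, f, _ => absurd f.le (Nat.not_succ_le_zero _)
  | _ + 1, 0, _, _, .src _, c => c.1
  | _ + 1, 0, _, _, .tgt _, c => c.2.1
  | _ + 1, _ + 1, _, _, f, c => ⟨c.1, c.2.1, (X.hom c.1 c.2.1).map (globeHom f.pred) c.2.2⟩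

theorem cellMap_id (X : Gph.{u} (NGlobSet.{u} n)) : ∀ {k : ℕ} (hk : k ≤ n + 1) (c : X.Cell k hk),
    X.cellMap hk hk (.id k) c = c
  | 0, _, _ => rfl
  | k + 1, hk, ⟨x, y, c⟩ => by
    have h : (X.hom x y).map (𝟙 (globe k (Nat.le_of_succ_le_succ hk))) c = c :=
      Functor.map_id_apply (X.hom x y) _ c
    exact congrArg (fun d => (⟨x, y, d⟩ : X.Cell (k + 1) hk)) h

theorem cellMap_comp (X : Gph.{u} (NGlobSet.{u} n)) :
    ∀ {k l m : ℕ} (hk : k ≤ n + 1) (hl : l ≤ n + 1) (hm : m ≤ n + 1) (f : GlobeHom k l)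
      (g : GlobeHom l m) (c : X.Cell k hk),
      X.cellMap hk hm (f.comp g) c = X.cellMap hl hm g (X.cellMap hk hl f c)
  | 0, 0, 0, _, _, _, _, _, _ => rfl
  | 0, _ + 1, _, _, _, _, f, _, _ => absurd f.le (Nat.not_succ_le_zero _)
  | _, 0, _ + 1, _, _, _, _, g, _ => absurd g.le (Nat.not_succ_le_zero _)
  | _ + 1, 0, 0, _, _, _, _, .id _, _ => rfl
  | _ + 1, _ + 1, 0, _, _, _, _, .src _, _ => rfl
  | _ + 1, _ + 1, 0, _, _, _, _, .tgt _, _ => rfl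
  | k + 1, l + 1, m + 1, hk, hl, hm, f, g, ⟨x, y, c⟩ => by
    have h := Functor.map_comp_apply (X.hom x y)
      (globeHom (hk := Nat.le_of_succ_le_succ hk) (hl := Nat.le_of_succ_le_succ hl) f.pred)
      (globeHom (hl := Nat.le_of_succ_le_succ hm) g.pred) c
    have e : (globeHom (f.comp g).pred : globe k (Nat.le_of_succ_le_succ hk) ⟶
        globe m (Nat.le_of_succ_le_succ hm)) =
        globeHom (hl := Nat.le_of_succ_le_succ hl) f.pred ≫ globeHom g.pred := by
      rw [GlobeHom.pred_comp]
      rfl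
    rw [← e] at h
    exact congrArg (fun d => (⟨x, y, d⟩ : X.Cell (m + 1) hm)) h

/-- The action of a map of graphs on cells. -/
def cellApp {X Y : Gph.{u} (NGlobSet.{u} n)} (f : X ⟶ Y) :
    ∀ {k : ℕ} (hk : k ≤ n + 1), X.Cell k hk → Y.Cell k hk
  | 0, _, c => f.obj c
  | _ + 1, _, c => ⟨f.obj c.1, f.obj c.2.1, (f.map c.1 c.2.1).app _ c.2.2⟩

theorem cellApp_cellMap {X Y : Gph.{u} (NGlobSet.{u} n)} (φ : X ⟶ Y) :
    ∀ {k l : ℕ} (hk : k ≤ n + 1) (hl : l ≤ n + 1) (f : GlobeHom k l) (c : X.Cell k hk),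
      cellApp φ hl (X.cellMap hk hl f c) = Y.cellMap hk hl f (cellApp φ hk c)
  | 0, 0, _, _, _, _ => rfl
  | 0, _ + 1, _, _, f, _ => absurd f.le (Nat.not_succ_le_zero _)
  | _ + 1, 0, _, _, .src _, _ => rfl
  | _ + 1, 0, _, _, .tgt _, _ => rfl
  | _ + 1, l + 1, _, hl, f, ⟨x, y, c⟩ =>
    congrArg (fun d => (⟨φ.obj x, φ.obj y, d⟩ : Y.Cell (l + 1) hl))
      (NatTrans.naturality_apply (φ.map x y) (globeHom f.pred) c)

theorem cellApp_id (X : Gph.{u} (NGlobSet.{u} n)) :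
    ∀ {k : ℕ} (hk : k ≤ n + 1) (c : X.Cell k hk), cellApp (𝟙 X) hk c = c
  | 0, _, _ => rfl
  | _ + 1, _, _ => rfl

theorem cellApp_comp {X Y Z : Gph.{u} (NGlobSet.{u} n)} (f : X ⟶ Y) (g : Y ⟶ Z) :
    ∀ {k : ℕ} (hk : k ≤ n + 1) (c : X.Cell k hk),
      cellApp (f ≫ g) hk c = cellApp g hk (cellApp f hk c)
  | 0, _, _ => rfl
  | _ + 1, _, _ => rfl

/-- The functor (an equivalence of categories) from graphs enriched in `n`-globular sets to `(n+1)`-globular sets. -/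
def toGlob (n : ℕ) : Gph.{u} (NGlobSet.{u} n) ⥤ NGlobSet.{u} (n + 1) where
  obj X :=
    { obj := fun k => X.Cell k.obj.dim k.property
      map := fun f => TypeCat.ofHom (X.cellMap _ _ f.hom)
      map_id := fun _ => by
        ext c
        exact X.cellMap_id _ c
      map_comp := fun f g => by
        ext c
        exact X.cellMap_comp _ _ _ f.hom g.hom c }
  map φ :=
    { app := fun k => TypeCat.ofHom (cellApp φ k.property)
      naturality := fun _ _ f => by
        ext c
        exact cellApp_cellMap φ _ _ f.hom c }
  map_id X := by
    ext k c
    exact cellApp_id X _ c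
  map_comp f g := by
    ext k c
    exact cellApp_comp f g _ c

/-- A natural isomorphism `F ≅ G` induces `F-Gph ≅ G-Gph`. -/
def mapIso {V W : Type (u + 1)} [Category.{u} V] [Category.{u} W] {F G : V ⥤ W} (α : F ≅ G) :
    map F ≅ map G :=
  NatIso.ofComponents
    (fun _ =>
      { hom := ⟨fun x => x, fun _ _ => α.hom.app _⟩
        inv := ⟨fun x => x, fun _ _ => α.inv.app _⟩
        hom_inv_id := congrArg (Hom.mk _)
          (funext fun _ => funext fun _ => Iso.hom_inv_id_app α _)
        inv_hom_id := congrArg (Hom.mk _)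
          (funext fun _ => funext fun _ => Iso.inv_hom_id_app α _) })
    (fun _ => congrArg (Hom.mk _) (funext fun _ => funext fun _ => α.hom.naturality _))

/-- Restriction on the hom-objects of an enriched graph corresponds to restriction of globular
sets; the components are identities. -/
def restrictCell (X : Gph.{u} (NGlobSet.{u} (n + 1))) : ∀ {k : ℕ} (hk : k ≤ n + 1),
    ((map (R.{u} n)).obj X).Cell k hk ≃ X.Cell k (Nat.le_succ_of_le hk)
  | 0, _ => Equiv.refl _
  | _ + 1, _ => Equiv.refl _

theorem restrictCell_cellMap (X : Gph.{u} (NGlobSet.{u} (n + 1))) :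
    ∀ {k l : ℕ} (hk : k ≤ n + 1) (hl : l ≤ n + 1) (f : GlobeHom k l)
      (c : ((map (R.{u} n)).obj X).Cell k hk),
      X.restrictCell hl (((map (R.{u} n)).obj X).cellMap hk hl f c) =
        X.cellMap (Nat.le_succ_of_le hk) (Nat.le_succ_of_le hl) f (X.restrictCell hk c)
  | 0, 0, _, _, _, _ => rfl
  | 0, _ + 1, _, _, f, _ => absurd f.le (Nat.not_succ_le_zero _)
  | _ + 1, 0, _, _, .src _, _ => rfl
  | _ + 1, 0, _, _, .tgt _, _ => rfl
  | _ + 1, _ + 1, _, _, _, _ => rfl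

end Gph

/-- `Gph.toGlob` commutes with restriction; the components are identities. -/
def restrictIso (n : ℕ) :
    Gph.map (R.{u} n) ⋙ Gph.toGlob n ≅ Gph.toGlob (n + 1) ⋙ R.{u} (n + 1) :=
  NatIso.ofComponents
    (fun X => NatIso.ofComponents (fun k => (X.restrictCell k.property).toIso)
      (fun {k l} f => by
        ext c
        exact X.restrictCell_cellMap k.property l.property f.hom c))
    (fun {X Y} f => by
      ext ⟨⟨k⟩, hk⟩ c
      cases k <;> rfl)

/-- The forgetful functor `U_n` from strict `n`-categories to `n`-globular sets: `U_0` is the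
isomorphism `Set ≅ [𝔾_0, Set]`, and `U_{n+1}` is `(n-Cat)-Cat ⥤ (n-Cat)-Gph ⥤ [𝔾_n, Set]-Gph`
followed by the equivalence with `[𝔾_{n+1}, Set]`. -/
def U : ∀ n : ℕ, NCat.{u} n ⥤ NGlobSet.{u} n
  | 0 => Functor.const (GlobeLE 0)
  | n + 1 => VCat.toGph (NCat.{u} n) ⋙ Gph.map (U n) ⋙ Gph.toGlob n


/-- The `0`-cells of an enriched category are its objects; the components are identities. -/
def objectsCell (X : Gph.{u} (NGlobSet.{u} 0)) : ∀ {k : ℕ} (hk : k ≤ 0),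
    X.vertex ≃ X.Cell k (Nat.le_succ_of_le hk)
  | 0, _ => Equiv.refl _
  | _ + 1, hk => absurd hk (Nat.not_succ_le_zero _)

/-- The forgetful functors commute with truncation and restriction. (All components of this
isomorphism are identities.) -/
def UIso : ∀ n : ℕ, S.{u} n ⋙ U.{u} n ≅ U.{u} (n + 1) ⋙ R.{u} n
  | 0 => NatIso.ofComponents
      (fun C => NatIso.ofComponents
        (fun k => (objectsCell ((VCat.toGph (NCat.{u} 0) ⋙ Gph.map (U 0)).obj C)
          k.property).toIso)
        (fun {k l} f => by
          obtain ⟨⟨k⟩, hk⟩ := k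
          obtain ⟨⟨l⟩, hl⟩ := l
          obtain rfl : k = 0 := Nat.le_zero.1 hk
          obtain rfl : l = 0 := Nat.le_zero.1 hl
          rfl))
      (fun {C D} F => by
        ext ⟨⟨k⟩, hk⟩ c
        obtain rfl : k = 0 := Nat.le_zero.1 hk
        rfl)
  | n + 1 =>
    Functor.isoWhiskerLeft (VCat.toGph (NCat.{u} (n + 1)))
      (Functor.isoWhiskerRight (Gph.mapIso (UIso n)) (Gph.toGlob n) ≪≫
        Functor.isoWhiskerLeft (Gph.map (U (n + 1))) (restrictIso n))

/-! ### Strict `ω`-categories -/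

/-- A strict `ω`-category: an object of the limit of the categories of strict `n`-categories along
the truncation functors. -/
structure OmegaCat : Type (u + 1) where
  obj (n : ℕ) : NCat.{u} n
  trunc (n : ℕ) : (S.{u} n).obj (obj (n + 1)) = obj n

namespace OmegaCat

/-- A strict `ω`-functor. -/
@[ext]
structure Hom (X Y : OmegaCat.{u}) : Type u where
  map (n : ℕ) : X.obj n ⟶ Y.obj n
  trunc (n : ℕ) : (S.{u} n).map (map (n + 1)) =
    eqToHom (X.trunc n) ≫ map n ≫ eqToHom (Y.trunc n).symm

instance : Category.{u} OmegaCat.{u} where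
  Hom := Hom
  id X := ⟨fun _ => 𝟙 _, fun n => by simp⟩
  comp f g := ⟨fun n => f.map n ≫ g.map n, fun n => by simp [f.trunc, g.trunc]⟩
  id_comp _ := by ext; simp
  comp_id _ := by ext; simp
  assoc _ _ _ := by ext; simp

end OmegaCat

namespace GlobSet

/-- Iterated maps of a sequence `⋯ ⟶ X 2 ⟶ X 1 ⟶ X 0`. -/
def down {X : ℕ → Type u} (s : ∀ n, X (n + 1) ⟶ X n) {m n : ℕ} (h : n ≤ m) : X m ⟶ X n :=
  (Functor.ofOpSequence s).map (homOfLE h).op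

theorem down_refl {X : ℕ → Type u} (s : ∀ n, X (n + 1) ⟶ X n) (n : ℕ) : down s (le_refl n) = 𝟙 _ :=
  (Functor.ofOpSequence s).map_id _

theorem down_comp {X : ℕ → Type u} (s : ∀ n, X (n + 1) ⟶ X n) {l m n : ℕ} (h : m ≤ l)
    (h' : n ≤ m) : down s h ≫ down s h' = down s (h'.trans h) :=
  ((Functor.ofOpSequence s).map_comp (homOfLE h).op (homOfLE h').op).symm

theorem down_succ {X : ℕ → Type u} (s : ∀ n, X (n + 1) ⟶ X n) (n : ℕ) :
    down s (Nat.le_succ n) = s n :=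
  Functor.ofOpSequence_map_homOfLE_succ s n

theorem down_naturality {X Y : ℕ → Type u} (s : ∀ n, X (n + 1) ⟶ X n) (s' : ∀ n, Y (n + 1) ⟶ Y n)
    (f : ∀ n, X n ⟶ Y n) (hf : ∀ n, s n ≫ f n = f (n + 1) ≫ s' n) {m n : ℕ} (h : n ≤ m) :
    down s h ≫ f n = f m ≫ down s' h := by
  induction m, h using Nat.le_induction with
  | base => rw [down_refl, down_refl, Category.id_comp, Category.comp_id]
  | succ m h ih =>
    rw [← down_comp s (Nat.le_succ m) h, ← down_comp s' (Nat.le_succ m) h, down_succ, down_succ,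
      Category.assoc, ih, ← Category.assoc, hf, Category.assoc]

theorem tgt_down {X : ℕ → Type u} (s t : ∀ n, X (n + 1) ⟶ X n)
    (hs : ∀ n, s (n + 1) ≫ s n = t (n + 1) ≫ s n) {m n : ℕ} (h : n < m) (e : X (n + 1) ⟶ X n)
    (he : s (n + 1) ≫ e = t (n + 1) ≫ e) :
    t m ≫ down s (Nat.succ_le_of_lt h) ≫ e = s m ≫ down s (Nat.succ_le_of_lt h) ≫ e := by
  obtain _ | k := m
  · exact absurd h (Nat.not_lt_zero _)
  obtain rfl | h' := (Nat.lt_succ_iff.1 h).eq_or_lt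
  · rw [down_refl, Category.id_comp, he]
  · have : down s (Nat.succ_le_of_lt h) = s k ≫ down s (Nat.succ_le_of_lt h') := by
      rw [← down_succ s k, down_comp]
    rw [this, Category.assoc, ← Category.assoc, ← hs, Category.assoc]

/-- The structure maps of the globular set with given cells, sources and targets. -/
def srcTgtMap {X : ℕ → Type u} (s t : ∀ n, X (n + 1) ⟶ X n) :
    ∀ {m n : ℕ}, GlobeHom m n → (X m ⟶ X n)
  | _, _, .id _ => 𝟙 _
  | _, n, .src h => down s (Nat.succ_le_of_lt h) ≫ s n
  | _, n, .tgt h => down s (Nat.succ_le_of_lt h) ≫ t n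

theorem srcTgtMap_comp {X : ℕ → Type u} (s t : ∀ n, X (n + 1) ⟶ X n)
    (hs : ∀ n, s (n + 1) ≫ s n = t (n + 1) ≫ s n) (ht : ∀ n, s (n + 1) ≫ t n = t (n + 1) ≫ t n)
    {l m n : ℕ} (f : GlobeHom l m) (g : GlobeHom m n) :
    srcTgtMap s t (f.comp g) = srcTgtMap s t f ≫ srcTgtMap s t g := by
  have key : ∀ {l m n : ℕ} (h : m < l) (h' : n < m) (e : X (n + 1) ⟶ X n),
      down s (Nat.succ_le_of_lt (h'.trans h)) ≫ e =
        (down s (Nat.succ_le_of_lt h) ≫ s m) ≫ down s (Nat.succ_le_of_lt h') ≫ e := by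
    intro l m n h h' e
    rw [← down_succ s m, down_comp, ← Category.assoc, down_comp]
  cases g with
  | id => exact (Category.comp_id _).symm
  | src h' =>
    cases f with
    | id => exact (Category.id_comp _).symm
    | src h => exact key h h' _
    | tgt h =>
      refine (key h h' _).trans ?_
      simp only [srcTgtMap, Category.assoc]
      rw [tgt_down s t hs h' _ (hs n)]
  | tgt h' =>
    cases f with
    | id => exact (Category.id_comp _).symm
    | src h => exact key h h' _
    | tgt h =>
      refine (key h h' _).trans ?_
      simp only [srcTgtMap, Category.assoc]
      rw [tgt_down s t hs h' _ (ht n)]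

/-- The globular set with given sets of `n`-cells and given source and target maps. -/
def ofSrcTgt (X : ℕ → Type u) (s t : ∀ n, X (n + 1) ⟶ X n)
    (hs : ∀ n, s (n + 1) ≫ s n = t (n + 1) ≫ s n) (ht : ∀ n, s (n + 1) ≫ t n = t (n + 1) ≫ t n) :
    GlobSet.{u} where
  obj k := X k.dim
  map f := srcTgtMap s t f
  map_id _ := rfl
  map_comp f g := srcTgtMap_comp s t hs ht f g

theorem srcTgtMap_naturality {X Y : ℕ → Type u} {s t : ∀ n, X (n + 1) ⟶ X n}
    {s' t' : ∀ n, Y (n + 1) ⟶ Y n} (f : ∀ n, X n ⟶ Y n)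
    (hs : ∀ n, s n ≫ f n = f (n + 1) ≫ s' n) (ht : ∀ n, t n ≫ f n = f (n + 1) ≫ t' n) :
    ∀ {m n : ℕ} (g : GlobeHom m n), srcTgtMap s t g ≫ f n = f m ≫ srcTgtMap s' t' g
  | _, _, .id _ => (Category.id_comp _).trans (Category.comp_id _).symm
  | _, _, .src h => by
    simp only [srcTgtMap, Category.assoc]
    rw [hs, ← Category.assoc, down_naturality s s' f hs, Category.assoc]
  | _, _, .tgt h => by
    simp only [srcTgtMap, Category.assoc]
    rw [ht, ← Category.assoc, down_naturality s s' f hs, Category.assoc]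

end GlobSet

namespace OmegaCat

/-- The identification of the restriction of the `(n+1)`-globular set underlying the `(n+1)`-st
truncation of `X` with the `n`-globular set underlying the `n`-th truncation. -/
def glue (X : OmegaCat.{u}) (n : ℕ) :
    (R.{u} n).obj ((U.{u} (n + 1)).obj (X.obj (n + 1))) ⟶ (U.{u} n).obj (X.obj n) :=
  (UIso n).inv.app (X.obj (n + 1)) ≫ (U n).map (eqToHom (X.trunc n))

theorem glue_naturality {X Y : OmegaCat.{u}} (f : X ⟶ Y) (n : ℕ) :
    (R.{u} n).map ((U.{u} (n + 1)).map (f.map (n + 1))) ≫ Y.glue n =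
      X.glue n ≫ (U.{u} n).map (f.map n) := by
  have h := (UIso n).inv.naturality (f.map (n + 1))
  have h' := f.trunc n
  dsimp only [Functor.comp_map] at h
  unfold glue
  rw [← Category.assoc, h, h', Category.assoc, Category.assoc, ← Functor.map_comp,
    ← Functor.map_comp]
  simp

theorem comp_aux₁ {A B B' C C' D : Type u} {a : A ⟶ B} {p : B ⟶ B'} {b : B' ⟶ C'} {q : C' ⟶ D}
    {b' : B ⟶ C} {p' : C ⟶ C'} {c : A ⟶ C} (h : b' ≫ p' = p ≫ b) (h' : c = a ≫ b') :
    (a ≫ p) ≫ b ≫ q = c ≫ p' ≫ q := by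
  rw [h', Category.assoc, ← Category.assoc p b q, ← h]
  simp only [Category.assoc]

theorem comp_aux₂ {A B C A' B' C' : Type u} {a : A ⟶ B} {p : B ⟶ C} {a' : A' ⟶ B'} {p' : B' ⟶ C'}
    {m₁ : A ⟶ A'} {m₂ : B ⟶ B'} {m₃ : C ⟶ C'} (h : m₂ ≫ p' = p ≫ m₃) (h' : a ≫ m₂ = m₁ ≫ a') :
    (a ≫ p) ≫ m₃ = m₁ ≫ a' ≫ p' := by
  rw [Category.assoc, ← h, ← Category.assoc, h', Category.assoc]

/-- The set of `n`-cells of a strict `ω`-category. -/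
def Cell (X : OmegaCat.{u}) (n : ℕ) : Type u :=
  ((U.{u} n).obj (X.obj n)).obj (globe n le_rfl)

/-- The structure map from `(n+1)`-cells to `n`-cells given by a morphism `n + 1 ⟶ n` of the globe
category. -/
def bdry (X : OmegaCat.{u}) {n : ℕ} (f : GlobeHom (n + 1) n) : X.Cell (n + 1) ⟶ X.Cell n :=
  ((U.{u} (n + 1)).obj (X.obj (n + 1))).map
      (globeHom (hk := le_rfl) (hl := Nat.le_succ n) f) ≫
    (X.glue n).app (globe n le_rfl)

theorem bdry_bdry (X : OmegaCat.{u}) {n : ℕ} (f f' : GlobeHom (n + 2) (n + 1))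
    (g : GlobeHom (n + 1) n) (h : f.comp g = f'.comp g) :
    X.bdry f ≫ X.bdry g = X.bdry f' ≫ X.bdry g := by
  have key : ∀ f : GlobeHom (n + 2) (n + 1), X.bdry f ≫ X.bdry g =
      ((U.{u} (n + 2)).obj (X.obj (n + 2))).map
        (globeHom (hk := le_rfl) (hl := (Nat.le_succ n).trans (Nat.le_succ _)) (f.comp g)) ≫
      (X.glue (n + 1)).app (globe n (Nat.le_succ n)) ≫ (X.glue n).app (globe n le_rfl) := by
    intro f
    have nat := (X.glue (n + 1)).naturality
      (globeHom (hk := le_refl (n + 1)) (hl := Nat.le_succ n) g)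
    have mc := ((U.{u} (n + 2)).obj (X.obj (n + 2))).map_comp
      (globeHom (hk := le_rfl) (hl := Nat.le_succ (n + 1)) f)
      (globeHom (hl := (Nat.le_succ n).trans (Nat.le_succ _)) g)
    exact comp_aux₁ nat mc
  rw [key, key, h]

/-- The underlying globular set of a strict `ω`-category. -/
def toGlobSet (X : OmegaCat.{u}) : GlobSet.{u} :=
  GlobSet.ofSrcTgt X.Cell (fun n => X.bdry (.src (Nat.lt_succ_self n)))
    (fun n => X.bdry (.tgt (Nat.lt_succ_self n)))
    (fun _ => X.bdry_bdry _ _ _ rfl) (fun _ => X.bdry_bdry _ _ _ rfl)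

/-- The action of a strict `ω`-functor on `n`-cells. -/
def cellMap {X Y : OmegaCat.{u}} (f : X ⟶ Y) (n : ℕ) : X.Cell n ⟶ Y.Cell n :=
  ((U.{u} n).map (f.map n)).app (globe n le_rfl)

theorem bdry_naturality {X Y : OmegaCat.{u}} (f : X ⟶ Y) {n : ℕ} (g : GlobeHom (n + 1) n) :
    X.bdry g ≫ cellMap f n = cellMap f (n + 1) ≫ Y.bdry g := by
  have h₁ := congrArg (fun α => NatTrans.app α (globe n le_rfl)) (glue_naturality f n)
  have h₂ := ((U.{u} (n + 1)).map (f.map (n + 1))).naturality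
    (globeHom (hk := le_rfl) (hl := Nat.le_succ n) g)
  exact comp_aux₂ h₁ h₂

end OmegaCat

/-- The forgetful functor `U_ω` from strict `ω`-categories to globular sets. -/
def UOmega : OmegaCat.{u} ⥤ GlobSet.{u} where
  obj X := X.toGlobSet
  map f :=
    { app := fun k => OmegaCat.cellMap f k.dim
      naturality := fun _ _ g => GlobSet.srcTgtMap_naturality (OmegaCat.cellMap f)
        (fun _ => OmegaCat.bdry_naturality f _) (fun _ => OmegaCat.bdry_naturality f _) g }
  map_id X := by
    ext k : 2
    exact congrArg (fun α => NatTrans.app α (globe k.dim le_rfl)) ((U.{u} k.dim).map_id _)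
  map_comp f g := by
    ext k : 2
    exact congrArg (fun α => NatTrans.app α (globe k.dim le_rfl)) ((U.{u} k.dim).map_comp _ _)

/-! ### Monads -/

section Monads

variable {C : Type*} [Category* C] {D : Type*} [Category* D]

/-- A monad is cartesian if its functor part preserves pullbacks and all naturality squares of its
unit and multiplication are pullbacks. -/
structure IsCartesianMonad (T : Monad C) : Prop where
  preserves : PreservesLimitsOfShape WalkingCospan T.toFunctor
  unit : NatTrans.Equifibered T.η
  mul : NatTrans.Equifibered T.μ

/-- The structure of a weak map of monads `(C, T) ⟶ (D, T')` on a functor `Q : C ⥤ D`: a monad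
functor whose natural transformation part `T' ∘ Q ⟶ Q ∘ T` is invertible. -/
structure WeakMonadMap (T : Monad C) (T' : Monad D) (Q : C ⥤ D) where
  iso : Q ⋙ T'.toFunctor ≅ T.toFunctor ⋙ Q
  unit (X : C) : T'.η.app (Q.obj X) ≫ iso.hom.app X = Q.map (T.η.app X)
  mul (X : C) : T'.μ.app (Q.obj X) ≫ iso.hom.app X =
    T'.map (iso.hom.app X) ≫ iso.hom.app (T.obj X) ≫ Q.map (T.μ.app X)

/-- The functor between categories of algebras induced by a weak map of monads. -/
def WeakMonadMap.algebraFunctor {T : Monad C} {T' : Monad D} {Q : C ⥤ D}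
    (φ : WeakMonadMap T T' Q) : T.Algebra ⥤ T'.Algebra where
  obj A :=
    { A := Q.obj A.A
      a := φ.iso.hom.app A.A ≫ Q.map A.a
      unit := by
        rw [← Category.assoc, φ.unit, ← Q.map_comp, A.unit]
        exact Q.map_id _
      assoc := by
        have h := φ.iso.hom.naturality A.a
        dsimp only [Functor.comp_map] at h
        rw [← Category.assoc, φ.mul, Functor.map_comp]
        simp only [Category.assoc]
        rw [← Q.map_comp, A.assoc, Q.map_comp]
        rw [← Category.assoc (φ.iso.hom.app (T.obj A.A)), ← h, Category.assoc] }
  map {A B} f :=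
    { f := Q.map f.f
      h := by
        have h := φ.iso.hom.naturality f.f
        dsimp only [Functor.comp_map] at h
        change T'.map (Q.map f.f) ≫ φ.iso.hom.app B.A ≫ Q.map B.a =
          (φ.iso.hom.app A.A ≫ Q.map A.a) ≫ Q.map f.f
        rw [← Category.assoc, h, Category.assoc, Category.assoc, ← Q.map_comp, ← Q.map_comp, f.h] }

end Monads

end
end StrictHigherCat

/-! The finite-dimensional statements are proved by induction on `n`. An `(n+1)`-globular set is a
graph enriched in `n`-globular sets, and the forgetful functor from `V`-categories, with `V =
n-Cat`, passes through `V`-graphs. Its left adjoint applies `F_n` to hom-objects and then forms the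
free `V`-category, whose hom-objects are coproducts, over sequences of vertices, of products of
hom-objects. This needs `V` to have coproducts over which products distribute, so the induction
carries the package `Good`: monadicity, cartesianness of unit and multiplication, and a description
of the cells of free objects by sums and pullbacks of cells (`Fam`). The last item makes the monad
preserve pullbacks, coproducts and filtered colimits. Coproducts in `V` are then created by `U`, and
distributivity is checked on cells.

The central computation is `Gph.walkEl_bijective`: the cells of a free `V`-category are walks of
cells. It shows that change of base along a functor that behaves well on cells preserves free
enriched categories. For `U_n` this lifts one monad over the other and makes the composite forgetful
functor monadic by Beck's theorem; for `S_n` it gives the Beck-Chevalley condition, hence the weak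
map of monads and its compatibility with comparison functors. Cartesianness of the multiplication
reduces to two facts: a bracketing of a walk depends only on lengths, which maps preserve
(`Walk.existsUnique_flatten`), and the maps at which the counit of `F_n ⊣ U_n` is cartesian are
closed under products and coproducts.

For `ω`, the truncations are isofibrations, so the strict limit of the categories `n-Cat` is also a
pseudo-limit, as globular sets are of `n`-globular sets. Free objects and algebra structures are
glued from the levels, because truncation preserves free objects (`LevelAdj.exists_adjunction`,
`LevelAdj.isEquivalence_comparison`). Pullbacks and filtered colimits are then checked level by
level. -/

namespace StrictHigherCat

noncomputable section

/-! ### Distributive categories -/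

/-- A cartesian category with small coproducts, over which products distribute. -/
class IsDistrib (V : Type (u + 1)) [Category.{u} V] [CartesianMonoidalCategory V] : Prop where
  hasCoproducts : HasCoproducts.{u} V
  tensorLeft (A : V) (J : Type u) : PreservesColimitsOfShape (Discrete J) (tensorLeft A)
  tensorRight (A : V) (J : Type u) : PreservesColimitsOfShape (Discrete J) (tensorRight A)

attribute [instance] IsDistrib.hasCoproducts IsDistrib.tensorLeft IsDistrib.tensorRight

section Distrib

variable {V : Type (u + 1)} [Category.{u} V] [CartesianMonoidalCategory V] [IsDistrib V]
  {J : Type u} {A : J → V} {B C : V}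

/-- A functor preserving a coproduct keeps its injections jointly epic. With `G` a tensoring
functor, or a composite of two, this tests maps out of products on summands. -/
theorem map_sigma_ext {W : Type*} [Category* W] (G : V ⥤ W)
    [PreservesColimitsOfShape (Discrete J) G] {D : W} {f g : G.obj (∐ A) ⟶ D}
    (h : ∀ j, G.map (Sigma.ι A j) ≫ f = G.map (Sigma.ι A j) ≫ g) : f = g :=
  Cofan.IsColimit.hom_ext (isColimitMapCoconeCofanMkEquiv G _ _
    (isColimitOfPreserves G (coproductIsCoproduct A))) _ _ h

/-- The morphism out of `B ⊗ ∐ A` with given components. -/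
def whiskerLeftDesc (f : ∀ j, B ⊗ A j ⟶ C) : B ⊗ (∐ A) ⟶ C :=
  inv (sigmaComparison (tensorLeft B) A) ≫ Sigma.desc f

theorem ι_whiskerLeftDesc (f : ∀ j, B ⊗ A j ⟶ C) (j : J) :
    B ◁ Sigma.ι A j ≫ whiskerLeftDesc f = f j := by
  have : B ◁ Sigma.ι A j = Sigma.ι _ j ≫ sigmaComparison (tensorLeft B) A :=
    (ι_comp_sigmaComparison (tensorLeft B) A j).symm
  rw [this, whiskerLeftDesc, Category.assoc, IsIso.hom_inv_id_assoc, Sigma.ι_desc]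

/-- The morphism out of `∐ A ⊗ B` with given components. -/
def whiskerRightDesc (f : ∀ j, A j ⊗ B ⟶ C) : (∐ A) ⊗ B ⟶ C :=
  inv (sigmaComparison (tensorRight B) A) ≫ Sigma.desc f

theorem ι_whiskerRightDesc (f : ∀ j, A j ⊗ B ⟶ C) (j : J) :
    Sigma.ι A j ▷ B ≫ whiskerRightDesc f = f j := by
  have : Sigma.ι A j ▷ B = Sigma.ι _ j ≫ sigmaComparison (tensorRight B) A :=
    (ι_comp_sigmaComparison (tensorRight B) A j).symm
  rw [this, whiskerRightDesc, Category.assoc, IsIso.hom_inv_id_assoc, Sigma.ι_desc]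

end Distrib

/-! ### Free enriched categories -/

/-- Finite sequences of elements of `α` with given first and last element. -/
inductive VPath (α : Type u) : α → α → Type u
  | nil (x : α) : VPath α x x
  | cons (x : α) {y z : α} (p : VPath α y z) : VPath α x z

namespace Gph

/-- Both maps are presented with one common vertex function, so that their hom components can be
compared without transport along equalities of vertices. -/
theorem hom_ext' {V : Type (u + 1)} [Category.{u} V] {X Y : Gph.{u} V} {f g : X ⟶ Y}
    {o : X.vertex → Y.vertex} {m m' : ∀ x y, X.hom x y ⟶ Y.hom (o x) (o y)} (hf : f = ⟨o, m⟩)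
    (hg : g = ⟨o, m'⟩) (h : ∀ x y, m x y = m' x y) : f = g := by
  rw [hf, hg, funext fun x => funext (h x)]

variable {V : Type (u + 1)} [Category.{u} V] [CartesianMonoidalCategory V]

/-- The product of the hom-objects along a sequence of vertices. -/
def pathObj (X : Gph.{u} V) : ∀ {x z : X.vertex}, VPath X.vertex x z → V
  | _, _, .nil _ => 𝟙_ V
  | _, _, .cons x (y := y) p => X.hom x y ⊗ X.pathObj p

section Fold

variable {X : Gph.{u} V} {C : Type u} [EnrichedCategory V C] (o : X.vertex → C)
  (m : ∀ x y, X.hom x y ⟶ (o x ⟶[V] o y))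

/-- The product of the action of a map of graphs along a path, followed by composition. -/
def fold : ∀ {x z : X.vertex} (p : VPath X.vertex x z), X.pathObj p ⟶ (o x ⟶[V] o z)
  | _, _, .nil x => eId V (o x)
  | _, _, .cons x (y := y) p => (m x y ⊗ₘ fold p) ≫ eComp V _ _ _

end Fold

variable [IsDistrib V]

/-- The hom-objects of the free enriched category on a graph. -/
def freeHom (X : Gph.{u} V) (x z : X.vertex) : V :=
  ∐ fun p : VPath X.vertex x z => X.pathObj p

variable (X : Gph.{u} V) {x y z w : X.vertex}

/-- The inclusion of the summand of a path. -/
def freeι (p : VPath X.vertex x z) : X.pathObj p ⟶ X.freeHom x z :=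
  Sigma.ι (fun p : VPath X.vertex x z => X.pathObj p) p

/-- The inclusion of the summand of a path of length zero. -/
def freeNil (x : X.vertex) : 𝟙_ V ⟶ X.freeHom x x := X.freeι (.nil x)

/-- The inclusion of the summand of a path of positive length. -/
def freeCons (x : X.vertex) (p : VPath X.vertex y z) : X.hom x y ⊗ X.pathObj p ⟶ X.freeHom x z :=
  X.freeι (.cons x p)

/-- The morphism out of a hom-object of the free enriched category with given components. -/
def freeDesc {A : V} (f : ∀ p : VPath X.vertex x z, X.pathObj p ⟶ A) : X.freeHom x z ⟶ A :=
  Sigma.desc f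

theorem freeι_freeDesc {A : V} (f : ∀ p : VPath X.vertex x z, X.pathObj p ⟶ A)
    (p : VPath X.vertex x z) : X.freeι p ≫ X.freeDesc f = f p :=
  Sigma.ι_desc _ _

variable {X} in
theorem freeHom_ext {A : V} {f g : X.freeHom x z ⟶ A} (h : ∀ p, X.freeι p ≫ f = X.freeι p ≫ g) :
    f = g :=
  Sigma.hom_ext _ _ h

variable {X} in
theorem freeHom_whiskerLeft_ext {A B : V} {f g : B ⊗ X.freeHom x z ⟶ A}
    (h : ∀ p, B ◁ X.freeι p ≫ f = B ◁ X.freeι p ≫ g) : f = g :=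
  map_sigma_ext (tensorLeft B) h

variable {X} in
theorem freeHom_whiskerRight_ext {A B : V} {f g : X.freeHom x z ⊗ B ⟶ A}
    (h : ∀ p, X.freeι p ▷ B ≫ f = X.freeι p ▷ B ≫ g) : f = g :=
  map_sigma_ext (tensorRight B) h

variable {X} in
theorem freeHom_whiskerRight_whiskerLeft_ext {A B D : V} {f g : (D ⊗ X.freeHom x z) ⊗ B ⟶ A}
    (h : ∀ p, (D ◁ X.freeι p) ▷ B ≫ f = (D ◁ X.freeι p) ▷ B ≫ g) : f = g :=
  map_sigma_ext (tensorLeft D ⋙ tensorRight B) h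

variable {X} in
theorem freeHom_whiskerRight_whiskerRight_ext {A B D : V} {f g : (X.freeHom x z ⊗ D) ⊗ B ⟶ A}
    (h : ∀ p, (X.freeι p ▷ D) ▷ B ≫ f = (X.freeι p ▷ D) ▷ B ≫ g) : f = g :=
  map_sigma_ext (tensorRight D ⋙ tensorRight B) h

/-- Prepending an edge. -/
def freePre (x y z : X.vertex) : X.hom x y ⊗ X.freeHom y z ⟶ X.freeHom x z :=
  whiskerLeftDesc fun p => X.freeι (.cons x p)

theorem ι_freePre (p : VPath X.vertex y z) :
    X.hom x y ◁ X.freeι p ≫ X.freePre x y z = X.freeCons x p :=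
  ι_whiskerLeftDesc _ p

theorem ι_freePre_assoc (p : VPath X.vertex y z) {A : V} (f : X.freeHom x z ⟶ A) :
    X.hom x y ◁ X.freeι p ≫ X.freePre x y z ≫ f = X.freeCons x p ≫ f := by
  rw [← ι_freePre, Category.assoc]

/-- Prepending a path. -/
def freeAct (w : X.vertex) : ∀ {x z : X.vertex} (p : VPath X.vertex x z),
    X.pathObj p ⊗ X.freeHom z w ⟶ X.freeHom x w
  | _, _, .nil _ => (λ_ _).hom
  | _, _, .cons x (y := y) p => (α_ _ _ _).hom ≫ X.hom x y ◁ freeAct w p ≫ X.freePre x y w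

/-- Composition in the free enriched category. -/
def freeComp (x y z : X.vertex) : X.freeHom x y ⊗ X.freeHom y z ⟶ X.freeHom x z :=
  whiskerRightDesc fun p => X.freeAct z p

theorem ι_freeComp (p : VPath X.vertex x y) :
    X.freeι p ▷ X.freeHom y z ≫ X.freeComp x y z = X.freeAct z p :=
  ι_whiskerRightDesc _ p

theorem ι_freeComp_assoc (p : VPath X.vertex x y) {A : V} (f : X.freeHom x z ⟶ A) :
    X.freeι p ▷ X.freeHom y z ≫ X.freeComp x y z ≫ f = X.freeAct z p ≫ f := by
  rw [← ι_freeComp, Category.assoc]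

theorem nil_freeComp : X.freeNil x ▷ X.freeHom x z ≫ X.freeComp x x z = (λ_ _).hom :=
  X.ι_freeComp (.nil x)

theorem cons_freeComp (p : VPath X.vertex y z) :
    X.freeCons x p ▷ X.freeHom z w ≫ X.freeComp x z w =
      (α_ _ _ _).hom ≫ X.hom x y ◁ X.freeAct w p ≫ X.freePre x y w :=
  X.ι_freeComp (.cons x p)

/-- Associativity when the first factor is a single edge: on each summand it is the recursive clause
of `freeAct`. It is the inductive step for arbitrary paths. -/
theorem freePre_freeComp :
    X.freePre x y z ▷ X.freeHom z w ≫ X.freeComp x z w =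
      (α_ _ _ _).hom ≫ X.hom x y ◁ X.freeComp y z w ≫ X.freePre x y w := by
  refine freeHom_whiskerRight_whiskerLeft_ext fun p => ?_
  rw [← comp_whiskerRight_assoc, ι_freePre, cons_freeComp, associator_naturality_middle_assoc,
    ← whiskerLeft_comp_assoc, ι_freeComp]

theorem freeAct_freeComp {x y : X.vertex} (p : VPath X.vertex x y) (z w : X.vertex) :
    X.freeAct z p ▷ X.freeHom z w ≫ X.freeComp x z w =
      (α_ _ _ _).hom ≫ X.pathObj p ◁ X.freeComp y z w ≫ X.freeAct w p := by
  induction p with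
  | nil x =>
    change (λ_ (X.freeHom x z)).hom ▷ X.freeHom z w ≫ X.freeComp x z w =
      (α_ _ _ _).hom ≫ 𝟙_ V ◁ X.freeComp x z w ≫ (λ_ _).hom
    simp
  | cons x p ih =>
    rename_i y t
    change ((α_ (X.hom x y) (X.pathObj p) _).hom ≫ X.hom x y ◁ X.freeAct z p ≫ X.freePre x y z) ▷
        X.freeHom z w ≫ X.freeComp x z w =
      (α_ _ _ _).hom ≫ (X.hom x y ⊗ X.pathObj p) ◁ X.freeComp t z w ≫
        (α_ _ _ _).hom ≫ X.hom x y ◁ X.freeAct w p ≫ X.freePre x y w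
    simp only [comp_whiskerRight, Category.assoc, freePre_freeComp]
    rw [associator_naturality_middle_assoc, ← whiskerLeft_comp_assoc, ih]
    simp

/-- The right unit law on the summand of `p`. Paths are built from the left, so unlike the left unit
law it needs an induction. -/
theorem freeAct_nil {x y : X.vertex} (p : VPath X.vertex x y) :
    X.pathObj p ◁ X.freeNil y ≫ X.freeAct y p = (ρ_ _).hom ≫ X.freeι p := by
  induction p with
  | nil x =>
    change 𝟙_ V ◁ X.freeNil x ≫ (λ_ _).hom = (ρ_ _).hom ≫ X.freeNil x
    simp [unitors_equal]
  | cons x p ih =>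
    rename_i y t
    change (X.hom x y ⊗ X.pathObj p) ◁ X.freeNil t ≫
      (α_ _ _ _).hom ≫ X.hom x y ◁ X.freeAct t p ≫ X.freePre x y t = (ρ_ _).hom ≫ X.freeCons x p
    rw [← ι_freePre, associator_naturality_right_assoc, ← whiskerLeft_comp_assoc, ih]
    simp

/-- The free enriched category on a graph. -/
def free : VCat.{u} V where
  carrier := X.vertex
  str :=
    { Hom := X.freeHom
      id := X.freeNil
      comp := X.freeComp
      id_comp := fun x y => by
        rw [nil_freeComp, Iso.inv_hom_id]
      comp_id := fun x y => by
        refine freeHom_ext fun p => ?_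
        rw [Category.comp_id, rightUnitor_inv_naturality_assoc, ← whisker_exchange_assoc,
          ι_freeComp, freeAct_nil, Iso.inv_hom_id_assoc]
      assoc := fun x y z w => by
        rw [← cancel_epi (α_ _ _ _).hom, Iso.hom_inv_id_assoc]
        refine freeHom_whiskerRight_whiskerRight_ext fun p => ?_
        rw [← comp_whiskerRight_assoc, ι_freeComp, freeAct_freeComp,
          associator_naturality_left_assoc, ← whisker_exchange_assoc, ι_freeComp] }

/-- The inclusion of the summand of a path of length one. -/
def freeSingle (x y : X.vertex) : X.hom x y ⊗ 𝟙_ V ⟶ X.freeHom x y :=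
  X.freeCons x (.nil y)

theorem single_freeComp :
    X.freeSingle x y ▷ X.freeHom y z ≫ X.freeComp x y z =
      (α_ _ _ _).hom ≫ X.hom x y ◁ (λ_ _).hom ≫ X.freePre x y z :=
  X.cons_freeComp (.nil y)

/-- The inclusion of the edges in the free enriched category. -/
def freeEdge (x y : X.vertex) : X.hom x y ⟶ X.freeHom x y :=
  (ρ_ _).inv ≫ X.freeSingle x y

theorem freeEdge_freeComp : X.freeEdge x y ▷ _ ≫ X.freeComp x y z = X.freePre x y z := by
  rw [freeEdge, comp_whiskerRight, Category.assoc, single_freeComp]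
  simp

/-! ### The universal property of the free enriched category -/

section Lift

variable {X} {C : Type u} [EnrichedCategory V C] (o : X.vertex → C)
  (m : ∀ x y, X.hom x y ⟶ (o x ⟶[V] o y))

/-- The action on hom-objects of the enriched functor out of the free enriched category induced by
a map of graphs. -/
def freeMap (x y : X.vertex) : X.freeHom x y ⟶ (o x ⟶[V] o y) :=
  X.freeDesc (fold o m)

theorem freeι_freeMap (p : VPath X.vertex x y) : X.freeι p ≫ freeMap o m x y = fold o m p :=
  freeι_freeDesc _ _ _

theorem freeNil_freeMap : X.freeNil x ≫ freeMap o m x x = eId V (o x) :=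
  freeι_freeMap o m (.nil x)

theorem freeCons_freeMap (p : VPath X.vertex y z) :
    X.freeCons x p ≫ freeMap o m x z = (m x y ⊗ₘ fold o m p) ≫ eComp V _ _ _ :=
  freeι_freeMap o m (.cons x p)

theorem freePre_freeMap :
    X.freePre x y z ≫ freeMap o m x z = (m x y ⊗ₘ freeMap o m y z) ≫ eComp V _ _ _ := by
  refine freeHom_whiskerLeft_ext fun p => ?_
  rw [ι_freePre_assoc, freeCons_freeMap, ← id_tensorHom, tensorHom_comp_tensorHom_assoc,
    freeι_freeMap, Category.id_comp]

/-- Functoriality on the summand of one path, by induction: the empty path uses the left unit law of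
`C`, and a longer one its associativity. -/
theorem freeAct_freeMap (p : VPath X.vertex x y) :
    X.freeAct z p ≫ freeMap o m x z = (fold o m p ⊗ₘ freeMap o m y z) ≫ eComp V _ _ _ := by
  induction p with
  | nil x =>
    change (λ_ _).hom ≫ freeMap o m x z = (eId V (o x) ⊗ₘ freeMap o m x z) ≫ eComp V _ _ _
    have := e_id_comp V (o x) (o z)
    rw [Iso.inv_comp_eq, Category.comp_id] at this
    rw [tensorHom_def'_assoc, this, leftUnitor_naturality]
  | cons x p ih =>
    rename_i y t
    change ((α_ _ _ _).hom ≫ X.hom x y ◁ X.freeAct z p ≫ X.freePre x y z) ≫ freeMap o m x z =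
      ((m x y ⊗ₘ fold o m p) ≫ eComp V _ _ _ ⊗ₘ freeMap o m t z) ≫ eComp V _ _ _
    have h := e_assoc V (o x) (o y) (o t) (o z)
    rw [Iso.inv_comp_eq] at h
    have e : ((m x y ⊗ₘ fold o m p) ≫ eComp V _ _ _ ⊗ₘ freeMap o m t z) =
        ((m x y ⊗ₘ fold o m p) ⊗ₘ freeMap o m t z) ≫ eComp V _ _ _ ▷ _ := by
      rw [← tensorHom_id, tensorHom_comp_tensorHom, Category.comp_id]
    simp only [e, Category.assoc, h]
    rw [freePre_freeMap, ← id_tensorHom,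
      tensorHom_comp_tensorHom_assoc, ih, Category.id_comp, associator_naturality_assoc,
      ← id_tensorHom, tensorHom_comp_tensorHom_assoc, Category.comp_id]

theorem freeComp_freeMap : X.freeComp x y z ≫ freeMap o m x z =
    (freeMap o m x y ⊗ₘ freeMap o m y z) ≫ eComp V _ _ _ := by
  refine freeHom_whiskerRight_ext fun p => ?_
  rw [ι_freeComp_assoc, freeAct_freeMap, ← tensorHom_id, tensorHom_comp_tensorHom_assoc,
    freeι_freeMap, Category.id_comp]

theorem freeEdge_freeMap : X.freeEdge x y ≫ freeMap o m x y = m x y := by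
  have h : (m x y ⊗ₘ eId V (o y)) ≫ eComp V _ _ _ = (ρ_ _).hom ≫ m x y := by
    have := e_comp_id V (o x) (o y)
    rw [Iso.inv_comp_eq, Category.comp_id] at this
    rw [tensorHom_def_assoc, this, rightUnitor_naturality]
  have h' : X.freeSingle x y ≫ freeMap o m x y = (m x y ⊗ₘ eId V (o y)) ≫ eComp V _ _ _ :=
    freeCons_freeMap o m (.nil y)
  rw [freeEdge, Category.assoc, h', h, Iso.inv_hom_id_assoc]

/-- A family of morphisms compatible with identities and composition is determined by its
restriction to edges. -/
theorem freeι_eq_fold (G : ∀ x y, X.freeHom x y ⟶ (o x ⟶[V] o y))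
    (hi : ∀ x, X.freeNil x ≫ G x x = eId V (o x))
    (hc : ∀ x y z, X.freeComp x y z ≫ G x z = (G x y ⊗ₘ G y z) ≫ eComp V _ _ _)
    (p : VPath X.vertex x y) :
    X.freeι p ≫ G x y = fold o (fun x y => X.freeEdge x y ≫ G x y) p := by
  induction p with
  | nil x => exact hi x
  | cons x p ih =>
    rename_i y t
    change X.freeCons x p ≫ G x t = (_ ⊗ₘ _) ≫ eComp V _ _ _
    rw [← ih, ← ι_freePre, Category.assoc, ← freeEdge_freeComp, Category.assoc, hc,
      ← id_tensorHom, ← tensorHom_id, tensorHom_comp_tensorHom_assoc,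
      tensorHom_comp_tensorHom_assoc]
    simp

theorem freeMap_unique (G : ∀ x y, X.freeHom x y ⟶ (o x ⟶[V] o y))
    (hi : ∀ x, X.freeNil x ≫ G x x = eId V (o x))
    (hc : ∀ x y z, X.freeComp x y z ≫ G x z = (G x y ⊗ₘ G y z) ≫ eComp V _ _ _) :
    freeMap o (fun x y => X.freeEdge x y ≫ G x y) x y = G x y :=
  freeHom_ext fun p => by rw [freeι_freeMap, freeι_eq_fold o G hi hc]

end Lift

/-- The unit of the free enriched category adjunction. -/
def freeUnit : X ⟶ (VCat.toGph V).obj X.free where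
  obj x := x
  map x y := X.freeEdge x y

variable {X} {C : VCat.{u} V}

/-- The enriched functor out of the free enriched category induced by a map of graphs. -/
def freeLift (φ : X ⟶ (VCat.toGph V).obj C) : X.free ⟶ C :=
  EnrichedFunctor.mk (V := V) (C := X.free.carrier) (D := C.carrier) φ.obj
    (fun x y => freeMap (C := C.carrier) φ.obj φ.map x y)
    (fun _ => freeNil_freeMap (C := C.carrier) φ.obj φ.map)
    (fun _ _ _ => freeComp_freeMap (C := C.carrier) φ.obj φ.map)

theorem freeUnit_freeLift (φ : X ⟶ (VCat.toGph V).obj C) :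
    X.freeUnit ≫ (VCat.toGph V).map (freeLift φ) = φ :=
  hom_ext' (o := φ.obj) (m' := φ.map) rfl rfl fun _ _ =>
    freeEdge_freeMap (C := C.carrier) φ.obj φ.map

theorem freeLift_freeUnit (G : X.free ⟶ C) :
    freeLift (X.freeUnit ≫ (VCat.toGph V).map G) = G :=
  VCat.hom_ext (fun _ => rfl) fun _ _ => (Category.comp_id _).trans
    (freeMap_unique (C := C.carrier) G.obj G.map (EnrichedFunctor.map_id G)
      (EnrichedFunctor.map_comp G))

/-- The universal property of the free enriched category. -/
def freeEquiv (X : Gph.{u} V) (C : VCat.{u} V) : (X.free ⟶ C) ≃ (X ⟶ (VCat.toGph V).obj C) where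
  toFun G := X.freeUnit ≫ (VCat.toGph V).map G
  invFun := freeLift
  left_inv := freeLift_freeUnit
  right_inv := freeUnit_freeLift

variable (V) in
/-- The free enriched category functor. -/
def freeFunctor : Gph.{u} V ⥤ VCat.{u} V :=
  Adjunction.leftAdjointOfEquiv freeEquiv fun X C D g h => by
    simp [freeEquiv]

variable (V) in
/-- The free enriched category functor is left adjoint to the forgetful functor. -/
def freeAdj : freeFunctor V ⊣ VCat.toGph V :=
  Adjunction.adjunctionOfEquivLeft freeEquiv _

theorem freeAdj_unit_app (X : Gph.{u} V) : (freeAdj V).unit.app X = X.freeUnit := by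
  have h : (freeAdj V).unit.app X = X.freeUnit ≫ (VCat.toGph V).map (𝟙 X.free) := by
    simp [freeAdj, Adjunction.adjunctionOfEquivLeft, freeEquiv]
    rfl
  exact h.trans ((congrArg (X.freeUnit ≫ ·) ((VCat.toGph V).map_id _)).trans (Category.comp_id _))

/-- The free functor comes from an abstract construction of left adjoints. This formula and the next
two recover its counit and its action on maps from the explicit `freeLift`. -/
theorem freeFunctor_map_counit (φ : X ⟶ (VCat.toGph V).obj C) :
    (freeFunctor V).map φ ≫ (freeAdj V).counit.app C = freeLift φ := by
  have h : (freeAdj V).homEquiv X C (freeLift φ) = φ :=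
    ((freeAdj V).homEquiv_unit _ _ _).trans ((congrArg (· ≫ (VCat.toGph V).map (freeLift φ))
      (freeAdj_unit_app X)).trans (freeUnit_freeLift φ))
  exact ((freeAdj V).homEquiv_counit _ _ _).symm.trans
    (((freeAdj V).homEquiv X C).symm_apply_eq.2 h.symm)

theorem freeAdj_counit_app (C : VCat.{u} V) :
    (freeAdj V).counit.app C = freeLift (𝟙 ((VCat.toGph V).obj C)) := by
  rw [← freeFunctor_map_counit]
  simp

theorem freeFunctor_map {Y : Gph.{u} V} (f : X ⟶ Y) :
    (freeFunctor V).map f = freeLift (f ≫ Y.freeUnit) := by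
  have h : (freeFunctor V).map (f ≫ (freeAdj V).unit.app Y) ≫
      (freeAdj V).counit.app ((freeFunctor V).obj Y) = (freeFunctor V).map f := by simp
  rw [freeAdj_unit_app] at h
  exact h.symm.trans (freeFunctor_map_counit _)

theorem map_eq_of_mk_eq {W : Type (u + 1)} [Category.{u} W] {X Y : Gph.{u} W}
    {o : X.vertex → Y.vertex} {m m' : ∀ x y, X.hom x y ⟶ Y.hom (o x) (o y)}
    (h : (⟨o, m⟩ : Hom X Y) = ⟨o, m'⟩) (x y : X.vertex) : m x y = m' x y := by
  injection h with _ h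
  rw [h]

end Gph

/-! ### Enriched categories are monadic over enriched graphs -/

namespace Gph

theorem comp_eq_comp_of_factor {W : Type*} [Category* W] {A B C D : W} {c c' : A ⟶ B} {i : A ⟶ D} {f g : D ⟶ B} {m : B ⟶ C}
    (h : f ≫ m = g ≫ m) (hf : i ≫ f = c) (hg : i ≫ g = c') : c ≫ m = c' ≫ m := by
  rw [← hf, ← hg, Category.assoc, Category.assoc, h]

variable {V : Type (u + 1)} [Category.{u} V] [CartesianMonoidalCategory V]

instance : (VCat.toGph V).Faithful where
  map_injective {C D} F G h := by
    obtain ⟨o, m, _, _⟩ := F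
    obtain ⟨o', m', _, _⟩ := G
    have h' : (⟨o, m⟩ : Hom ((VCat.toGph V).obj C) ((VCat.toGph V).obj D)) = ⟨o', m'⟩ := h
    obtain ⟨rfl, h'⟩ := Hom.mk.inj h'
    obtain rfl := eq_of_heq h'
    rfl

variable [IsDistrib V]

section Descend

variable {C D : Type u} [EnrichedCategory V C] [EnrichedCategory V D] (o : C → D)
  (m : ∀ x y : C, (x ⟶[V] y) ⟶ (o x ⟶[V] o y))

/-- The underlying graph of an enriched category. -/
abbrev ofEnriched (V : Type (u + 1)) [Category.{u} V] [CartesianMonoidalCategory V]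
    (C : Type u) [EnrichedCategory V C] : Gph.{u} V :=
  ⟨C, fun x y => x ⟶[V] y⟩

/-- Paths of length two recover composition from the action of the free enriched category monad. -/
theorem freeEdge_tensor_freeComp_freeMap (x y z : C) :
    ((ofEnriched V C).freeEdge x y ⊗ₘ (ofEnriched V C).freeEdge y z) ≫
      (ofEnriched V C).freeComp x y z ≫ freeMap (X := ofEnriched V C) o m x z =
        (m x y ⊗ₘ m y z) ≫ eComp V _ _ _ := by
  rw [freeComp_freeMap, tensorHom_comp_tensorHom_assoc, freeEdge_freeMap, freeEdge_freeMap]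

variable {o m}

/-- The hypothesis says that `m` is a morphism of algebras for the free enriched category monad.
Empty paths give preservation of identities, and in `map_comp_of_freeMap` paths of length two give
that of composition. -/
theorem map_id_of_freeMap
    (h : ∀ x y : C, freeMap (X := ofEnriched V C) (fun x => x) (fun _ _ => 𝟙 _) x y ≫ m x y =
      freeMap (X := ofEnriched V C) o m x y) (x : C) : eId V x ≫ m x x = eId V (o x) := by
  have h1 := freeNil_freeMap (X := ofEnriched V C) (fun x => x) (fun _ _ => 𝟙 _) (x := x)
  have h2 := freeNil_freeMap (X := ofEnriched V C) o m (x := x)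
  rw [← h1, Category.assoc, h, h2]

theorem map_comp_of_freeMap
    (h : ∀ x y : C, freeMap (X := ofEnriched V C) (fun x => x) (fun _ _ => 𝟙 _) x y ≫ m x y =
      freeMap (X := ofEnriched V C) o m x y) (x y z : C) :
    eComp V x y z ≫ m x z = (m x y ⊗ₘ m y z) ≫ eComp V _ _ _ := by
  have h1 := freeEdge_tensor_freeComp_freeMap (V := V) (fun x : C => x) (fun _ _ => 𝟙 _) x y z
  have h2 := freeEdge_tensor_freeComp_freeMap o m x y z
  rw [← h2, ← h, ← Category.assoc, ← Category.assoc]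
  rw [← Category.assoc] at h1
  rw [h1]
  simp

end Descend

instance : (Monad.comparison (freeAdj V)).Full where
  map_surjective {C D} f := by
    let φ : (VCat.toGph V).obj C ⟶ (VCat.toGph V).obj D := f.f
    have h : (VCat.toGph V).map ((freeAdj V).counit.app C) ≫ φ =
        (VCat.toGph V).map ((freeFunctor V).map φ ≫ (freeAdj V).counit.app D) := by
      rw [Functor.map_comp]
      exact f.h.symm
    rw [freeFunctor_map_counit, freeAdj_counit_app] at h
    have h' := map_eq_of_mk_eq h
    exact ⟨EnrichedFunctor.mk (V := V) (C := C.carrier) (D := D.carrier) φ.obj φ.map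
      (map_id_of_freeMap (C := C.carrier) (D := D.carrier) h')
      (map_comp_of_freeMap (C := C.carrier) (D := D.carrier) h'), rfl⟩

section OfAlgebra

variable {X : Gph.{u} V} (m : ∀ x y, X.freeHom x y ⟶ X.hom x y)

/-- The composition on a graph induced by an action of the free enriched category on it. -/
def algComp (x y z : X.vertex) : X.hom x y ⊗ X.hom y z ⟶ X.hom x z :=
  (X.freeEdge x y ⊗ₘ X.freeEdge y z) ≫ X.freeComp x y z ≫ m x z

variable (hu : ∀ x y, X.freeEdge x y ≫ m x y = 𝟙 _)
  (hm : ∀ x y z, X.freeComp x y z ≫ m x z = (m x y ⊗ₘ m y z) ≫ algComp m x y z)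

/-- The enriched category of an algebra for the free enriched category monad. -/
@[reducible]
def algEnriched : EnrichedCategory V X.vertex where
  Hom := X.hom
  id x := X.freeNil x ≫ m x x
  comp := algComp m
  id_comp x y := by
    -- By the unit law `hu`, the identity of `X.hom x y` may be replaced by `freeEdge` followed by
    -- `m`; then `hm` moves the computation into the free enriched category, where the law is known.
    -- The other two axioms are treated in the same way.
    have h : (X.freeNil x ≫ m x x) ▷ X.hom x y =
        (𝟙_ V ◁ X.freeEdge x y) ≫ (X.freeNil x ▷ _) ≫ (m x x ⊗ₘ m x y) := by
      simp [← id_tensorHom, ← tensorHom_id, tensorHom_comp_tensorHom, hu]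
    rw [h, Category.assoc, Category.assoc, ← hm, ← Category.assoc (X.freeNil x ▷ _),
      nil_freeComp]
    simp [hu]
  comp_id x y := by
    have h : X.hom x y ◁ (X.freeNil y ≫ m y y) =
        (X.freeEdge x y ▷ 𝟙_ V) ≫ (_ ◁ X.freeNil y) ≫ (m x y ⊗ₘ m y y) := by
      simp [← id_tensorHom, ← tensorHom_id, tensorHom_comp_tensorHom, hu]
    have h' := e_comp_id V (C := X.free.carrier) x y
    change (ρ_ _).inv ≫ _ ◁ X.freeNil y ≫ X.freeComp x y y = 𝟙 _ at h'
    rw [Iso.inv_comp_eq, Category.comp_id] at h'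
    rw [h, Category.assoc, Category.assoc, ← hm, ← Category.assoc (_ ◁ X.freeNil y), h']
    simp [hu]
  assoc x y z w := by
    have h' := e_assoc V (C := X.free.carrier) x y z w
    change (α_ _ _ _).inv ≫ X.freeComp x y z ▷ _ ≫ X.freeComp x z w =
      _ ◁ X.freeComp y z w ≫ X.freeComp x y w at h'
    have h1 : algComp m x y z ▷ X.hom z w = ((X.freeEdge x y ⊗ₘ X.freeEdge y z) ⊗ₘ X.freeEdge z w) ≫
        X.freeComp x y z ▷ _ ≫ (m x z ⊗ₘ m z w) := by
      simp only [algComp, ← tensorHom_id, tensorHom_comp_tensorHom, hu,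
        Category.id_comp]
    have h2 : X.hom x y ◁ algComp m y z w = (X.freeEdge x y ⊗ₘ (X.freeEdge y z ⊗ₘ X.freeEdge z w)) ≫
        _ ◁ X.freeComp y z w ≫ (m x y ⊗ₘ m y w) := by
      simp only [algComp, ← id_tensorHom, tensorHom_comp_tensorHom, hu,
        Category.id_comp]
    rw [h1, h2]
    simp only [Category.assoc]
    rw [← hm, ← hm, ← associator_inv_naturality_assoc]
    simp only [← Category.assoc]
    congr 1
    simp only [Category.assoc, h']

end OfAlgebra

instance : (Monad.comparison (freeAdj V)).EssSurj where
  mem_essImage A := by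
    obtain ⟨X, a, hu, ha⟩ := A
    obtain ⟨o, m⟩ := a
    have hu' : X.freeUnit ≫ (⟨o, m⟩ : (VCat.toGph V).obj X.free ⟶ X) = 𝟙 X := by
      rw [← freeAdj_unit_app]
      exact hu
    -- The unit law of the algebra forces the action to be the identity on vertices.
    obtain rfl : o = fun x => x := congrArg Hom.obj hu'
    obtain ⟨m, rfl⟩ : ∃ m' : ∀ x y : X.vertex, X.freeHom x y ⟶ X.hom x y, m' = m := ⟨m, rfl⟩
    have hu := map_eq_of_mk_eq hu'
    have ha' : (VCat.toGph V).map ((freeAdj V).counit.app X.free) ≫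
        (⟨fun x => x, m⟩ : (VCat.toGph V).obj X.free ⟶ X) =
      (VCat.toGph V).map ((freeFunctor V).map (⟨fun x => x, m⟩ : (VCat.toGph V).obj X.free ⟶ X)) ≫
        (⟨fun x => x, m⟩ : (VCat.toGph V).obj X.free ⟶ X) := ha
    rw [freeAdj_counit_app, freeFunctor_map] at ha'
    have ha := map_eq_of_mk_eq ha'
    -- This is the associativity law of the algebra, restricted to paths of length two in the
    -- underlying graph of the free enriched category.
    have hm (x y z) : X.freeComp x y z ≫ m x z = (m x y ⊗ₘ m y z) ≫ algComp m x y z := by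
      have h1 := freeEdge_tensor_freeComp_freeMap (V := V) (C := X.free.carrier)
        (D := X.free.carrier) (fun x => x) (fun _ _ => 𝟙 _) x y z
      have h2 := freeEdge_tensor_freeComp_freeMap (V := V) (C := X.free.carrier)
        (D := X.free.carrier) (fun x => x) (fun x y => m x y ≫ X.freeEdge x y) x y z
      rw [← Category.assoc] at h1 h2
      have h3 : (𝟙 _ ⊗ₘ 𝟙 _) ≫ X.freeComp x y z ≫ m x z =
          (m x y ≫ X.freeEdge x y ⊗ₘ m y z ≫ X.freeEdge y z) ≫ X.freeComp x y z ≫ m x z :=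
        (Category.assoc _ _ _).symm.trans
          ((comp_eq_comp_of_factor (ha x z) h1 h2).trans (Category.assoc _ _ _))
      rw [id_tensorHom_id, Category.id_comp] at h3
      rw [h3, algComp, tensorHom_comp_tensorHom_assoc]
    let C : VCat.{u} V := @VCat.mk V _ _ X.vertex (algEnriched m hu hm)
    refine ⟨C, ⟨Monad.Algebra.isoMk (Iso.refl _) ?_⟩⟩
    -- An action compatible with identities and composition is determined by its values on edges, so
    -- the counit at `C` is the given action.
    have h : ((VCat.toGph V).map ((freeAdj V).counit.app C) : (VCat.toGph V).obj X.free ⟶ X) =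
        ⟨fun x => x, m⟩ := by
      rw [freeAdj_counit_app]
      refine hom_ext' (o := fun x => x) rfl rfl fun x y => ?_
      let _ := algEnriched m hu hm
      refine Eq.trans ?_ (freeMap_unique (C := X.vertex) (X := X) (fun x => x) m
        (fun _ => rfl) hm (x := x) (y := y))
      exact congrArg (fun k => freeMap (C := X.vertex) (X := X) (fun x => x) k x y)
        (funext fun x => funext fun y => (hu x y).symm)
    exact (congrArg (· ≫ (⟨fun x => x, m⟩ : (VCat.toGph V).obj X.free ⟶ X))
      ((freeFunctor V ⋙ VCat.toGph V).map_id X)).trans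
      ((Category.id_comp _).trans (h.symm.trans (Category.comp_id _).symm))

instance : (Monad.comparison (freeAdj V)).IsEquivalence where

variable (V) in
/-- Enriched categories are monadic over enriched graphs. -/
instance : MonadicRightAdjoint (VCat.toGph V) where
  L := _
  adj := freeAdj V
  eqv := inferInstance

end Gph

/-! ### Monadicity of composites -/

section Monadicity

universe v w₁ w₂ w₃

variable {A : Type w₁} [Category.{v} A] {B : Type w₂} [Category.{v} B] {C : Type w₃} [Category.{v} C]

theorem hasSplitCoequalizer_of_natIso {D : Type*} [Category* D] {F G : B ⥤ D} (e : F ≅ G)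
    {X Y : B} (f g : X ⟶ Y) [HasSplitCoequalizer (F.map f) (F.map g)] :
    HasSplitCoequalizer (G.map f) (G.map g) := by
  let q := HasSplitCoequalizer.isSplitCoequalizer (F.map f) (F.map g)
  refine ⟨_, e.inv.app Y ≫ HasSplitCoequalizer.coequalizerπ (F.map f) (F.map g), ⟨
    { rightSection := q.rightSection ≫ e.hom.app Y
      leftSection := e.inv.app Y ≫ q.leftSection ≫ e.hom.app X
      condition := ?_
      rightSection_π := ?_
      leftSection_bottom := ?_
      leftSection_top := ?_ }⟩⟩
  · rw [e.inv.naturality_assoc, q.condition, e.inv.naturality_assoc]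
  · simp [q.rightSection_π]
  · rw [Category.assoc, Category.assoc, ← e.hom.naturality, q.leftSection_bottom_assoc,
      e.inv_hom_id_app]
  · rw [Category.assoc, Category.assoc, ← e.hom.naturality, q.leftSection_top_assoc,
      Category.assoc]

/-- The image of a parallel pair. -/
def parallelPairCompIso {D : Type*} [Category* D] (F : B ⥤ D) {X Y : B} (f g : X ⟶ Y) :
    parallelPair f g ⋙ F ≅ parallelPair (F.map f) (F.map g) :=
  diagramIsoParallelPair _

/-- `MonadicRightAdjoint` fixes one left adjoint; the creation criterion of Beck's theorem mentions
only `G`, so it transfers the equivalence to any other one. -/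
theorem isEquivalence_comparison_of_monadic {G : A ⥤ B} [MonadicRightAdjoint G] {F : B ⥤ A}
    (adj : F ⊣ G) : (Monad.comparison adj).IsEquivalence :=
  haveI : Monad.CreatesColimitOfIsSplitPair G :=
    ⟨fun f g _ => Monad.createsGSplitCoequalizersOfMonadic G f g⟩
  (Monad.monadicOfCreatesGSplitCoequalizers adj).eqv

variable (G₁ : A ⥤ B) (G₂ : B ⥤ C) [MonadicRightAdjoint G₁] [MonadicRightAdjoint G₂]

/-- Split coequalizers are preserved by every functor, in particular by `P`. Since `G₂` creates
coequalizers of `G₂`-split pairs, the lift `T` of `P` preserves them too. -/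
theorem preservesColimit_of_lift {T : B ⥤ B} {P : C ⥤ C} (e : T ⋙ G₂ ≅ G₂ ⋙ P) {X Y : B}
    (f g : X ⟶ Y) [G₂.IsSplitPair f g] : PreservesColimit (parallelPair f g) T := by
  have : HasSplitCoequalizer ((G₂ ⋙ P).map f) ((G₂ ⋙ P).map g) :=
    map_is_split_pair P (G₂.map f) (G₂.map g)
  have : HasSplitCoequalizer (G₂.map (T.map f)) (G₂.map (T.map g)) :=
    hasSplitCoequalizer_of_natIso e.symm f g
  let _ : CreatesColimit (parallelPair f g) G₂ := Monad.createsGSplitCoequalizersOfMonadic G₂ f g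
  let _ : CreatesColimit (parallelPair (T.map f) (T.map g)) G₂ :=
    Monad.createsGSplitCoequalizersOfMonadic G₂ _ _
  have : HasColimit (parallelPair f g ⋙ G₂) :=
    hasColimit_of_iso (parallelPairCompIso G₂ f g)
  have : PreservesColimit (parallelPair f g ⋙ G₂) P :=
    preservesColimit_of_iso_diagram P (parallelPairCompIso G₂ f g).symm
  have : PreservesColimit (parallelPair f g) (T ⋙ G₂) := preservesColimit_of_natIso _ e.symm
  have : ReflectsColimit (parallelPair f g ⋙ T) G₂ :=
    reflectsColimit_of_iso_diagram G₂ (parallelPairCompIso T f g).symm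
  exact preservesColimit_of_reflects_of_preserves T G₂

/-- A composite of monadic functors is monadic if the monad of the first one lifts the second
one. -/
theorem isEquivalence_comparison_comp {F : C ⥤ A} (adj : F ⊣ G₁ ⋙ G₂) {P : C ⥤ C}
    (e : (monadicLeftAdjoint G₁ ⋙ G₁) ⋙ G₂ ≅ G₂ ⋙ P) :
    (Monad.comparison adj).IsEquivalence := by
  -- By Beck's theorem it is enough to create coequalizers of pairs split by the composite. The
  -- image of such a pair under `G₁` is `G₂`-split, and by `e` so is its image under the monad of
  -- `G₁`. The monad therefore preserves both coequalizers, which lets `G₁` create the coequalizer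
  -- that `G₂` creates.
  have : Monad.CreatesColimitOfIsSplitPair (G₁ ⋙ G₂) := by
    refine ⟨fun f g _ => ?_⟩
    have h : G₂.IsSplitPair (G₁.map f) (G₁.map g) :=
      inferInstanceAs ((G₁ ⋙ G₂).IsSplitPair f g)
    have : HasSplitCoequalizer ((G₂ ⋙ P).map (G₁.map f)) ((G₂ ⋙ P).map (G₁.map g)) :=
      map_is_split_pair P (G₂.map (G₁.map f)) (G₂.map (G₁.map g))
    have h' : G₂.IsSplitPair ((monadicLeftAdjoint G₁ ⋙ G₁).map (G₁.map f))
        ((monadicLeftAdjoint G₁ ⋙ G₁).map (G₁.map g)) :=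
      hasSplitCoequalizer_of_natIso e.symm (G₁.map f) (G₁.map g)
    have p := preservesColimit_of_lift G₂ e (G₁.map f) (G₁.map g)
    have p' := preservesColimit_of_lift G₂ e ((monadicLeftAdjoint G₁ ⋙ G₁).map (G₁.map f))
      ((monadicLeftAdjoint G₁ ⋙ G₁).map (G₁.map g))
    have : PreservesColimit (parallelPair f g ⋙ G₁) (monadicLeftAdjoint G₁ ⋙ G₁) :=
      preservesColimit_of_iso_diagram _ (parallelPairCompIso G₁ f g).symm
    have : PreservesColimit ((parallelPair f g ⋙ G₁) ⋙ monadicLeftAdjoint G₁ ⋙ G₁)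
        (monadicLeftAdjoint G₁ ⋙ G₁) :=
      preservesColimit_of_iso_diagram _ (Functor.isoWhiskerRight (parallelPairCompIso G₁ f g) _ ≪≫
        parallelPairCompIso (monadicLeftAdjoint G₁ ⋙ G₁) _ _).symm
    let _ : CreatesColimit (parallelPair f g) G₁ :=
      monadicCreatesColimitOfPreservesColimit G₁ (parallelPair f g)
    let _ := Monad.createsGSplitCoequalizersOfMonadic G₂ (G₁.map f) (G₁.map g)
    let _ : CreatesColimit (parallelPair f g ⋙ G₁) G₂ :=
      createsColimitOfIsoDiagram G₂ (parallelPairCompIso G₁ f g).symm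
    infer_instance
  exact (Monad.monadicOfCreatesGSplitCoequalizers adj).eqv

end Monadicity

/-! ### Change of base for enriched graphs -/

namespace Gph

variable {V W : Type (u + 1)} [Category.{u} V] [Category.{u} W] {F : V ⥤ W} {U : W ⥤ V}

/-- An adjunction induces an adjunction between categories of enriched graphs. -/
def mapAdj (adj : F ⊣ U) : map F ⊣ map U where
  unit :=
    { app := fun _ => ⟨fun x => x, fun _ _ => adj.unit.app _⟩
      naturality := fun _ _ f => hom_ext' (o := f.obj) rfl rfl fun _ _ => adj.unit.naturality _ }
  counit :=
    { app := fun _ => ⟨fun x => x, fun _ _ => adj.counit.app _⟩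
      naturality := fun _ _ f => hom_ext' (o := f.obj) rfl rfl fun _ _ => adj.counit.naturality _ }
  left_triangle_components _ := hom_ext' (o := fun x => x) rfl rfl fun _ _ =>
    adj.left_triangle_components _
  right_triangle_components _ := hom_ext' (o := fun x => x) rfl rfl fun _ _ =>
    adj.right_triangle_components _

instance [U.Faithful] : (map U).Faithful where
  map_injective {X Y} f g h := by
    obtain ⟨o, m⟩ := f
    obtain ⟨o', m'⟩ := g
    obtain rfl : o = o' := congrArg Hom.obj h
    refine hom_ext' rfl rfl fun x y => U.map_injective ?_
    exact map_eq_of_mk_eq h x y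

theorem faithful_of_isEquivalence_comparison (adj : F ⊣ U)
    [(Monad.comparison adj).IsEquivalence] : U.Faithful :=
  Functor.Faithful.of_iso (Monad.comparisonForget adj)

variable (adj : F ⊣ U) [(Monad.comparison adj).IsEquivalence]

/-- The unit law makes the action of an algebra on a graph the identity on vertices, so such an
algebra is a family of algebras on the hom-objects. Fullness and essential surjectivity are thus
checked on hom-objects. -/
theorem full_comparison_mapAdj : (Monad.comparison (mapAdj adj)).Full where
  map_surjective {X Y} f := by
    obtain ⟨⟨o, m⟩, h⟩ := f
    have h' := map_eq_of_mk_eq (X := (map (U ⋙ F ⋙ U)).obj X) (Y := (map U).obj Y) (o := o)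
      (m := fun x y => U.map (F.map (m x y)) ≫
      U.map (adj.counit.app (Y.hom (o x) (o y))))
      (m' := fun x y => U.map (adj.counit.app (X.hom x y)) ≫ m x y) h
    let φ (x y : X.vertex) : (Monad.comparison adj).obj (X.hom x y) ⟶
        (Monad.comparison adj).obj (Y.hom (o x) (o y)) := ⟨m x y, h' x y⟩
    refine ⟨⟨o, fun x y => (Monad.comparison adj).preimage (φ x y)⟩, ?_⟩
    ext1
    refine hom_ext' (o := o) rfl rfl fun x y => ?_
    exact congrArg Monad.Algebra.Hom.f ((Monad.comparison adj).map_preimage (φ x y))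

theorem essSurj_comparison_mapAdj : (Monad.comparison (mapAdj adj)).EssSurj where
  mem_essImage A := by
    obtain ⟨X, ⟨o, m⟩, hu, ha⟩ := A
    obtain rfl : o = fun x => x := congrArg Hom.obj hu
    have hu' := map_eq_of_mk_eq (o := fun x => x) hu
    have ha' := map_eq_of_mk_eq (X := (map (F ⋙ U ⋙ F ⋙ U)).obj X) (Y := X) (o := fun x => x)
      (m := fun x y => U.map (adj.counit.app (F.obj (X.hom x y))) ≫ m x y)
      (m' := fun x y => U.map (F.map (m x y)) ≫ m x y) ha
    let P (x y : X.vertex) : adj.toMonad.Algebra :=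
      { A := X.hom x y
        a := m x y
        unit := hu' x y
        assoc := ha' x y }
    let i (x y) := (Monad.comparison adj).objObjPreimageIso (P x y)
    refine ⟨⟨X.vertex, fun x y => (Monad.comparison adj).objPreimage (P x y)⟩,
      ⟨Monad.Algebra.isoMk
        { hom := ⟨fun x => x, fun x y => (i x y).hom.f⟩
          inv := ⟨fun x => x, fun x y => (i x y).inv.f⟩
          hom_inv_id := hom_ext' (o := fun x => x) rfl rfl fun x y =>
            congrArg Monad.Algebra.Hom.f (i x y).hom_inv_id
          inv_hom_id := hom_ext' (o := fun x => x) rfl rfl fun x y =>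
            congrArg Monad.Algebra.Hom.f (i x y).inv_hom_id } ?_⟩⟩
    exact hom_ext' (o := fun x => x) rfl rfl fun x y => (i x y).hom.h

/-- Monadicity is inherited by categories of enriched graphs. -/
theorem isEquivalence_comparison_mapAdj : (Monad.comparison (mapAdj adj)).IsEquivalence :=
  haveI := full_comparison_mapAdj adj
  haveI := essSurj_comparison_mapAdj adj
  haveI := faithful_of_isEquivalence_comparison adj
  { }

end Gph

/-! ### The Beck-Chevalley condition -/

section BeckChevalley

variable {A B A' B' : Type*} [Category* A] [Category* B] [Category* A'] [Category* B']
  {F : B ⥤ A} {U : A ⥤ B} (adj : F ⊣ U) {F' : B' ⥤ A'} {U' : A' ⥤ B'} (adj' : F' ⊣ U')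
  {S : A ⥤ A'} {R : B ⥤ B'} (i : S ⋙ U' ≅ U ⋙ R)

/-- The Beck-Chevalley condition: `S` carries the free objects on `X` to free objects on `R X`. -/
def BeckChevalley : Prop :=
  ∀ X : B, ∃ ψ : F'.obj (R.obj X) ≅ S.obj (F.obj X),
    adj'.unit.app (R.obj X) ≫ U'.map ψ.hom ≫ i.hom.app (F.obj X) = R.map (adj.unit.app X)

variable {adj adj' i}

/-- Free objects for a composite are formed in two stages, and the comparisons of the stages
compose. The isomorphism `k` is a separate argument, tied to the pasting by `hk`, so that the lemma
applies to isomorphisms defined otherwise, such as `UIso`. -/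
theorem BeckChevalley.comp {C C' : Type*} [Category* C] [Category* C'] {G : C ⥤ B} {H : B ⥤ C}
    {adj₂ : G ⊣ H} {G' : C' ⥤ B'} {H' : B' ⥤ C'} {adj₂' : G' ⊣ H'} {Q : C ⥤ C'}
    {j : R ⋙ H' ≅ H ⋙ Q} (h₂ : BeckChevalley adj₂ adj₂' j) (h : BeckChevalley adj adj' i)
    (k : S ⋙ U' ⋙ H' ≅ (U ⋙ H) ⋙ Q)
    (hk : ∀ X, k.hom.app X = H'.map (i.hom.app X) ≫ j.hom.app (U.obj X)) :
    BeckChevalley (adj₂.comp adj) (adj₂'.comp adj') k := by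
  intro X
  obtain ⟨ψ₂, e₂⟩ := h₂ X
  obtain ⟨ψ, e⟩ := h (G.obj X)
  refine ⟨F'.mapIso ψ₂ ≪≫ ψ, ?_⟩
  have n := j.hom.naturality (adj.unit.app (G.obj X))
  dsimp at n
  have n' := adj'.unit.naturality ψ₂.hom
  dsimp at n'
  rw [hk, Adjunction.comp_unit_app, Adjunction.comp_unit_app]
  change (adj₂'.unit.app (Q.obj X) ≫ H'.map (adj'.unit.app (G'.obj (Q.obj X)))) ≫
    H'.map (U'.map (F'.map ψ₂.hom ≫ ψ.hom)) ≫ H'.map (i.hom.app (F.obj (G.obj X))) ≫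
      j.hom.app (U.obj (F.obj (G.obj X))) =
    Q.map (adj₂.unit.app X ≫ H.map (adj.unit.app (G.obj X)))
  rw [CategoryTheory.Functor.map_comp Q, ← e₂, Category.assoc, Category.assoc, Category.assoc, ← n, ← e,
    Functor.map_comp U', ← Functor.map_comp_assoc, ← Functor.map_comp_assoc,
    ← Functor.map_comp_assoc]
  simp only [Category.assoc]
  rw [← Category.assoc (adj'.unit.app (G'.obj (Q.obj X))), ← n', Category.assoc]

/-- If `U'` is an equivalence, the units of `adj'` are invertible and `U'` reflects isomorphisms, so
only the images under `R` of the units of `adj` matter. -/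
theorem BeckChevalley.of_isEquivalence [U'.IsEquivalence]
    (h : ∀ X, IsIso (R.map (adj.unit.app X))) : BeckChevalley adj adj' i := by
  intro X
  have : F'.IsEquivalence := adj'.isEquivalence_left_of_isEquivalence_right
  let ψ : F'.obj (R.obj X) ⟶ S.obj (F.obj X) :=
    (adj'.homEquiv _ _).symm (R.map (adj.unit.app X) ≫ i.inv.app (F.obj X))
  have hψ : adj'.unit.app (R.obj X) ≫ U'.map ψ = R.map (adj.unit.app X) ≫ i.inv.app (F.obj X) := by
    exact (adj'.homEquiv_unit _ _ _).symm.trans (Equiv.apply_symm_apply _ _)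
  have : IsIso (adj'.unit.app (R.obj X) ≫ U'.map ψ) := by
    rw [hψ]
    infer_instance
  have : IsIso (U'.map ψ) := IsIso.of_isIso_comp_left (adj'.unit.app (R.obj X)) _
  have : IsIso ψ := isIso_of_reflects_iso ψ U'
  refine ⟨asIso ψ, ?_⟩
  rw [asIso_hom, ← Category.assoc, hψ]
  simp

section

variable (adj adj' i)

/-- The mate of `i`. -/
def mate (X : B) : F'.obj (R.obj X) ⟶ S.obj (F.obj X) :=
  (adj'.homEquiv _ _).symm (R.map (adj.unit.app X) ≫ i.inv.app (F.obj X))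

theorem unit_mate (X : B) : adj'.unit.app (R.obj X) ≫ U'.map (mate adj adj' i X) =
    R.map (adj.unit.app X) ≫ i.inv.app (F.obj X) := by
  exact (adj'.homEquiv_unit _ _ _).symm.trans (Equiv.apply_symm_apply _ _)

theorem free_hom_ext {X : B'} {Y : A'} {f g : F'.obj X ⟶ Y}
    (h : adj'.unit.app X ≫ U'.map f = adj'.unit.app X ≫ U'.map g) : f = g := by
  exact (adj'.homEquiv _ _).injective
    ((adj'.homEquiv_unit _ _ _).trans (h.trans (adj'.homEquiv_unit _ _ _).symm))

theorem mate_naturality {X Y : B} (f : X ⟶ Y) :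
    F'.map (R.map f) ≫ mate adj adj' i Y = mate adj adj' i X ≫ S.map (F.map f) := by
  refine free_hom_ext adj' ?_
  have n := i.inv.naturality (F.map f)
  dsimp at n
  have n' := adj'.unit.naturality (R.map f)
  dsimp at n'
  rw [Functor.map_comp, Functor.map_comp, ← Category.assoc, ← Category.assoc, ← n', unit_mate,
    Category.assoc, unit_mate, Category.assoc, ← n, ← Functor.map_comp_assoc,
    ← Functor.map_comp_assoc]
  simp

/-- Compatibility of the mate with counits, obtained by testing on generators. It yields the
multiplication law of `weakMonadMap` and the agreement of algebra structures in `comparisonIso`. -/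
theorem mate_counit (a : A) :
    F'.map (i.hom.app a) ≫ mate adj adj' i (U.obj a) ≫ S.map (adj.counit.app a) =
      adj'.counit.app (S.obj a) := by
  refine free_hom_ext adj' ?_
  have n : R.map (U.map (adj.counit.app a)) ≫ i.inv.app a =
      i.inv.app (F.obj (U.obj a)) ≫ U'.map (S.map (adj.counit.app a)) :=
    i.inv.naturality (adj.counit.app a)
  have n' : i.hom.app a ≫ adj'.unit.app (R.obj (U.obj a)) =
      adj'.unit.app (U'.obj (S.obj a)) ≫ U'.map (F'.map (i.hom.app a)) :=
    adj'.unit.naturality (i.hom.app a)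
  have r : i.hom.app a ≫ R.map (𝟙 (U.obj a)) ≫ i.inv.app a = 𝟙 (U'.obj (S.obj a)) :=
    (congrArg (fun t => i.hom.app a ≫ t ≫ i.inv.app a) (R.map_id _)).trans
      ((congrArg (i.hom.app a ≫ ·) (Category.id_comp _)).trans (i.hom_inv_id_app a))
  change adj'.unit.app (U'.obj (S.obj a)) ≫ U'.map (F'.map (i.hom.app a) ≫ _ ≫ _) =
    adj'.unit.app (U'.obj (S.obj a)) ≫ U'.map (adj'.counit.app (S.obj a))
  rw [Functor.map_comp, Functor.map_comp, ← Category.assoc, ← n', Category.assoc,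
    ← Category.assoc (adj'.unit.app _), unit_mate, Category.assoc, ← n, ← Functor.map_comp_assoc,
    adj.right_triangle_components, r, adj'.right_triangle_components]

end

/-- The mate is the only map compatible with the units, so it coincides with the isomorphism that
the condition provides. -/
theorem BeckChevalley.isIso_mate (h : BeckChevalley adj adj' i) (X : B) :
    IsIso (mate adj adj' i X) := by
  obtain ⟨ψ, e⟩ := h X
  suffices mate adj adj' i X = ψ.hom by
    rw [this]
    infer_instance
  refine free_hom_ext adj' ?_
  rw [unit_mate, ← e]
  simp

/-- A Beck-Chevalley square induces a weak map of monads. -/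
def BeckChevalley.weakMonadMap (h : BeckChevalley adj adj' i) :
    WeakMonadMap adj.toMonad adj'.toMonad R where
  iso := NatIso.ofComponents
    (fun X => U'.mapIso (@asIso _ _ _ _ _ (h.isIso_mate X)) ≪≫ i.app (F.obj X))
    (fun {X Y} f => by
      have n := i.hom.naturality (F.map f)
      dsimp at n
      change U'.map (F'.map (R.map f)) ≫ U'.map (mate adj adj' i Y) ≫ i.hom.app (F.obj Y) =
        (U'.map (mate adj adj' i X) ≫ i.hom.app (F.obj X)) ≫ R.map (U.map (F.map f))
      rw [← Functor.map_comp_assoc, mate_naturality, Functor.map_comp_assoc, n, Category.assoc])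
  unit X := by
    change adj'.unit.app (R.obj X) ≫ U'.map (mate adj adj' i X) ≫ i.hom.app (F.obj X) =
      R.map (adj.unit.app X)
    rw [← Category.assoc, unit_mate]
    simp
  mul X := by
    have n := i.hom.naturality (adj.counit.app (F.obj X))
    dsimp at n
    have c := mate_counit adj adj' i (F.obj X)
    have c' : adj'.counit.app (F'.obj (R.obj X)) ≫ mate adj adj' i X =
        F'.map (U'.map (mate adj adj' i X)) ≫ adj'.counit.app (S.obj (F.obj X)) :=
      (adj'.counit_naturality (mate adj adj' i X)).symm
    change U'.map (adj'.counit.app (F'.obj (R.obj X))) ≫ U'.map (mate adj adj' i X) ≫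
        i.hom.app (F.obj X) =
      U'.map (F'.map (U'.map (mate adj adj' i X) ≫ i.hom.app (F.obj X))) ≫
        (U'.map (mate adj adj' i (U.obj (F.obj X))) ≫ i.hom.app (F.obj (U.obj (F.obj X)))) ≫
        R.map (U.map (adj.counit.app (F.obj X)))
    rw [Category.assoc, ← n, ← Functor.map_comp_assoc, ← Functor.map_comp_assoc,
      ← Functor.map_comp_assoc, c', ← c, Functor.map_comp F']
    simp only [Category.assoc]

/-- The functor between categories of algebras induced by a Beck-Chevalley square lifts `S`. -/
def BeckChevalley.comparisonIso (h : BeckChevalley adj adj' i) :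
    S ⋙ Monad.comparison adj' ≅ Monad.comparison adj ⋙ h.weakMonadMap.algebraFunctor :=
  NatIso.ofComponents
    (fun a => Monad.Algebra.isoMk (i.app a) (by
      have n := i.hom.naturality (adj.counit.app a)
      dsimp at n
      have c := mate_counit adj adj' i a
      change U'.map (F'.map (i.hom.app a)) ≫ (U'.map (mate adj adj' i (U.obj a)) ≫
          i.hom.app (F.obj (U.obj a))) ≫ R.map (U.map (adj.counit.app a)) =
        U'.map (adj'.counit.app (S.obj a)) ≫ i.hom.app a
      rw [Category.assoc, ← n, ← c]
      simp only [Functor.map_comp, Category.assoc]))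
    (fun {a b} f => by
      ext1
      exact i.hom.naturality f)

end BeckChevalley

/-! ### Graphs enriched in globular sets are globular sets -/

namespace GlobeHom

/-- Raising all dimensions by one. -/
def succ : ∀ {m n : ℕ}, GlobeHom m n → GlobeHom (m + 1) (n + 1)
  | m, _, id _ => id (m + 1)
  | _, _, src h => src (Nat.succ_lt_succ h)
  | _, _, tgt h => tgt (Nat.succ_lt_succ h)

theorem succ_comp {l m : ℕ} (f : GlobeHom l m) :
    ∀ {n : ℕ} (g : GlobeHom m n), (f.comp g).succ = f.succ.comp g.succ
  | _, id _ => rfl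
  | _, src _ => rfl
  | _, tgt _ => rfl

theorem succ_pred : ∀ {m n : ℕ} (f : GlobeHom (m + 1) (n + 1)), f.pred.succ = f
  | _, _, id _ => rfl
  | _, _, src _ => rfl
  | _, _, tgt _ => rfl

theorem pred_succ : ∀ {m n : ℕ} (f : GlobeHom m n), f.succ.pred = f
  | _, _, id _ => rfl
  | _, _, src _ => rfl
  | _, _, tgt _ => rfl

end GlobeHom

namespace Gph

section fib

variable {α : Type u} {P : α → α → Type u}

/-- The element of `P a b` given by an element of the total space lying over `(a, b)`. -/
def fib (z : Σ x y, P x y) {a b : α} (h₁ : z.1 = a) (h₂ : z.2.1 = b) : P a b :=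
  h₁ ▸ h₂ ▸ z.2.2

theorem mk_fib (z : Σ x y, P x y) {a b : α} (h₁ : z.1 = a) (h₂ : z.2.1 = b) :
    (⟨a, b, fib z h₁ h₂⟩ : Σ x y, P x y) = z := by
  obtain ⟨x, y, p⟩ := z
  obtain rfl := h₁
  obtain rfl := h₂
  rfl

theorem mk_injective {a b : α} {p q : P a b} (h : (⟨a, b, p⟩ : Σ x y, P x y) = ⟨a, b, q⟩) :
    p = q := by
  simpa using h

end fib

variable {n : ℕ}

instance : (toGlob.{u} n).Faithful where
  map_injective {X Y f g} h := by
    have h0 : ∀ (k : ℕ) (hk : k ≤ n + 1) (c : X.Cell k hk), cellApp f hk c = cellApp g hk c :=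
      fun k hk c => ConcreteCategory.congr_hom (congrArg (fun t => NatTrans.app t (globe k hk)) h) c
    obtain ⟨o, m⟩ := f
    obtain ⟨o', m'⟩ := g
    obtain rfl : o = o' := funext (h0 0 (Nat.zero_le _))
    refine congrArg (Hom.mk o) (funext fun x => funext fun y => ?_)
    ext ⟨⟨k⟩, hk⟩ c
    exact mk_injective (P := fun a b => (Y.hom a b).obj (globe k hk))
      (h0 (k + 1) (Nat.succ_le_succ hk) ⟨x, y, c⟩)

section

variable {X Y : Gph.{u} (NGlobSet.{u} n)} (φ : (toGlob n).obj X ⟶ (toGlob n).obj Y)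

/-- The action on cells of a map of globular sets. -/
def cellFun {k : ℕ} (hk : k ≤ n + 1) (c : X.Cell k hk) : Y.Cell k hk :=
  φ.app (globe k hk) c

theorem cellFun_cellMap {k l : ℕ} (hk : k ≤ n + 1) (hl : l ≤ n + 1) (f : GlobeHom k l)
    (c : X.Cell k hk) : cellFun φ hl (X.cellMap hk hl f c) = Y.cellMap hk hl f (cellFun φ hk c) :=
  NatTrans.naturality_apply φ (globeHom f) c

/-- Naturality at the iterated source. Together with `cellFun_tgt` it places the image of a cell of
`X(x, y)` in the hom-object required by `ofGlobMap`. -/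
theorem cellFun_src {k : ℕ} (hk : k + 1 ≤ n + 1) (x y : X.vertex)
    (c : (X.hom x y).obj (globe k (Nat.le_of_succ_le_succ hk))) :
    (cellFun φ hk ⟨x, y, c⟩).1 = cellFun φ (Nat.zero_le _) x :=
  (cellFun_cellMap φ hk (Nat.zero_le _) (.src (Nat.succ_pos _)) ⟨x, y, c⟩).symm

theorem cellFun_tgt {k : ℕ} (hk : k + 1 ≤ n + 1) (x y : X.vertex)
    (c : (X.hom x y).obj (globe k (Nat.le_of_succ_le_succ hk))) :
    (cellFun φ hk ⟨x, y, c⟩).2.1 = cellFun φ (Nat.zero_le _) y :=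
  (cellFun_cellMap φ hk (Nat.zero_le _) (.tgt (Nat.succ_pos _)) ⟨x, y, c⟩).symm

/-- The map of graphs given by a map of globular sets. -/
def ofGlobMap : X ⟶ Y where
  obj x := cellFun φ (Nat.zero_le _) x
  map x y :=
    { app := fun k => TypeCat.ofHom fun c =>
        fib (P := fun a b => (Y.hom a b).obj k)
          (cellFun φ (k := k.obj.dim + 1) (Nat.succ_le_succ k.property) ⟨x, y, c⟩)
          (cellFun_src φ _ x y c) (cellFun_tgt φ _ x y c)
      naturality := fun k l f => by
        ext c
        -- Equality in a fibre is tested in the total space, where `mk_fib` removes the transports.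
        refine mk_injective (P := fun a b => (Y.hom a b).obj l) ?_
        refine (mk_fib _ _ _).trans ?_
        have h := cellFun_cellMap φ (Nat.succ_le_succ k.property) (Nat.succ_le_succ l.property)
          f.hom.succ ⟨x, y, c⟩
        have h' := mk_fib (P := fun a b => (Y.hom a b).obj k)
          (cellFun φ (k := k.obj.dim + 1) (Nat.succ_le_succ k.property) ⟨x, y, c⟩)
          (cellFun_src φ _ x y c) (cellFun_tgt φ _ x y c)
        have e : f.hom.succ.pred = f.hom := GlobeHom.pred_succ f.hom
        have aux : ∀ (Z : Gph.{u} (NGlobSet.{u} n)) (x y : Z.vertex) (c : (Z.hom x y).obj k),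
            Z.cellMap (Nat.succ_le_succ k.property) (Nat.succ_le_succ l.property) f.hom.succ
              ⟨x, y, c⟩ = ⟨x, y, (Z.hom x y).map f c⟩ := by
          intro Z x y c
          refine congrArg (fun t => (⟨x, y, t⟩ : Σ a b, (Z.hom a b).obj l)) ?_
          change (Z.hom x y).map (globeHom f.hom.succ.pred) c = _
          rw [e]
          rfl
        exact (congrArg (cellFun φ (Nat.succ_le_succ l.property)) (aux X x y c)).symm.trans
          (h.trans ((congrArg _ h'.symm).trans (aux Y _ _ _))) }

theorem toGlob_map_ofGlobMap : (toGlob n).map (ofGlobMap φ) = φ := by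
  ext ⟨⟨k⟩, hk⟩ c
  obtain _ | k := k
  · rfl
  · exact mk_fib _ _ _

end

instance : (toGlob.{u} n).Full where
  map_surjective φ := ⟨ofGlobMap φ, toGlob_map_ofGlobMap φ⟩

/-! ### The graph of a globular set -/

section

variable (Z : NGlobSet.{u} (n + 1))

/-- The action of a map of the globe category on the cells of a globular set. -/
def act {k l : ℕ} (hk : k ≤ n + 1) (hl : l ≤ n + 1) (f : GlobeHom k l) (c : Z.obj (globe k hk)) :
    Z.obj (globe l hl) :=
  Z.map (globeHom f) c

theorem act_comp {k l m : ℕ} (hk : k ≤ n + 1) (hl : l ≤ n + 1) (hm : m ≤ n + 1) (f : GlobeHom k l)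
    (g : GlobeHom l m) (c : Z.obj (globe k hk)) :
    act Z hk hm (f.comp g) c = act Z hl hm g (act Z hk hl f c) :=
  Functor.map_comp_apply Z (globeHom f : globe k hk ⟶ globe l hl) (globeHom g) c

theorem act_id {k : ℕ} (hk : k ≤ n + 1) (c : Z.obj (globe k hk)) :
    act Z hk hk (.id k) c = c :=
  Functor.map_id_apply Z (globe k hk) c

/-- The cells of dimension `k + 1` with given `0`-dimensional source and target. -/
def cellsBetween (x y : Z.obj (globe 0 (Nat.zero_le _))) (k : ℕ) (hk : k + 1 ≤ n + 1) : Type u :=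
  { c : Z.obj (globe (k + 1) hk) // act Z hk (Nat.zero_le _) (.src (Nat.succ_pos _)) c = x ∧
    act Z hk (Nat.zero_le _) (.tgt (Nat.succ_pos _)) c = y }

/-- The globular identities: a composite in `GlobeHom` ending in `src` is `src`, whatever precedes
it. -/
theorem act_succ_src {k l : ℕ} (hk : k + 1 ≤ n + 1) (hl : l + 1 ≤ n + 1) (f : GlobeHom k l)
    (c : Z.obj (globe (k + 1) hk)) :
    act Z hl (Nat.zero_le _) (.src (Nat.succ_pos _)) (act Z hk hl f.succ c) =
      act Z hk (Nat.zero_le _) (.src (Nat.succ_pos _)) c := by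
  rw [← act_comp]
  rfl

theorem act_succ_tgt {k l : ℕ} (hk : k + 1 ≤ n + 1) (hl : l + 1 ≤ n + 1) (f : GlobeHom k l)
    (c : Z.obj (globe (k + 1) hk)) :
    act Z hl (Nat.zero_le _) (.tgt (Nat.succ_pos _)) (act Z hk hl f.succ c) =
      act Z hk (Nat.zero_le _) (.tgt (Nat.succ_pos _)) c := by
  rw [← act_comp]
  rfl

/-- The graph of a globular set. -/
def ofGlob : Gph.{u} (NGlobSet.{u} n) where
  vertex := Z.obj (globe 0 (Nat.zero_le _))
  hom x y :=
    { obj := fun k => cellsBetween Z x y k.obj.dim (Nat.succ_le_succ k.property)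
      map := fun {k l} f => TypeCat.ofHom fun c =>
        ⟨act Z _ (Nat.succ_le_succ l.property) f.hom.succ c.1,
          (act_succ_src Z _ _ _ _).trans c.2.1, (act_succ_tgt Z _ _ _ _).trans c.2.2⟩
      map_id := fun k => by
        ext c
        refine Subtype.ext ?_
        change act Z _ _ (GlobeHom.id (k.obj.dim + 1)) c.1 = c.1
        exact act_id Z _ c.1
      map_comp := fun {k l m} f g => by
        ext c
        refine Subtype.ext ?_
        change act Z _ _ (GlobeHom.succ (GlobeHom.comp f.hom g.hom)) c.1 =
          act Z _ _ g.hom.succ (act Z _ _ f.hom.succ c.1)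
        rw [GlobeHom.succ_comp, act_comp] }

/-- The cells of the graph of a globular set. -/
def ofGlobCell : ∀ {k : ℕ} (hk : k ≤ n + 1), (ofGlob Z).Cell k hk ≃ Z.obj (globe k hk)
  | 0, _ => Equiv.refl _
  | k + 1, hk =>
    { toFun := fun c => c.2.2.1
      invFun := fun c => ⟨_, _, c, rfl, rfl⟩
      left_inv := fun ⟨x, y, c, h₁, h₂⟩ => by
        subst h₁ h₂
        rfl
      right_inv := fun _ => rfl }

theorem ofGlobCell_cellMap : ∀ {k l : ℕ} (hk : k ≤ n + 1) (hl : l ≤ n + 1) (f : GlobeHom k l)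
    (c : (ofGlob Z).Cell k hk),
    ofGlobCell Z hl ((ofGlob Z).cellMap hk hl f c) = act Z hk hl f (ofGlobCell Z hk c)
  | 0, 0, _, _, .id _, c => (act_id Z _ c).symm
  | 0, _ + 1, _, _, f, _ => absurd f.le (Nat.not_succ_le_zero _)
  | _ + 1, 0, _, _, .src _, c => c.2.2.2.1.symm
  | _ + 1, 0, _, _, .tgt _, c => c.2.2.2.2.symm
  | _ + 1, _ + 1, _, _, f, c => by
    change act Z _ _ f.pred.succ c.2.2.1 = act Z _ _ f c.2.2.1
    rw [GlobeHom.succ_pred]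

/-- Every globular set is the globular set of a graph. -/
def toGlobOfGlob : (toGlob n).obj (ofGlob Z) ≅ Z :=
  NatIso.ofComponents (fun k => (ofGlobCell Z k.property).toIso) (fun {k l} f => by
    ext c
    exact ofGlobCell_cellMap Z k.property l.property f.hom c)

end

instance : (toGlob.{u} n).EssSurj where
  mem_essImage Z := ⟨ofGlob Z, ⟨toGlobOfGlob Z⟩⟩

instance : (toGlob.{u} n).IsEquivalence where

end Gph

/-! ### Walks -/

/-- Walks in a family of types of edges. -/
inductive Walk {α : Type u} (H : α → α → Type u) : α → α → Type u
  | nil (x : α) : Walk H x x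
  | cons {x y z : α} (e : H x y) (w : Walk H y z) : Walk H x z

namespace Walk

variable {α β γ : Type u} {H : α → α → Type u} {K : β → β → Type u} {M : γ → γ → Type u}

/-- The image of a walk. -/
def map (o : α → β) (h : ∀ {x y}, H x y → K (o x) (o y)) : ∀ {x z : α}, Walk H x z →
    Walk K (o x) (o z)
  | _, _, nil x => nil (o x)
  | _, _, cons e w => cons (h e) (w.map o h)

theorem map_map (o : α → β) (h : ∀ {x y}, H x y → K (o x) (o y)) (o' : β → γ)
    (h' : ∀ {x y}, K x y → M (o' x) (o' y)) {x z : α} (w : Walk H x z) :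
    (w.map o h).map o' h' = w.map (o' ∘ o) fun e => h' (h e) := by
  induction w with
  | nil x => rfl
  | cons e w ih => exact congrArg (cons _) ih

theorem map_id {h : ∀ x y, H x y → H x y} (e : ∀ x y a, h x y a = a)
    {x z : α} (w : Walk H x z) : w.map (fun x => x) (fun {x y} => h x y) = w := by
  induction w with
  | nil x => rfl
  | cons a w ih => exact congrArg₂ cons (e _ _ a) ih

/-- Concatenation of walks. -/
def append : ∀ {x y z : α}, Walk H x y → Walk H y z → Walk H x z
  | _, _, _, nil _, w => w
  | _, _, _, cons e v, w => cons e (v.append w)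

/-- The length of a walk. -/
def length : ∀ {x y : α}, Walk H x y → ℕ
  | _, _, nil _ => 0
  | _, _, cons _ v => v.length + 1

theorem length_append {x y z : α} (v : Walk H x y) (w : Walk H y z) :
    (v.append w).length = v.length + w.length := by
  induction v with
  | nil x => simp [append, length]
  | cons e v ih => simp [append, length, ih, Nat.add_right_comm]

theorem length_map (o : α → β) (h : ∀ {x y}, H x y → K (o x) (o y)) {x z : α} (w : Walk H x z) :
    (w.map o h).length = w.length := by
  induction w with
  | nil x => rfl
  | cons e w ih => exact congrArg (· + 1) ih

theorem map_append (o : α → β) (h : ∀ {x y}, H x y → K (o x) (o y)) {x y z : α} (v : Walk H x y)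
    (w : Walk H y z) : (v.append w).map o h = (v.map o h).append (w.map o h) := by
  induction v with
  | nil x => rfl
  | cons e v ih => exact congrArg (cons _) (ih w)

/-- The length of the first part decides where a walk is cut. The middle vertex belongs to the
conclusion, since the two cuts are not assumed to share it. -/
theorem append_inj {x y y' z : α} (v : Walk H x y) (v' : Walk H x y') (w : Walk H y z)
    (w' : Walk H y' z) (hl : v.length = v'.length) (h : v.append w = v'.append w') :
    (⟨y, v, w⟩ : Σ y, Walk H x y × Walk H y z) = ⟨y', v', w'⟩ := by
  induction v with
  | nil x =>
    cases v' with
    | nil => exact congrArg (fun t => (⟨_, nil _, t⟩ : Σ y, Walk H _ y × Walk H y z)) h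
    | cons e v' => simp [length] at hl
  | cons e v ih =>
    cases v' with
    | nil => simp [length] at hl
    | cons e' v' =>
      simp only [append, cons.injEq] at h
      obtain ⟨rfl, h1, h2⟩ := h
      obtain rfl := eq_of_heq h1
      have := ih v' w (by simpa [length] using hl) (eq_of_heq h2)
      simp only [Sigma.mk.injEq] at this
      obtain ⟨rfl, h3⟩ := this
      obtain ⟨rfl, rfl⟩ := Prod.mk.inj (eq_of_heq h3)
      rfl

theorem exists_append (m : ℕ) {x z : α} (w : Walk H x z) (h : m ≤ w.length) :
    ∃ (y : α) (v : Walk H x y) (v' : Walk H y z), v.length = m ∧ v.append v' = w := by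
  induction m generalizing x with
  | zero => exact ⟨x, nil x, w, rfl, rfl⟩
  | succ m ih =>
    cases w with
    | nil => simp [length] at h
    | cons e w =>
      obtain ⟨y, v, v', hv, rfl⟩ := ih w (by simpa [length] using h)
      exact ⟨y, cons e v, v', congrArg (· + 1) hv, rfl⟩

/-- The concatenation of a walk of walks. -/
def flatten : ∀ {x z : α}, Walk (Walk H) x z → Walk H x z
  | _, _, nil x => nil x
  | _, _, cons v W => v.append W.flatten

/-- The lengths of the walks in a walk of walks. -/
def lengths : ∀ {x z : α}, Walk (Walk H) x z → List ℕ
  | _, _, nil _ => []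
  | _, _, cons v W => v.length :: W.lengths

theorem sum_lengths {x z : α} (W : Walk (Walk H) x z) : W.lengths.sum = W.flatten.length := by
  induction W with
  | nil x => rfl
  | cons v W ih => simp [lengths, flatten, length_append, ih]

theorem lengths_map (o : α → β) (h : ∀ {x y}, H x y → K (o x) (o y)) {x z : α}
    (W : Walk (Walk H) x z) : (W.map o fun w => w.map o h).lengths = W.lengths := by
  induction W with
  | nil x => rfl
  | cons v W ih => exact congrArg₂ List.cons (v.length_map o h) ih

theorem flatten_map (o : α → β) (h : ∀ {x y}, H x y → K (o x) (o y)) {x z : α}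
    (W : Walk (Walk H) x z) : (W.map o fun w => w.map o h).flatten = W.flatten.map o h := by
  induction W with
  | nil x => rfl
  | cons v W ih => exact (congrArg (append _) ih).trans (map_append o h _ _).symm

/-- A bracketing of a walk amounts to a list of lengths. With `exists_flatten`, this identifies
walks of walks with pairs of a walk and a list of lengths of the right sum. -/
theorem eq_of_lengths_flatten {x z : α} (W W' : Walk (Walk H) x z) (hl : W.lengths = W'.lengths)
    (hf : W.flatten = W'.flatten) : W = W' := by
  induction W with
  | nil x =>
    cases W' with
    | nil => rfl
    | cons => simp [lengths] at hl
  | cons v W ih =>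
    cases W' with
    | nil => simp [lengths] at hl
    | cons v' W' =>
      simp only [lengths, List.cons.injEq] at hl
      have := append_inj v v' _ _ hl.1 hf
      simp only [Sigma.mk.injEq] at this
      obtain ⟨rfl, h3⟩ := this
      obtain ⟨rfl, h4⟩ := Prod.mk.inj (eq_of_heq h3)
      rw [ih W' hl.2 h4]

theorem exists_flatten (ls : List ℕ) {x z : α} (w : Walk H x z) (h : ls.sum = w.length) :
    ∃ W : Walk (Walk H) x z, W.lengths = ls ∧ W.flatten = w := by
  induction ls generalizing x with
  | nil =>
    cases w with
    | nil => exact ⟨nil _, rfl, rfl⟩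
    | cons => simp [length] at h
  | cons m ls ih =>
    obtain ⟨y, v, v', hv, rfl⟩ := exists_append m w (by simp at h; omega)
    obtain ⟨W, h1, h2⟩ := ih v' (by simp [length_append] at h; omega)
    exact ⟨cons v W, by simp [lengths, h1, hv], by simp [flatten, h2]⟩

/-- The concatenation of walks of walks is a cartesian operation. -/
theorem existsUnique_flatten (o : α → β) (h : ∀ {x y}, H x y → K (o x) (o y)) {x z : α}
    (w : Walk H x z) (W' : Walk (Walk K) (o x) (o z)) (e : W'.flatten = w.map o h) :
    ∃! W : Walk (Walk H) x z, W.flatten = w ∧ (W.map o fun w => w.map o h) = W' := by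
  -- Maps preserve lengths, so the bracketing of `W'` can be imposed on `w`.
  obtain ⟨W, h1, h2⟩ := exists_flatten W'.lengths w (by rw [sum_lengths, e, length_map])
  refine ⟨W, ⟨h2, eq_of_lengths_flatten _ _ ?_ ?_⟩, fun W₁ h' => eq_of_lengths_flatten _ _ ?_ ?_⟩
  · rw [lengths_map, h1]
  · rw [flatten_map, h2, e]
  · rw [h1, ← h'.2, lengths_map]
  · rw [h2, h'.1]

end Walk

/-! ### Elements of enriched categories -/

section Elements

variable {V : Type (u + 1)} [Category.{u} V] (L : V ⥤ Type u)

/-- The action of a functor to types on elements. -/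
def elMap {A B : V} (f : A ⟶ B) (a : L.obj A) : L.obj B := L.map f a

theorem elMap_comp {A B C : V} (f : A ⟶ B) (g : B ⟶ C) (a : L.obj A) :
    elMap L (f ≫ g) a = elMap L g (elMap L f a) :=
  Functor.map_comp_apply L f g a

theorem elMap_id {A : V} (a : L.obj A) : elMap L (𝟙 A) a = a :=
  Functor.map_id_apply L A a

variable [CartesianMonoidalCategory V] [PreservesFiniteProducts L]

theorem elPair_bijective (A B : V) :
    Function.Bijective fun p : L.obj (A ⊗ B) => (elMap L (fst A B) p, elMap L (snd A B) p) :=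
  (isIso_iff_bijective (CartesianMonoidalCategory.prodComparison L A B)).1 inferInstance

theorem el_ext {A B : V} {p q : L.obj (A ⊗ B)} (h₁ : elMap L (fst A B) p = elMap L (fst A B) q)
    (h₂ : elMap L (snd A B) p = elMap L (snd A B) q) : p = q :=
  (elPair_bijective L A B).1 (Prod.ext h₁ h₂)

/-- The element of a product with given components. -/
def elPair {A B : V} (a : L.obj A) (b : L.obj B) : L.obj (A ⊗ B) :=
  ((elPair_bijective L A B).2 (a, b)).choose

theorem elMap_fst_elPair {A B : V} (a : L.obj A) (b : L.obj B) :
    elMap L (fst A B) (elPair L a b) = a :=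
  congrArg Prod.fst ((elPair_bijective L A B).2 (a, b)).choose_spec

theorem elMap_snd_elPair {A B : V} (a : L.obj A) (b : L.obj B) :
    elMap L (snd A B) (elPair L a b) = b :=
  congrArg Prod.snd ((elPair_bijective L A B).2 (a, b)).choose_spec

theorem elPair_eta {A B : V} (p : L.obj (A ⊗ B)) :
    elPair L (elMap L (fst A B) p) (elMap L (snd A B) p) = p :=
  el_ext L (elMap_fst_elPair L _ _) (elMap_snd_elPair L _ _)

theorem elMap_tensor {A B A' B' : V} (f : A ⟶ A') (g : B ⟶ B') (a : L.obj A) (b : L.obj B) :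
    elMap L (f ⊗ₘ g) (elPair L a b) = elPair L (elMap L f a) (elMap L g b) := by
  apply el_ext <;>
  simp only [← elMap_comp, tensorHom_fst, tensorHom_snd, elMap_fst_elPair, elMap_snd_elPair] <;>
  simp only [elMap_comp, elMap_fst_elPair, elMap_snd_elPair]

theorem elMap_whiskerLeft {A B B' : V} (g : B ⟶ B') (a : L.obj A) (b : L.obj B) :
    elMap L (A ◁ g) (elPair L a b) = elPair L a (elMap L g b) := by
  rw [← id_tensorHom, elMap_tensor, elMap_id]

theorem elMap_whiskerRight {A B A' : V} (f : A ⟶ A') (a : L.obj A) (b : L.obj B) :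
    elMap L (f ▷ B) (elPair L a b) = elPair L (elMap L f a) b := by
  rw [← tensorHom_id, elMap_tensor, elMap_id]

theorem elUnit_bijective : Function.Bijective fun _ : L.obj (𝟙_ V) => PUnit.unit.{u + 1} :=
  (isIso_iff_bijective (CartesianMonoidalCategory.terminalComparison L)).1 inferInstance

/-- The element of the terminal object. -/
def elUnit : L.obj (𝟙_ V) := ((elUnit_bijective L).2 PUnit.unit).choose

theorem elUnit_ext (a b : L.obj (𝟙_ V)) : a = b := (elUnit_bijective L).1 rfl

variable {C : Type u} [EnrichedCategory V C]

/-- The identity element. -/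
def elId (x : C) : L.obj (x ⟶[V] x) := elMap L (eId V x) (elUnit L)

/-- Composition of elements. -/
def elComp {x y z : C} (a : L.obj (x ⟶[V] y)) (b : L.obj (y ⟶[V] z)) : L.obj (x ⟶[V] z) :=
  elMap L (eComp V x y z) (elPair L a b)

theorem elId_elComp {x y : C} (a : L.obj (x ⟶[V] y)) : elComp L (elId L x) a = a := by
  have h := congrArg (fun t => elMap L t a) (e_id_comp V x y)
  rw [elMap_id, elMap_comp, elMap_comp] at h
  have e : elMap L (λ_ (x ⟶[V] y)).inv a = elPair L (elUnit L) a := by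
    refine el_ext L (elUnit_ext L _ _) ?_
    rw [elMap_snd_elPair, ← elMap_comp, leftUnitor_inv_snd, elMap_id]
  rw [e, elMap_whiskerRight] at h
  exact h

theorem elComp_assoc {x y z w : C} (a : L.obj (x ⟶[V] y)) (b : L.obj (y ⟶[V] z))
    (c : L.obj (z ⟶[V] w)) : elComp L (elComp L a b) c = elComp L a (elComp L b c) := by
  have h := congrArg (fun t => elMap L t (elPair L a (elPair L b c))) (e_assoc V x y z w)
  rw [elMap_comp, elMap_comp, elMap_comp, elMap_whiskerLeft] at h
  have e : elMap L (α_ (x ⟶[V] y) (y ⟶[V] z) (z ⟶[V] w)).inv (elPair L a (elPair L b c)) =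
      elPair L (elPair L a b) c := by
    apply el_ext
    · apply el_ext
      · rw [elMap_fst_elPair, ← elMap_comp, ← elMap_comp, associator_inv_fst_fst,
          elMap_fst_elPair, elMap_fst_elPair]
      · rw [elMap_fst_elPair, ← elMap_comp, ← elMap_comp, associator_inv_fst_snd,
          elMap_comp, elMap_snd_elPair, elMap_fst_elPair, elMap_snd_elPair]
    · rw [elMap_snd_elPair, ← elMap_comp, associator_inv_snd, elMap_comp, elMap_snd_elPair,
        elMap_snd_elPair]
  rw [e, elMap_whiskerRight] at h
  exact h

variable (C) in
/-- The types of elements of the hom-objects. -/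
abbrev elHom (x y : C) : Type u := L.obj (x ⟶[V] y)

/-- The composite of a walk of elements. -/
def elCompose : ∀ {x z : C}, Walk (elHom L C) x z → L.obj (x ⟶[V] z)
  | _, _, .nil x => elId L x
  | _, _, .cons e w => elComp L e (elCompose w)

theorem elCompose_append {x y z : C} (v : Walk (elHom L C) x y) (w : Walk (elHom L C) y z) :
    elCompose L (v.append w) = elComp L (elCompose L v) (elCompose L w) := by
  induction v with
  | nil x => exact (elId_elComp L _).symm
  | cons e v ih => exact (congrArg (elComp L e) (ih w)).trans (elComp_assoc L _ _ _).symm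

theorem elCompose_flatten {x z : C} (W : Walk (Walk (elHom L C)) x z) :
    elCompose L W.flatten = elCompose L (W.map (fun x => x) (elCompose L)) := by
  induction W with
  | nil x => rfl
  | cons v W ih => exact (elCompose_append L _ _).trans (congrArg (elComp L _) ih)

end Elements

/-! ### Elements of free enriched categories are walks -/

theorem bijective_sigma {V : Type (u + 1)} [Category.{u} V] [HasCoproducts.{u} V] (L : V ⥤ Type u)
    [∀ J : Type u, PreservesColimitsOfShape (Discrete J) L]
    {J : Type u} (A : J → V) :
    Function.Bijective fun p : Σ j, L.obj (A j) => elMap L (Sigma.ι A p.1) p.2 :=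
  (Cofan.nonempty_isColimit_iff_bijective_fromSigma
    (Cofan.mk _ fun j => L.map (Sigma.ι A j))).1 ⟨isColimitMapCoconeCofanMkEquiv L _ _
    (isColimitOfPreserves L (coproductIsCoproduct A))⟩

namespace Gph

variable {V : Type (u + 1)} [Category.{u} V] [CartesianMonoidalCategory V] (L : V ⥤ Type u)
  [PreservesFiniteProducts L] (X : Gph.{u} V)

/-- The types of elements of the edges of a graph. -/
abbrev elEdge (x y : X.vertex) : Type u := L.obj (X.hom x y)

/-- The sequence of vertices of a walk. -/
def walkPath : ∀ {x z : X.vertex}, Walk (X.elEdge L) x z → VPath X.vertex x z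
  | _, _, .nil x => .nil x
  | _, _, .cons (x := x) _ w => .cons x (walkPath w)

/-- The element of a product of hom-objects given by a walk. -/
def walkOb : ∀ {x z : X.vertex} (w : Walk (X.elEdge L) x z), L.obj (X.pathObj (X.walkPath L w))
  | _, _, .nil x => elUnit L
  | _, _, .cons e w => elPair L e (walkOb w)

/-- The walk given by an element of a product of hom-objects. -/
def pathWalk : ∀ {x z : X.vertex} (p : VPath X.vertex x z), L.obj (X.pathObj p) →
    Walk (X.elEdge L) x z
  | _, _, .nil x, _ => .nil x
  | _, _, .cons x (y := y) p, a =>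
    .cons (elMap L (fst (X.hom x y) (X.pathObj p)) a)
      (pathWalk p (elMap L (snd (X.hom x y) (X.pathObj p)) a))

theorem pathWalk_walkOb {x z : X.vertex} (w : Walk (X.elEdge L) x z) :
    X.pathWalk L (X.walkPath L w) (X.walkOb L w) = w := by
  induction w with
  | nil x => rfl
  | cons e w ih =>
    change Walk.cons (elMap L _ (elPair L _ _)) (X.pathWalk L _ (elMap L _ (elPair L _ _))) = _
    rw [elMap_fst_elPair, elMap_snd_elPair, ih]

variable [IsDistrib V]

/-- The element of the free enriched category given by a walk. -/
def walkEl : ∀ {x z : X.vertex}, Walk (X.elEdge L) x z → L.obj (X.freeHom x z)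
  | _, _, .nil x => elMap L (X.freeNil x) (elUnit L)
  | _, _, .cons e w => elMap L (X.freePre _ _ _) (elPair L e (walkEl w))

theorem walkEl_eq {x z : X.vertex} (w : Walk (X.elEdge L) x z) :
    X.walkEl L w = elMap L (X.freeι (X.walkPath L w)) (X.walkOb L w) := by
  induction w with
  | nil x => rfl
  | cons e w ih =>
    change elMap L _ (elPair L _ _) = elMap L (X.freeCons _ _) (elPair L _ _)
    rw [ih, ← ι_freePre, elMap_comp, elMap_whiskerLeft]

theorem walkEl_pathWalk {x z : X.vertex} (p : VPath X.vertex x z) (a : L.obj (X.pathObj p)) :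
    X.walkEl L (X.pathWalk L p a) = elMap L (X.freeι p) a := by
  induction p with
  | nil x => exact congrArg _ (elUnit_ext L _ _)
  | cons x p ih =>
    rename_i y t
    have key : ∀ a : L.obj (X.hom x y ⊗ X.pathObj p), elMap L (X.freePre _ _ _)
        (elPair L (elMap L (fst _ _) a) (elMap L (X.freeι p) (elMap L (snd _ _) a))) =
          elMap L (X.freeCons x p) a := fun a => by
      rw [← ι_freePre, elMap_comp, ← elMap_whiskerLeft, elPair_eta]
    exact (congrArg (fun t => elMap L (X.freePre _ _ _) (elPair L _ t)) (ih _)).trans (key a)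

/-- Since `L` preserves coproducts and finite products, an element of a free hom-object is a
sequence of vertices with one element of each consecutive hom-object, which is exactly a walk. -/
theorem walkEl_bijective [∀ J : Type u, PreservesColimitsOfShape (Discrete J) L] (x z : X.vertex) :
    Function.Bijective (X.walkEl L (x := x) (z := z)) := by
  have h := bijective_sigma L fun p : VPath X.vertex x z => X.pathObj p
  constructor
  · intro w w' e
    rw [walkEl_eq, walkEl_eq] at e
    have := h.1 (a₁ := ⟨_, X.walkOb L w⟩) (a₂ := ⟨_, X.walkOb L w'⟩) e
    rw [← X.pathWalk_walkOb L w, ← X.pathWalk_walkOb L w']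
    exact congrArg (fun p : Σ p : VPath X.vertex x z, L.obj (X.pathObj p) => X.pathWalk L p.1 p.2)
      this
  · intro a
    obtain ⟨⟨p, b⟩, hb⟩ := h.2 a
    exact ⟨X.pathWalk L p b, (X.walkEl_pathWalk L p b).trans hb⟩

/-- Prepending an edge is composing with it, so the element named by a walk is the composite of its
edges. In this form it can be followed through enriched functors and change of base. -/
theorem walkEl_eq_elCompose {x z : X.vertex} (w : Walk (X.elEdge L) x z) :
    X.walkEl L w = elCompose (C := X.free.carrier) L
      (w.map (K := elHom L X.free.carrier) (fun x => x) fun {x y} a => elMap L (X.freeEdge x y) a) := by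
  induction w with
  | nil x => rfl
  | cons e w ih =>
    rename_i x y z
    have key : elMap L (X.freePre x y z) (elPair L e (X.walkEl L w)) =
        elMap L (X.freeComp x y z) (elPair L (elMap L (X.freeEdge x y) e) (X.walkEl L w)) := by
      rw [← elMap_whiskerRight, ← freeEdge_freeComp, elMap_comp]
    exact key.trans (congrArg (fun t => elMap L (X.freeComp x y z)
      (elPair L (elMap L (X.freeEdge x y) e) t)) ih)

section

variable {X} {C : Type u} [EnrichedCategory V C] (o : X.vertex → C)
  (m : ∀ x y, X.hom x y ⟶ (o x ⟶[V] o y))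

theorem elMap_freeMap {x z : X.vertex} (w : Walk (X.elEdge L) x z) :
    elMap L (freeMap o m x z) (X.walkEl L w) =
      elCompose L (w.map (K := elHom L C) o fun {x y} a => elMap L (m x y) a) := by
  induction w with
  | nil x =>
    change elMap L _ (elMap L _ _) = elMap L _ _
    rw [← elMap_comp, freeNil_freeMap]
  | cons e w ih =>
    change elMap L _ (elMap L _ (elPair L _ _)) = elMap L _ (elPair L _ (elCompose L _))
    rw [← ih, ← elMap_comp, freePre_freeMap, elMap_comp, elMap_tensor]

end

end Gph

/-! ### Jointly conservative families of functors to types -/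

/-- A jointly conservative family of functors to types that preserve finite products and small
coproducts. -/
structure CellFamily {V : Type (u + 1)} [Category.{u} V] {ι : Type*} (c : ι → V ⥤ Type u) :
    Prop where
  products (i : ι) : PreservesFiniteProducts (c i)
  coproducts (i : ι) (J : Type u) : PreservesColimitsOfShape (Discrete J) (c i)
  isIso {A B : V} (f : A ⟶ B) : (∀ i, Function.Bijective (elMap (c i) f)) → IsIso f

section

variable {V : Type (u + 1)} [Category.{u} V] [CartesianMonoidalCategory V]

/-- The symmetry of the cartesian product. -/
def swapIso (A B : V) : A ⊗ B ≅ B ⊗ A where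
  hom := lift (snd A B) (fst A B)
  inv := lift (snd B A) (fst B A)
  hom_inv_id := by ext <;> simp
  inv_hom_id := by ext <;> simp

theorem swapIso_naturality (A : V) {B C : V} (f : B ⟶ C) :
    A ◁ f ≫ (swapIso A C).hom = (swapIso A B).hom ≫ f ▷ A := by
  simp only [swapIso]
  ext <;> simp

/-- Products on the left are products on the right. -/
def tensorLeftIsoTensorRight (A : V) : tensorLeft A ≅ tensorRight A :=
  NatIso.ofComponents (fun B => swapIso A B) (fun f => swapIso_naturality A f)

/-- Distributivity is the invertibility of a comparison map, which the family detects; on elements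
it is the distributivity of products of sets over disjoint unions. The right-handed form follows by
symmetry. -/
theorem CellFamily.isDistrib {ι : Type*} {c : ι → V ⥤ Type u} (hc : CellFamily c)
    [HasCoproducts.{u} V] : IsDistrib V := by
  have h : ∀ (A : V) (J : Type u), PreservesColimitsOfShape (Discrete J) (tensorLeft A) := by
    intro A J
    suffices ∀ B : J → V, IsIso (sigmaComparison (tensorLeft A) B) by
      have : ∀ B : J → V, PreservesColimit (Discrete.functor B) (tensorLeft A) := fun B => by
        have := this B
        exact PreservesCoproduct.of_iso_comparison _ _
      exact preservesColimitsOfShape_of_discrete _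
    intro B
    refine hc.isIso _ fun i => ?_
    have := hc.products i
    have := hc.coproducts i
    have e : ∀ (j : J) (p : (c i).obj (A ⊗ B j)), elMap (c i) (sigmaComparison (tensorLeft A) B)
        (elMap (c i) (Sigma.ι (fun j => A ⊗ B j) j) p) = elMap (c i) (A ◁ Sigma.ι B j) p :=
      fun j p => (elMap_comp _ _ _ _).symm.trans
        (congrArg (fun t => elMap (c i) t p) (ι_comp_sigmaComparison (tensorLeft A) B j))
    constructor
    · intro a b hab
      obtain ⟨⟨j, p⟩, rfl⟩ := (bijective_sigma (c i) fun j => A ⊗ B j).2 a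
      obtain ⟨⟨j', p'⟩, rfl⟩ := (bijective_sigma (c i) fun j => A ⊗ B j).2 b
      have hab' : elMap (c i) (A ◁ Sigma.ι B j) p = elMap (c i) (A ◁ Sigma.ι B j') p' :=
        (e j p).symm.trans (hab.trans (e j' p'))
      have h₁ := congrArg (elMap (c i) (fst _ _)) hab'
      have h₂ := congrArg (elMap (c i) (snd _ _)) hab'
      rw [← elMap_comp, ← elMap_comp, whiskerLeft_fst, whiskerLeft_fst] at h₁
      rw [← elMap_comp, ← elMap_comp, whiskerLeft_snd, whiskerLeft_snd, elMap_comp,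
        elMap_comp] at h₂
      have := (bijective_sigma (c i) B).1 (a₁ := ⟨j, _⟩) (a₂ := ⟨j', _⟩) h₂
      obtain ⟨rfl, h₃⟩ := Sigma.mk.inj this
      rw [el_ext (c i) h₁ (eq_of_heq h₃)]
    · intro (q : (c i).obj (A ⊗ ∐ B))
      obtain ⟨⟨j, b⟩, hb⟩ := (bijective_sigma (c i) B).2 (elMap (c i) (snd _ _) q)
      refine ⟨elMap (c i) (Sigma.ι (fun j => A ⊗ B j) j)
        (elPair (c i) (elMap (c i) (fst _ _) q) b), (e j _).trans ?_⟩
      rw [elMap_whiskerLeft]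
      exact (congrArg (elPair (c i) _) hb).trans (elPair_eta (c i) q)
  exact ⟨inferInstance, h, fun A J => by
    have := h A J
    exact preservesColimitsOfShape_of_natIso (tensorLeftIsoTensorRight A)⟩

end

/-! ### Change of base preserves free enriched categories -/

namespace VCat

variable {V W : Type (u + 1)} [Category.{u} V] [CartesianMonoidalCategory V] [Category.{u} W]
  [CartesianMonoidalCategory W] (L : V ⥤ W) [PreservesFiniteProducts L]

/-- Change of base commutes with the forgetful functors to graphs. -/
def changeBaseToGph : changeBase L ⋙ toGph W ≅ toGph V ⋙ Gph.map L :=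
  NatIso.ofComponents (fun _ => Iso.refl _)
    (fun _ => (Category.comp_id _).trans (Category.id_comp _).symm)

section

variable (c : W ⥤ Type u) [PreservesFiniteProducts c] (C : VCat.{u} V)

/-- The structure maps `ε` and `μ` of `L` are invisible on elements, because an element of a product
is determined by its components. -/
theorem elCompose_changeBase {x z : C.carrier} (w : Walk (elHom (L ⋙ c) C.carrier) x z) :
    elCompose (C := ((changeBase L).obj C).carrier) c w = elCompose (L ⋙ c) w := by
  let _ := Functor.Monoidal.ofChosenFiniteProducts L
  induction w with
  | nil x =>
    have h : elMap c (Functor.LaxMonoidal.ε L ≫ L.map (eId V x)) (elUnit c) =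
        elMap (L ⋙ c) (eId V x) (elUnit (L ⋙ c)) := by
      rw [elMap_comp]
      exact congrArg (elMap (L ⋙ c) (eId V x)) (elUnit_ext (L ⋙ c) _ _)
    exact h
  | cons e w ih =>
    rename_i x y z
    have h : ∀ (a : c.obj (L.obj (x ⟶[V] y))) (b : c.obj (L.obj (y ⟶[V] z))),
        elMap c (Functor.LaxMonoidal.μ L _ _ ≫ L.map (eComp V x y z)) (elPair c a b) =
          elMap (L ⋙ c) (eComp V x y z) (elPair (L ⋙ c) a b) := by
      intro a b
      rw [elMap_comp]
      refine congrArg (elMap (L ⋙ c) (eComp V x y z)) (el_ext (L ⋙ c) ?_ ?_)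
      · refine (elMap_comp c _ (L.map (fst _ _)) _).symm.trans ?_
        rw [Functor.Monoidal.μ_fst]
        exact (elMap_fst_elPair c _ _).trans (elMap_fst_elPair (L ⋙ c) _ _).symm
      · refine (elMap_comp c _ (L.map (snd _ _)) _).symm.trans ?_
        rw [Functor.Monoidal.μ_snd]
        exact (elMap_snd_elPair c _ _).trans (elMap_snd_elPair (L ⋙ c) _ _).symm
    exact (congrArg (elComp (C := ((changeBase L).obj C).carrier) c e) ih).trans (h e _)

end

variable [IsDistrib V] [IsDistrib W]

/-- The comparison between the free enriched categories. -/
def freeChangeBase (X : Gph.{u} V) : ((Gph.map L).obj X).free ⟶ (changeBase L).obj X.free :=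
  Gph.freeLift (V := W) (X := (Gph.map L).obj X) (C := (changeBase L).obj X.free)
    ((Gph.map L).map X.freeUnit)

/-- Both hom-objects have the walks in `X` as elements, and the comparison sends the element of a
walk to the element of the same walk. Coproducts need only be preserved by the composites `L ⋙ c i`,
which is what is known for truncation. -/
theorem isIso_freeChangeBase {ι : Type*} {c : ι → W ⥤ Type u} (hc : CellFamily c)
    (hL : ∀ i (J : Type u), PreservesColimitsOfShape (Discrete J) (L ⋙ c i)) (X : Gph.{u} V) :
    IsIso (freeChangeBase L X) := by
  refine isIso_mk (X := X.vertex) ((Gph.map L).obj X).free.str ((changeBase L).obj X.free).str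
    (freeChangeBase L X) rfl fun x z => hc.isIso _ fun i => ?_
  have := hc.products i
  have := hc.coproducts i
  have := hL i
  have h : ∀ w, elMap (c i) ((freeChangeBase L X).map x z)
      (((Gph.map L).obj X).walkEl (c i) (x := x) (z := z) w) = X.walkEl (L ⋙ c i) w := by
    intro w
    refine (Gph.elMap_freeMap (c i) (X := (Gph.map L).obj X)
      (C := ((changeBase L).obj X.free).carrier) _ _ w).trans ?_
    refine (elCompose_changeBase L (c i) X.free _).trans ?_
    exact (X.walkEl_eq_elCompose (L ⋙ c i) w).symm
  have h' := ((Gph.map L).obj X).walkEl_bijective (c i) x z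
  exact (Function.Bijective.of_comp_iff _ h').1
    ((funext h : (_ ∘ _) = _) ▸ X.walkEl_bijective (L ⋙ c i) x z)

theorem beckChevalley_changeBase {ι : Type*} {c : ι → W ⥤ Type u} (hc : CellFamily c)
    (hL : ∀ i (J : Type u), PreservesColimitsOfShape (Discrete J) (L ⋙ c i)) :
    BeckChevalley (Gph.freeAdj V) (Gph.freeAdj W) (changeBaseToGph L) := by
  intro X
  have := isIso_freeChangeBase L hc hL X
  refine ⟨@asIso _ _ _ _ (freeChangeBase L X) this, ?_⟩
  refine Eq.trans ?_ (congrArg (Gph.map L).map (Gph.freeAdj_unit_app X).symm)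
  refine (congrArg₂ (· ≫ ·) (Gph.freeAdj_unit_app ((Gph.map L).obj X)) (Category.comp_id _)).trans ?_
  exact Gph.freeUnit_freeLift (V := W) (X := (Gph.map L).obj X)
    (C := (changeBase L).obj X.free) ((Gph.map L).map X.freeUnit)

end VCat

/-! ### Enriched graphs -/

namespace Gph

theorem isIso_mk {V : Type (u + 1)} [Category.{u} V] {α : Type u} {H K : α → α → V}
    (m : ∀ x y, H x y ⟶ K x y) [∀ x y, IsIso (m x y)] :
    @IsIso (Gph.{u} V) _ ⟨α, H⟩ ⟨α, K⟩ (Hom.mk (X := ⟨α, H⟩) (Y := ⟨α, K⟩) (fun x => x) m) :=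
  ⟨⟨fun x => x, fun x y => inv (m x y)⟩,
    hom_ext' (X := ⟨α, H⟩) (Y := ⟨α, H⟩) (o := fun x => x) (m := fun x y => m x y ≫ inv (m x y))
      (m' := fun x y => 𝟙 (H x y)) rfl rfl fun x y => IsIso.hom_inv_id (m x y),
    hom_ext' (X := ⟨α, K⟩) (Y := ⟨α, K⟩) (o := fun x => x) (m := fun x y => inv (m x y) ≫ m x y)
      (m' := fun x y => 𝟙 (K x y)) rfl rfl fun x y => IsIso.inv_hom_id (m x y)⟩

variable {A B A' B' : Type (u + 1)} [Category.{u} A] [Category.{u} B] [Category.{u} A']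
  [Category.{u} B'] {F : B ⥤ A} {U : A ⥤ B} {adj : F ⊣ U} {F' : B' ⥤ A'} {U' : A' ⥤ B'}
  {adj' : F' ⊣ U'} {S : A ⥤ A'} {R : B ⥤ B'} {i : S ⋙ U' ≅ U ⋙ R}

variable (i) in
/-- The isomorphism induced on graphs by an isomorphism of composites. -/
def mapIsoComp : map S ⋙ map U' ≅ map U ⋙ map R := mapIso i

theorem beckChevalley_map (h : BeckChevalley adj adj' i) :
    BeckChevalley (mapAdj adj) (mapAdj adj') (mapIsoComp i) := by
  intro X
  choose ψ hψ using h
  have : @IsIso (Gph.{u} A') _ ((map F').obj ((map R).obj X)) ((map S).obj ((map F).obj X))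
      (Hom.mk (fun x => x) fun x y => (ψ (X.hom x y)).hom) :=
    isIso_mk (H := fun x y => F'.obj (R.obj (X.hom x y)))
      (K := fun x y => S.obj (F.obj (X.hom x y))) (fun x y => (ψ (X.hom x y)).hom)
  exact ⟨@asIso _ _ _ _ _ this,
    congrArg (Hom.mk _) (funext fun x => funext fun y => hψ (X.hom x y))⟩

/-- The inverse of `toGlob`, as a left adjoint. -/
def globAdj (n : ℕ) : (toGlob.{u} n).inv ⊣ toGlob.{u} n :=
  (toGlob.{u} n).asEquivalence.symm.toAdjunction

instance (n : ℕ) (X : NGlobSet.{u} (n + 1)) : IsIso ((globAdj n).unit.app X) :=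
  inferInstanceAs (IsIso ((toGlob.{u} n).asEquivalence.symm.unit.app X))

theorem beckChevalley_toGlob (n : ℕ) :
    BeckChevalley (globAdj.{u} (n + 1)) (globAdj.{u} n) (restrictIso n) :=
  BeckChevalley.of_isEquivalence fun _ => inferInstance

end Gph

section

/-! ### Functors to types that preserve pullbacks, coproducts and filtered colimits -/

variable {C : Type (u + 1)} [Category.{u} C]

/-- Preservation of pullbacks, small coproducts and filtered colimits by a functor to types, in
terms of elements. -/
structure ElPres (G : C ⥤ Type u) : Prop where
  pullback_ext {P X Y Z : C} {p : P ⟶ X} {q : P ⟶ Y} {f : X ⟶ Z} {g : Y ⟶ Z}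
    (h : IsPullback p q f g) (a b : G.obj P) (h₁ : elMap G p a = elMap G p b)
    (h₂ : elMap G q a = elMap G q b) : a = b
  pullback_exists {P X Y Z : C} {p : P ⟶ X} {q : P ⟶ Y} {f : X ⟶ Z} {g : Y ⟶ Z}
    (h : IsPullback p q f g) (a : G.obj X) (b : G.obj Y) (e : elMap G f a = elMap G g b) :
    ∃ c, elMap G p c = a ∧ elMap G q c = b
  coproduct {J : Type u} {A : J → C} {c : Cofan A} (hc : IsColimit c) :
    Function.Bijective fun s : Σ j, G.obj (A j) => elMap G (c.inj s.1) s.2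
  filtered_exists {J : Type u} [Category.{u} J] [IsFiltered J] {D : J ⥤ C} {c : Cocone D}
    (hc : IsColimit c) (x : G.obj c.pt) : ∃ j y, elMap G (c.ι.app j) y = x
  filtered_eq {J : Type u} [Category.{u} J] [IsFiltered J] {D : J ⥤ C} {c : Cocone D}
    (hc : IsColimit c) (j : J) (a b : G.obj (D.obj j))
    (e : elMap G (c.ι.app j) a = elMap G (c.ι.app j) b) :
    ∃ (k : J) (f : j ⟶ k), elMap G (D.map f) a = elMap G (D.map f) b

/-- The standard form of a cofan. -/
def cofanIso {J : Type u} {A : J → C} (c : Cofan A) : c ≅ Cofan.mk c.pt c.inj :=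
  Cocone.ext (Iso.refl _) (fun ⟨_⟩ => Category.comp_id _)

section Converse

variable (G : C ⥤ Type u)

theorem isPullback_map_iff {P X Y Z : C} {p : P ⟶ X} {q : P ⟶ Y} {f : X ⟶ Z} {g : Y ⟶ Z}
    (w : p ≫ f = q ≫ g) : IsPullback (G.map p) (G.map q) (G.map f) (G.map g) ↔
      (∀ a b, elMap G p a = elMap G p b → elMap G q a = elMap G q b → a = b) ∧
      ∀ a b, elMap G f a = elMap G g b → ∃ c, elMap G p c = a ∧ elMap G q c = b := by
  rw [Types.isPullback_iff]
  exact ⟨fun h => ⟨fun a b h₁ h₂ => h.2.1 a b ⟨h₁, h₂⟩, h.2.2⟩,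
    fun h => ⟨by rw [← Functor.map_comp, w, Functor.map_comp], fun a b h' => h.1 a b h'.1 h'.2,
      h.2⟩⟩

theorem preservesPullbacks_of_isPullback {D : Type*} [Category* D] (G : C ⥤ D)
    (h : ∀ {P X Y Z : C} {p : P ⟶ X} {q : P ⟶ Y} {f : X ⟶ Z} {g : Y ⟶ Z},
      IsPullback p q f g → IsPullback (G.map p) (G.map q) (G.map f) (G.map g)) :
    PreservesLimitsOfShape WalkingCospan G := by
  refine ⟨fun {K} => ?_⟩
  suffices ∀ {X Y Z : C} (f : X ⟶ Z) (g : Y ⟶ Z), PreservesLimit (cospan f g) G by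
    have := this (K.map WalkingCospan.Hom.inl) (K.map WalkingCospan.Hom.inr)
    exact preservesLimit_of_iso_diagram G (diagramIsoCospan K).symm
  intro X Y Z f g
  refine ⟨fun {c} hc => ?_⟩
  have e := h (IsPullback.of_isLimit hc)
  have t := (isLimitMapConePullbackConeEquiv G (PullbackCone.condition c)).symm e.isLimit
  exact ⟨IsLimit.ofIsoLimit t ((Cone.functoriality _ G).mapIso (PullbackCone.eta c).symm)⟩

variable {G}

theorem ElPres.preservesPullbacks (hG : ElPres G) : PreservesLimitsOfShape WalkingCospan G :=
  preservesPullbacks_of_isPullback G fun h =>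
    (isPullback_map_iff G h.w).2 ⟨hG.pullback_ext h, hG.pullback_exists h⟩

theorem ElPres.preservesCoproducts (hG : ElPres G) (J : Type u) :
    PreservesColimitsOfShape (Discrete J) G := by
  have : ∀ A : J → C, PreservesColimit (Discrete.functor A) G := fun A => ⟨fun {c} hc => by
    have h := (Cofan.nonempty_isColimit_iff_bijective_fromSigma
      (Cofan.mk _ fun j => G.map (Cofan.inj c j))).2 (hG.coproduct hc)
    obtain ⟨h⟩ := h
    have e := (isColimitMapCoconeCofanMkEquiv G A (Cofan.inj c)).symm h
    exact ⟨IsColimit.ofIsoColimit e ((Cocone.functoriality _ G).mapIso (cofanIso c).symm)⟩⟩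
  exact preservesColimitsOfShape_of_discrete _

theorem ElPres.preservesFiltered (hG : ElPres G) : PreservesFilteredColimitsOfSize.{u, u} G :=
  ⟨fun J _ _ => ⟨fun {D} => ⟨fun {c} hc => ⟨Types.FilteredColimit.isColimitOf' _ _
    (fun x => by
      obtain ⟨j, y, h⟩ := hG.filtered_exists hc x
      exact ⟨j, y, h.symm⟩)
    (fun j a b e => hG.filtered_eq hc j a b e)⟩⟩⟩⟩

theorem ElPres.of_preserves [PreservesLimitsOfShape WalkingCospan G]
    [∀ J : Type u, PreservesColimitsOfShape (Discrete J) G]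
    [PreservesFilteredColimitsOfSize.{u, u} G] : ElPres G where
  pullback_ext h := ((isPullback_map_iff G h.w).1 (h.map G)).1
  pullback_exists h := ((isPullback_map_iff G h.w).1 (h.map G)).2
  coproduct {J A c} hc := by
    have e := isColimitOfPreserves G (IsColimit.ofIsoColimit hc (cofanIso c))
    exact (Cofan.nonempty_isColimit_iff_bijective_fromSigma
      (Cofan.mk _ fun j => G.map (Cofan.inj c j))).1 ⟨isColimitMapCoconeCofanMkEquiv G A _ e⟩
  filtered_exists {J _ _ D c} hc x := by
    have := PreservesFilteredColimitsOfSize.preserves_filtered_colimits (F := G) J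
    exact Types.jointly_surjective_of_isColimit (isColimitOfPreserves G hc) x
  filtered_eq {J _ _ D c} hc j a b e := by
    have := PreservesFilteredColimitsOfSize.preserves_filtered_colimits (F := G) J
    exact (Types.FilteredColimit.isColimit_eq_iff' (isColimitOfPreserves G hc) a b).1 e

end Converse

theorem elMap_app {G H : C ⥤ Type u} (f : G ⟶ H) {X Y : C} (h : X ⟶ Y) (a : G.obj X) :
    f.app Y (elMap G h a) = elMap H h (f.app X a) :=
  NatTrans.naturality_apply f h a

/-- The pointwise pullback of functors to types. -/
def pullbackFunctor {G H K : C ⥤ Type u} (f : G ⟶ K) (g : H ⟶ K) : C ⥤ Type u where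
  obj X := { p : G.obj X × H.obj X // f.app X p.1 = g.app X p.2 }
  map {X Y} h := TypeCat.ofHom fun p => ⟨(elMap G h p.1.1, elMap H h p.1.2), by
    rw [elMap_app, elMap_app, p.2]⟩
  map_id X := by
    refine ConcreteCategory.hom_ext _ _ fun p => ?_
    exact Subtype.ext (Prod.ext (elMap_id G p.1.1) (elMap_id H p.1.2))
  map_comp h h' := by
    refine ConcreteCategory.hom_ext _ _ fun p => ?_
    exact Subtype.ext (Prod.ext (elMap_comp G h h' p.1.1) (elMap_comp H h h' p.1.2))

/-- The pointwise coproduct of functors to types. -/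
def sigmaFunctor {J : Type u} (G : J → C ⥤ Type u) : C ⥤ Type u where
  obj X := Σ j, (G j).obj X
  map {X Y} h := TypeCat.ofHom fun p => ⟨p.1, elMap (G p.1) h p.2⟩
  map_id X := by
    refine ConcreteCategory.hom_ext _ _ fun ⟨j, p⟩ => ?_
    exact congrArg (fun t => (⟨j, t⟩ : Σ j, (G j).obj X)) (elMap_id (G j) p)
  map_comp {X Y Z} h h' := by
    refine ConcreteCategory.hom_ext _ _ fun ⟨j, p⟩ => ?_
    exact congrArg (fun t => (⟨j, t⟩ : Σ j, (G j).obj Z)) (elMap_comp (G j) h h' p)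

theorem ElPres.of_iso {G H : C ⥤ Type u} (e : G ≅ H) (hG : ElPres G) : ElPres H := by
  have := hG.preservesPullbacks
  have := hG.preservesCoproducts
  have := hG.preservesFiltered
  have := preservesLimitsOfShape_of_natIso (J := WalkingCospan) e
  have : ∀ J : Type u, PreservesColimitsOfShape (Discrete J) H :=
    fun J => preservesColimitsOfShape_of_natIso e
  have : PreservesFilteredColimitsOfSize.{u, u} H := ⟨fun J _ _ => by
    have := PreservesFilteredColimitsOfSize.preserves_filtered_colimits (F := G) J
    exact preservesColimitsOfShape_of_natIso e⟩
  exact .of_preserves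

/-- Pullbacks of sets commute with pullbacks, disjoint unions and filtered colimits. Agreement in
`K` forces both components into the same summand of a disjoint union; in a filtered colimit,
agreement at the colimit already holds at some later stage. -/
theorem ElPres.pullbackFunctor {G H K : C ⥤ Type u} {f : G ⟶ K} {g : H ⟶ K} (hG : ElPres G)
    (hH : ElPres H) (hK : ElPres K) : ElPres (pullbackFunctor f g) where
  pullback_ext h a b h₁ h₂ := Subtype.ext (Prod.ext
    (hG.pullback_ext h _ _ (congrArg (fun t => t.1.1) h₁) (congrArg (fun t => t.1.1) h₂))
    (hH.pullback_ext h _ _ (congrArg (fun t => t.1.2) h₁) (congrArg (fun t => t.1.2) h₂)))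
  pullback_exists h a b e := by
    obtain ⟨c, hc₁, hc₂⟩ := hG.pullback_exists h a.1.1 b.1.1 (congrArg (fun t => t.1.1) e)
    obtain ⟨d, hd₁, hd₂⟩ := hH.pullback_exists h a.1.2 b.1.2 (congrArg (fun t => t.1.2) e)
    refine ⟨⟨(c, d), hK.pullback_ext h _ _ ?_ ?_⟩, Subtype.ext (Prod.ext hc₁ hd₁),
      Subtype.ext (Prod.ext hc₂ hd₂)⟩
    · rw [← elMap_app, ← elMap_app, hc₁, hd₁, a.2]
    · rw [← elMap_app, ← elMap_app, hc₂, hd₂, b.2]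
  coproduct {J A c} hc := by
    constructor
    · rintro ⟨j, ⟨a, b⟩, e⟩ ⟨j', ⟨a', b'⟩, e'⟩ h
      have h₁ := (hG.coproduct hc).1 (a₁ := ⟨j, a⟩) (a₂ := ⟨j', a'⟩) (congrArg (fun t => t.1.1) h)
      have h₂ := (hH.coproduct hc).1 (a₁ := ⟨j, b⟩) (a₂ := ⟨j', b'⟩) (congrArg (fun t => t.1.2) h)
      simp only [Sigma.mk.injEq] at h₁ h₂
      obtain ⟨rfl, h₁⟩ := h₁
      obtain rfl := eq_of_heq h₁
      obtain rfl := eq_of_heq h₂.2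
      rfl
    · rintro ⟨⟨a, b⟩, e⟩
      obtain ⟨⟨j, a⟩, rfl⟩ := (hG.coproduct hc).2 a
      obtain ⟨⟨j', b⟩, rfl⟩ := (hH.coproduct hc).2 b
      have e' : elMap K (c.inj j) (f.app _ a) = elMap K (c.inj j') (g.app _ b) :=
        (elMap_app f _ _).symm.trans (e.trans (elMap_app g _ _))
      have h := (hK.coproduct hc).1 (a₁ := ⟨j, _⟩) (a₂ := ⟨j', _⟩) e'
      simp only [Sigma.mk.injEq] at h
      obtain ⟨rfl, h⟩ := h
      exact ⟨⟨j, ⟨a, b⟩, eq_of_heq h⟩, rfl⟩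
  filtered_exists {J _ _ D c} hc x := by
    obtain ⟨⟨a, b⟩, e⟩ := x
    obtain ⟨i, a, rfl⟩ := hG.filtered_exists hc a
    obtain ⟨j, b, rfl⟩ := hH.filtered_exists hc b
    obtain ⟨k, s, t, -⟩ := IsFilteredOrEmpty.cocone_objs i j
    have e' : elMap K (c.ι.app k) (f.app _ (elMap G (D.map s) a)) =
        elMap K (c.ι.app k) (g.app _ (elMap H (D.map t) b)) := by
      rw [← elMap_app, ← elMap_app, ← elMap_comp, ← elMap_comp, c.w, c.w]
      exact e
    obtain ⟨l, r, h⟩ := hK.filtered_eq hc k _ _ e'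
    rw [← elMap_app, ← elMap_app] at h
    refine ⟨l, ⟨⟨_, _⟩, h⟩, Subtype.ext (Prod.ext ?_ ?_)⟩
    · change elMap G _ (elMap G _ (elMap G _ _)) = _
      rw [← elMap_comp, ← elMap_comp, c.w, c.w]
    · change elMap H _ (elMap H _ (elMap H _ _)) = _
      rw [← elMap_comp, ← elMap_comp, c.w, c.w]
  filtered_eq {J _ _ D c} hc j a b e := by
    obtain ⟨k, s, h⟩ := hG.filtered_eq hc j _ _ (congrArg (fun t => t.1.1) e)
    obtain ⟨l, t, h'⟩ := hH.filtered_eq hc j _ _ (congrArg (fun t => t.1.2) e)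
    obtain ⟨m, s', t', hm⟩ := IsFiltered.span s t
    refine ⟨m, s ≫ s', Subtype.ext (Prod.ext ?_ ?_)⟩
    · change elMap G _ _ = elMap G _ _
      rw [D.map_comp, elMap_comp, elMap_comp, h]
    · change elMap H _ _ = elMap H _ _
      rw [hm, D.map_comp, elMap_comp, elMap_comp, h']

theorem ElPres.sigmaFunctor {I : Type u} {G : I → C ⥤ Type u} (hG : ∀ i, ElPres (G i)) :
    ElPres (sigmaFunctor G) where
  pullback_ext h a b h₁ h₂ := by
    obtain ⟨i, a⟩ := a
    obtain ⟨i', b⟩ := b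
    obtain rfl : i = i' := congrArg Sigma.fst h₁
    exact congrArg (Sigma.mk i) ((hG i).pullback_ext h a b (eq_of_heq (Sigma.mk.inj h₁).2)
      (eq_of_heq (Sigma.mk.inj h₂).2))
  pullback_exists h a b e := by
    obtain ⟨i, a⟩ := a
    obtain ⟨i', b⟩ := b
    obtain rfl : i = i' := congrArg Sigma.fst e
    obtain ⟨c, h₁, h₂⟩ := (hG i).pullback_exists h a b (eq_of_heq (Sigma.mk.inj e).2)
    exact ⟨⟨i, c⟩, congrArg (Sigma.mk i) h₁, congrArg (Sigma.mk i) h₂⟩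
  coproduct {J A c} hc := by
    constructor
    · rintro ⟨j, i, a⟩ ⟨j', i', a'⟩ h
      obtain rfl : i = i' := congrArg Sigma.fst h
      have h₁ := ((hG i).coproduct hc).1 (a₁ := ⟨j, a⟩) (a₂ := ⟨j', a'⟩)
        (eq_of_heq (Sigma.mk.inj h).2)
      simp only [Sigma.mk.injEq] at h₁
      obtain ⟨rfl, h₁⟩ := h₁
      obtain rfl := eq_of_heq h₁
      rfl
    · rintro ⟨i, a⟩
      obtain ⟨⟨j, a⟩, rfl⟩ := ((hG i).coproduct hc).2 a
      exact ⟨⟨j, i, a⟩, rfl⟩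
  filtered_exists {J _ _ D c} hc x := by
    obtain ⟨i, a⟩ := x
    obtain ⟨j, a, rfl⟩ := (hG i).filtered_exists hc a
    exact ⟨j, ⟨i, a⟩, rfl⟩
  filtered_eq {J _ _ D c} hc j a b e := by
    obtain ⟨i, a⟩ := a
    obtain ⟨i', b⟩ := b
    obtain rfl : i = i' := congrArg Sigma.fst e
    obtain ⟨k, f, h⟩ := (hG i).filtered_eq hc j a b (eq_of_heq (Sigma.mk.inj e).2)
    exact ⟨k, f, congrArg (Sigma.mk i) h⟩

/-- The closure of a class of functors to types under pullbacks and coproducts. -/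
inductive Fam (B : (C ⥤ Type u) → Prop) : (C ⥤ Type u) → Prop
  | base (G : C ⥤ Type u) (h : B G) : Fam B G
  | iso {G H : C ⥤ Type u} (e : G ≅ H) (h : Fam B G) : Fam B H
  | pullback {G H K : C ⥤ Type u} (f : G ⟶ K) (g : H ⟶ K) (hG : Fam B G) (hH : Fam B H)
    (hK : Fam B K) : Fam B (pullbackFunctor f g)
  | sigma {J : Type u} (G : J → C ⥤ Type u) (h : ∀ j, Fam B (G j)) : Fam B (sigmaFunctor G)

/-- Membership in `Fam` can be carried through categories of graphs by `Fam.precomp` and `Fam.total`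
without describing limits or colimits of graphs. The preservation properties are read off only at
the end, from the generators. -/
theorem Fam.elPres {B : (C ⥤ Type u) → Prop} (hB : ∀ G, B G → ElPres G) {G : C ⥤ Type u}
    (h : Fam B G) : ElPres G := by
  induction h with
  | base G h => exact hB G h
  | iso e _ ih => exact ih.of_iso e
  | pullback f g _ _ _ hG hH hK => exact hG.pullbackFunctor hH hK
  | sigma G _ ih => exact .sigmaFunctor ih

theorem Fam.precomp {D : Type (u + 1)} [Category.{u} D] {B : (C ⥤ Type u) → Prop}
    {B' : (D ⥤ Type u) → Prop} (P : D ⥤ C) (hB : ∀ G, B G → Fam B' (P ⋙ G)) {G : C ⥤ Type u}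
    (h : Fam B G) : Fam B' (P ⋙ G) := by
  induction h with
  | base G h => exact hB G h
  | iso e _ ih => exact .iso (Functor.isoWhiskerLeft P e) ih
  | pullback f g _ _ _ hG hH hK =>
    exact .iso (NatIso.ofComponents (fun X => Iso.refl _) fun _ => rfl)
      (.pullback (Functor.whiskerLeft P f) (Functor.whiskerLeft P g) hG hH hK)
  | sigma G _ ih =>
    exact .iso (NatIso.ofComponents (fun X => Iso.refl _) fun _ => rfl) (.sigma _ ih)

end

theorem nonempty_iso_of_bijective {C : Type*} [Category* C] {G H : C ⥤ Type u} (α : G ⟶ H)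
    (h : ∀ X, Function.Bijective (α.app X)) : Nonempty (G ≅ H) := by
  have : ∀ X, IsIso (α.app X) := fun X => (isIso_iff_bijective _).2 (h X)
  exact ⟨NatIso.ofComponents (fun X => asIso (α.app X)) (fun f => α.naturality f)⟩

/-! ### Total spaces of graphs -/

namespace Gph

variable {E : Type (u + 1)} [Category.{u} E]

variable (E) in
/-- The vertices of a graph. -/
def vertexFunctor : Gph.{u} E ⥤ Type u where
  obj X := X.vertex
  map f := TypeCat.ofHom f.obj

/-- The total space of elements of the edges of a graph. -/
def totalFunctor (G : E ⥤ Type u) : Gph.{u} E ⥤ Type u where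
  obj X := Σ x y : X.vertex, G.obj (X.hom x y)
  map f := TypeCat.ofHom fun c => ⟨f.obj c.1, f.obj c.2.1, elMap G (f.map c.1 c.2.1) c.2.2⟩
  map_id X := by
    refine ConcreteCategory.hom_ext _ _ fun ⟨x, y, c⟩ => ?_
    exact congrArg (fun t => (⟨x, y, t⟩ : Σ x y : X.vertex, G.obj (X.hom x y))) (elMap_id G c)
  map_comp {X Y Z} f g := by
    refine ConcreteCategory.hom_ext _ _ fun ⟨x, y, c⟩ => ?_
    exact congrArg (fun t => (⟨_, _, t⟩ : Σ x y : Z.vertex, G.obj (Z.hom x y)))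
      (elMap_comp G (f.map x y) (g.map (f.obj x) (f.obj y)) c)

/-- The action on total spaces of a natural transformation. -/
def totalMap {G H : E ⥤ Type u} (α : G ⟶ H) : totalFunctor G ⟶ totalFunctor H where
  app X := TypeCat.ofHom fun c => ⟨c.1, c.2.1, α.app _ c.2.2⟩
  naturality {X Y} f := by
    refine ConcreteCategory.hom_ext _ _ fun ⟨x, y, c⟩ => ?_
    exact congrArg (fun t => (⟨_, _, t⟩ : Σ x y : Y.vertex, H.obj (Y.hom x y)))
      (elMap_app α (f.map x y) c)

theorem totalMap_bijective {G H : E ⥤ Type u} (α : G ⟶ H) (h : ∀ X, Function.Bijective (α.app X))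
    (X : Gph.{u} E) : Function.Bijective ((totalMap α).app X) := by
  constructor
  · rintro ⟨x, y, c⟩ ⟨x', y', c'⟩ e
    obtain rfl : x = x' := congrArg (fun t => t.1) e
    obtain rfl : y = y' := congrArg (fun t => t.2.1) e
    obtain rfl := (h _).1 (mk_injective (P := fun x y => H.obj (X.hom x y)) e)
    rfl
  · rintro ⟨x, y, c⟩
    obtain ⟨c, rfl⟩ := (h _).2 c
    exact ⟨⟨x, y, c⟩, rfl⟩

/-- The target of an element of the total space. -/
def totalTgt (G : E ⥤ Type u) : totalFunctor G ⟶ vertexFunctor E where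
  app X := TypeCat.ofHom fun c => c.2.1

/-- Total spaces preserve pullbacks. -/
def totalPullback {G H K : E ⥤ Type u} (f : G ⟶ K) (g : H ⟶ K) :
    totalFunctor (pullbackFunctor f g) ⟶ pullbackFunctor (totalMap f) (totalMap g) where
  app X := TypeCat.ofHom fun c => ⟨(⟨c.1, c.2.1, c.2.2.1.1⟩, ⟨c.1, c.2.1, c.2.2.1.2⟩),
    congrArg (fun t => (⟨c.1, c.2.1, t⟩ : Σ x y : X.vertex, K.obj (X.hom x y))) c.2.2.2⟩

theorem totalPullback_bijective {G H K : E ⥤ Type u} (f : G ⟶ K) (g : H ⟶ K) (X : Gph.{u} E) :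
    Function.Bijective ((totalPullback f g).app X) := by
  constructor
  · rintro ⟨x, y, ⟨c, d⟩, h⟩ ⟨x', y', ⟨c', d'⟩, h'⟩ e
    have e₁ : (⟨x, y, c⟩ : Σ x y : X.vertex, G.obj (X.hom x y)) = ⟨x', y', c'⟩ :=
      congrArg (fun t => t.1.1) e
    have e₂ : (⟨x, y, d⟩ : Σ x y : X.vertex, H.obj (X.hom x y)) = ⟨x', y', d'⟩ :=
      congrArg (fun t => t.1.2) e
    obtain rfl : x = x' := congrArg (fun t => t.1) e₁
    obtain rfl : y = y' := congrArg (fun t => t.2.1) e₁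
    obtain rfl := mk_injective (P := fun x y => G.obj (X.hom x y)) e₁
    obtain rfl := mk_injective (P := fun x y => H.obj (X.hom x y)) e₂
    rfl
  · rintro ⟨⟨⟨x, y, c⟩, ⟨x', y', d⟩⟩, e⟩
    obtain rfl : x = x' := congrArg (fun t => t.1) e
    obtain rfl : y = y' := congrArg (fun t => t.2.1) e
    exact ⟨⟨x, y, ⟨c, d⟩, mk_injective (P := fun x y => K.obj (X.hom x y)) e⟩, rfl⟩

/-- Total spaces preserve coproducts. -/
def totalSigma {J : Type u} (G : J → E ⥤ Type u) :
    totalFunctor (sigmaFunctor G) ⟶ sigmaFunctor fun j => totalFunctor (G j) where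
  app X := TypeCat.ofHom fun c => ⟨c.2.2.1, c.1, c.2.1, c.2.2.2⟩

theorem totalSigma_bijective {J : Type u} (G : J → E ⥤ Type u) (X : Gph.{u} E) :
    Function.Bijective ((totalSigma G).app X) :=
  Function.bijective_iff_has_inverse.2
    ⟨fun c => ⟨c.2.1, c.2.2.1, c.1, c.2.2.2⟩, fun _ => rfl, fun _ => rfl⟩

end Gph

/-- Total spaces commute with pullbacks and sums of functors: an element of a total space records
its endpoints, so elements that agree over `K` lie in the same fibre. -/
theorem Fam.total {E : Type (u + 1)} [Category.{u} E] {B : (E ⥤ Type u) → Prop}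
    {B' : (Gph.{u} E ⥤ Type u) → Prop} (hB : ∀ G, B G → Fam B' (Gph.totalFunctor G))
    {G : E ⥤ Type u} (h : Fam B G) : Fam B' (Gph.totalFunctor G) := by
  induction h with
  | base G h => exact hB G h
  | iso e _ ih =>
    obtain ⟨i⟩ := nonempty_iso_of_bijective _ (Gph.totalMap_bijective e.hom fun X =>
      (isIso_iff_bijective _).1 inferInstance)
    exact .iso i ih
  | pullback f g _ _ _ hG hH hK =>
    obtain ⟨i⟩ := nonempty_iso_of_bijective _ (Gph.totalPullback_bijective f g)
    exact .iso i.symm (.pullback _ _ hG hH hK)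
  | sigma G _ ih =>
    obtain ⟨i⟩ := nonempty_iso_of_bijective _ (Gph.totalSigma_bijective G)
    exact .iso i.symm (.sigma _ ih)

/-! ### Spaces of walks -/

namespace Walk

variable {α : Type u} {H : α → α → Type u}

/-- Prepending an edge, in terms of total spaces. -/
def consTotal (e : Σ x y, H x y) (t : Σ x z, Walk H x z) (h : e.2.1 = t.1) : Σ x z, Walk H x z :=
  ⟨e.1, t.2.1, cons e.2.2 (h.symm.rec (motive := fun y _ => Walk H y t.2.1) t.2.2)⟩

theorem consTotal_mk {x y z : α} (e : H x y) (w : Walk H y z) :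
    consTotal ⟨x, y, e⟩ ⟨y, z, w⟩ rfl = ⟨x, z, cons e w⟩ :=
  rfl

theorem consTotal_length (e : Σ x y, H x y) (t : Σ x z, Walk H x z) (h : e.2.1 = t.1) :
    (consTotal e t h).2.2.length = t.2.2.length + 1 := by
  obtain ⟨x, y, e⟩ := e
  obtain ⟨y', z, w⟩ := t
  obtain rfl : y = y' := h
  rfl

theorem consTotal_inj {e e' : Σ x y, H x y} {t t' : Σ x z, Walk H x z} {h : e.2.1 = t.1}
    {h' : e'.2.1 = t'.1} (hh : consTotal e t h = consTotal e' t' h') : e = e' ∧ t = t' := by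
  obtain ⟨x, y, e⟩ := e
  obtain ⟨y', z, w⟩ := t
  obtain rfl : y = y' := h
  obtain ⟨x', v, e'⟩ := e'
  obtain ⟨v', z', w'⟩ := t'
  obtain rfl : v = v' := h'
  rw [consTotal_mk, consTotal_mk] at hh
  obtain rfl : x = x' := congrArg (fun t => t.1) hh
  obtain rfl : z = z' := congrArg (fun t => t.2.1) hh
  have := Gph.mk_injective (P := fun x z => Walk H x z) hh
  injection this with h1 h2 h3 h4 h5
  subst h2
  obtain rfl := eq_of_heq h4
  obtain rfl := eq_of_heq h5
  exact ⟨rfl, rfl⟩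

end Walk

namespace Gph

variable {E : Type (u + 1)} [Category.{u} E] (G : E ⥤ Type u)

/-- The total space of walks in a graph. -/
def walkFunctor : Gph.{u} E ⥤ Type u where
  obj X := Σ x z : X.vertex, Walk (fun x y => G.obj (X.hom x y)) x z
  map {X Y} f := TypeCat.ofHom fun c => ⟨f.obj c.1, f.obj c.2.1,
    c.2.2.map (K := fun x y => G.obj (Y.hom x y)) f.obj fun {x y} a => elMap G (f.map x y) a⟩
  map_id X := by
    refine ConcreteCategory.hom_ext _ _ fun ⟨x, y, c⟩ => ?_
    exact congrArg
      (fun t => (⟨x, y, t⟩ : Σ x z : X.vertex, Walk (fun x y => G.obj (X.hom x y)) x z))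
      (c.map_id (h := fun x y a => elMap G (𝟙 _) a) fun x y a => elMap_id G a)
  map_comp {X Y Z} f g := by
    refine ConcreteCategory.hom_ext _ _ fun ⟨x, y, c⟩ => ?_
    refine congrArg
      (fun t => (⟨_, _, t⟩ : Σ x z : Z.vertex, Walk (fun x y => G.obj (Z.hom x y)) x z)) ?_
    refine Eq.trans ?_ (c.map_map (K := fun x y => G.obj (Y.hom x y))
      (M := fun x y => G.obj (Z.hom x y)) f.obj (fun {x y} a => elMap G (f.map x y) a) g.obj
      (fun {x y} a => elMap G (g.map x y) a)).symm
    change Walk.map (H := fun x y => G.obj (X.hom x y)) (K := fun x y => G.obj (Z.hom x y))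
      (f ≫ g).obj (fun {x y} a => elMap G ((f ≫ g).map x y) a) c = _
    induction c with
    | nil => rfl
    | cons e w ih => exact congrArg₂ Walk.cons (elMap_comp G _ _ e) ih

/-- The space of walks of given length in a graph, with the first vertex. -/
def walkLen : ℕ → Σ P : Gph.{u} E ⥤ Type u, (P ⟶ vertexFunctor E)
  | 0 => ⟨vertexFunctor E, 𝟙 _⟩
  | m + 1 => ⟨pullbackFunctor (totalTgt G) (walkLen m).2,
      { app := fun _ => TypeCat.ofHom fun p => p.1.1.1
        naturality := fun _ _ _ => rfl }⟩

theorem walkLen_fam {B : (Gph.{u} E ⥤ Type u) → Prop} (hv : Fam B (vertexFunctor E))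
    (hG : Fam B (totalFunctor G)) : ∀ m, Fam B (walkLen G m).1
  | 0 => hv
  | m + 1 => .pullback _ _ hG (walkLen_fam hv hG m) hv

/-- The walk given by an element of the space of walks of given length. -/
def walkLenWalk (X : Gph.{u} E) : ∀ (m : ℕ) (p : (walkLen G m).1.obj X),
    { t : Σ x z : X.vertex, Walk (fun x y => G.obj (X.hom x y)) x z //
      (walkLen G m).2.app X p = t.1 }
  | 0, x => ⟨⟨x, x, .nil x⟩, rfl⟩
  | m + 1, p => ⟨Walk.consTotal p.1.1 (walkLenWalk X m p.1.2).1
      (p.2.trans (walkLenWalk X m p.1.2).2), rfl⟩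

theorem walkLen_tgt (X : Gph.{u} E) (m : ℕ) (p : (walkLen G (m + 1)).1.obj X) :
    p.1.1.2.1 = (walkLenWalk G X m p.1.2).1.1 :=
  p.2.trans (walkLenWalk G X m p.1.2).2

theorem walkLenWalk_length (X : Gph.{u} E) : ∀ (m : ℕ) (p : (walkLen G m).1.obj X),
    (walkLenWalk G X m p).1.2.2.length = m
  | 0, _ => rfl
  | m + 1, p => (Walk.consTotal_length _ _ (walkLen_tgt G X m p)).trans
      (congrArg (· + 1) (walkLenWalk_length X m p.1.2))

theorem walkLenWalk_injective (X : Gph.{u} E) : ∀ (m : ℕ) (p q : (walkLen G m).1.obj X),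
    (walkLenWalk G X m p).1 = (walkLenWalk G X m q).1 → p = q
  | 0, _, _, h => congrArg (fun t => t.1) h
  | m + 1, p, q, h => by
    have h' := Walk.consTotal_inj (h := walkLen_tgt G X m p) (h' := walkLen_tgt G X m q) h
    exact Subtype.ext (Prod.ext h'.1 (walkLenWalk_injective X m _ _ h'.2))

theorem walkLenWalk_surjective (X : Gph.{u} E) {x z : X.vertex}
    (w : Walk (fun x y => G.obj (X.hom x y)) x z) :
    ∃ m p, (walkLenWalk G X m p).1 = ⟨x, z, w⟩ := by
  induction w with
  | nil x => exact ⟨0, x, rfl⟩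
  | cons e w ih =>
    rename_i x y z
    obtain ⟨m, p, hp⟩ := ih
    refine ⟨m + 1, ⟨(⟨x, y, e⟩, p), ?_⟩, ?_⟩
    · exact (congrArg (fun t => t.1) hp).symm.trans (walkLenWalk G X m p).2.symm
    · have aux : ∀ (t : Σ x z : X.vertex, Walk (fun x y => G.obj (X.hom x y)) x z)
          (_ : t = ⟨y, z, w⟩) (h' : y = t.1), Walk.consTotal ⟨x, y, e⟩ t h' =
            ⟨x, z, .cons e w⟩ := by
        rintro _ rfl _
        rfl
      exact aux _ hp (congrArg (fun t => t.1) hp).symm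

theorem walkLenWalk_naturality {X Y : Gph.{u} E} (f : X ⟶ Y) :
    ∀ (m : ℕ) (p : (walkLen G m).1.obj X),
      (walkLenWalk G Y m (elMap (walkLen G m).1 f p)).1 =
        elMap (walkFunctor G) f (walkLenWalk G X m p).1
  | 0, _ => rfl
  | m + 1, p => by
    -- The walk over `Y` equals the image walk only propositionally, and `consTotal` depends on its
    -- first vertex; generalizing it to a variable allows the equality to be substituted.
    have aux : ∀ (e : Σ x y : X.vertex, G.obj (X.hom x y))
        (t : Σ x z : X.vertex, Walk (fun x y => G.obj (X.hom x y)) x z)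
        (t' : Σ x z : Y.vertex, Walk (fun x y => G.obj (Y.hom x y)) x z)
        (_ : t' = elMap (walkFunctor G) f t) (h : e.2.1 = t.1)
        (h' : (elMap (totalFunctor G) f e).2.1 = t'.1),
        Walk.consTotal (H := fun x y => G.obj (Y.hom x y)) (elMap (totalFunctor G) f e) t' h' =
          elMap (walkFunctor G) f (Walk.consTotal e t h) := by
      rintro ⟨x, y, e⟩ ⟨y', z, w⟩ _ rfl h h'
      obtain rfl : y = y' := h
      rfl
    exact aux _ _ _ (walkLenWalk_naturality f m p.1.2) (walkLen_tgt G X m p)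
      (walkLen_tgt G Y m (elMap (walkLen G (m + 1)).1 f p))

/-- The space of walks is the sum of the spaces of walks of given length. -/
theorem walkFunctor_fam {B : (Gph.{u} E ⥤ Type u) → Prop} (hv : Fam B (vertexFunctor E))
    (hG : Fam B (totalFunctor G)) : Fam B (walkFunctor G) := by
  let α : sigmaFunctor (fun m : ULift.{u} ℕ => (walkLen G m.down).1) ⟶ walkFunctor G :=
    { app := fun X => TypeCat.ofHom fun p => (walkLenWalk G X p.1.down p.2).1
      naturality := fun X Y f => by
        refine ConcreteCategory.hom_ext _ _ fun p => ?_
        exact walkLenWalk_naturality G f p.1.down p.2 }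
  obtain ⟨i⟩ := nonempty_iso_of_bijective α fun X => by
    constructor
    · rintro ⟨⟨m⟩, p⟩ ⟨⟨m'⟩, p'⟩ h
      obtain rfl : m = m' := (walkLenWalk_length G X m p).symm.trans
        ((congrArg (fun t => t.2.2.length) h).trans (walkLenWalk_length G X m' p'))
      obtain rfl := walkLenWalk_injective G X m _ _ h
      rfl
    · rintro ⟨x, z, w⟩
      obtain ⟨m, p, h⟩ := walkLenWalk_surjective G X w
      exact ⟨⟨⟨m⟩, p⟩, h⟩
  exact .iso i (.sigma _ fun m => walkLen_fam G hv hG m.down)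

end Gph

/-! ### Forgetful functors to globular sets -/

/-- The functors of cells of given dimension. -/
def IsEv (n : ℕ) (G : NGlobSet.{u} n ⥤ Type u) : Prop :=
  ∃ k : GlobeLE n, G = (evaluation (GlobeLE n) (Type u)).obj k

/-- The functor of cells of dimension `k`. -/
abbrev cells (n : ℕ) (k : GlobeLE n) : NGlobSet.{u} n ⥤ Type u :=
  (evaluation (GlobeLE n) (Type u)).obj k

theorem elPres_cells {n : ℕ} (k : GlobeLE n) : ElPres (cells.{u} n k) := by
  have : PreservesFilteredColimitsOfSize.{u, u} (cells.{u} n k) := ⟨fun J _ _ => inferInstance⟩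
  exact .of_preserves

theorem IsEv.elPres {n : ℕ} (G : NGlobSet.{u} n ⥤ Type u) (h : IsEv n G) : ElPres G := by
  obtain ⟨k, rfl⟩ := h
  exact elPres_cells k

theorem cellFamily_cells (n : ℕ) : CellFamily (cells.{u} n) where
  products _ := inferInstance
  coproducts _ _ := inferInstance
  isIso f h := by
    have : ∀ k, IsIso (f.app k) := fun k => (isIso_iff_bijective _).2 (h k)
    exact NatIso.isIso_of_isIso_app f

instance (n : ℕ) : IsDistrib (NGlobSet.{u} n) := (cellFamily_cells n).isDistrib

/-- The properties of the adjunction between strict `n`-categories and `n`-globular sets that are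
proved by induction. -/
structure Good {n : ℕ} {V : Type (u + 1)} [Category.{u} V] {F : NGlobSet.{u} n ⥤ V}
    {U : V ⥤ NGlobSet.{u} n} (adj : F ⊣ U) : Prop where
  monadic : (Monad.comparison adj).IsEquivalence
  unit : NatTrans.Equifibered adj.toMonad.η
  mul : NatTrans.Equifibered adj.toMonad.μ
  fam (k : GlobeLE n) : Fam (IsEv n) (F ⋙ U ⋙ cells n k)

namespace Good

variable {n : ℕ} {V : Type (u + 1)} [Category.{u} V] {F : NGlobSet.{u} n ⥤ V}
  {U : V ⥤ NGlobSet.{u} n} {adj : F ⊣ U} (h : Good adj)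

theorem elPres (h : Good adj) (k : GlobeLE n) : ElPres (F ⋙ U ⋙ cells n k) :=
  (h.fam k).elPres IsEv.elPres

theorem preservesPullbacks (h : Good adj) : PreservesLimitsOfShape WalkingCospan (F ⋙ U) :=
  preservesLimitsOfShape_of_evaluation _ _ fun k => (h.elPres k).preservesPullbacks

theorem preservesCoproducts (h : Good adj) (J : Type u) :
    PreservesColimitsOfShape (Discrete J) (F ⋙ U) :=
  preservesColimitsOfShape_of_evaluation _ _ fun k => (h.elPres k).preservesCoproducts J

theorem preservesFiltered (h : Good adj) : PreservesFilteredColimitsOfSize.{u, u} (F ⋙ U) :=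
  ⟨fun J _ _ => preservesColimitsOfShape_of_evaluation _ _ fun k =>
    (h.elPres k).preservesFiltered.preserves_filtered_colimits J⟩

theorem isCartesianMonad (h : Good adj) : IsCartesianMonad adj.toMonad where
  preserves := h.preservesPullbacks
  unit := h.unit
  mul := h.mul

/-- The forgetful functor is monadic. -/
abbrev monadicRightAdjoint (h : Good adj) : MonadicRightAdjoint U where
  L := F
  adj := adj
  eqv := h.monadic

/-- The forgetful functor creates coproducts. -/
abbrev createsCoproducts (h : Good adj) (J : Type u) : CreatesColimitsOfShape (Discrete J) U :=
  letI := h.monadicRightAdjoint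
  haveI := h.preservesCoproducts J
  ⟨fun {K} =>
    haveI : PreservesColimit (K ⋙ U) (monadicLeftAdjoint U ⋙ U) :=
      inferInstanceAs (PreservesColimit (K ⋙ U) (F ⋙ U))
    haveI : PreservesColimit ((K ⋙ U) ⋙ monadicLeftAdjoint U ⋙ U) (monadicLeftAdjoint U ⋙ U) :=
      inferInstanceAs (PreservesColimit ((K ⋙ U) ⋙ F ⋙ U) (F ⋙ U))
    monadicCreatesColimitOfPreservesColimit U K⟩

theorem hasCoproducts (h : Good adj) : HasCoproducts.{u} V := fun J => by
  let _ := h.createsCoproducts J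
  exact hasColimitsOfShape_of_hasColimitsOfShape_createsColimitsOfShape U

theorem preservesCoproducts_forget (h : Good adj) (J : Type u) :
    PreservesColimitsOfShape (Discrete J) U := by
  let _ := h.createsCoproducts J
  infer_instance

theorem reflectsIsomorphisms (h : Good adj) : U.ReflectsIsomorphisms := by
  have := h.monadic
  exact reflectsIsomorphisms_of_iso (Monad.comparisonForget adj)

/-- A right adjoint preserves products; coproducts are preserved because `U` is monadic with a
coproduct-preserving monad; and a monadic functor reflects isomorphisms. Hence `V` is distributive
and the construction can be iterated. -/
theorem cellFamily (h : Good adj) : CellFamily fun k => U ⋙ cells n k where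
  products _ := by
    have := adj.rightAdjoint_preservesLimits
    infer_instance
  coproducts _ J := by
    have := h.preservesCoproducts_forget J
    infer_instance
  isIso f hf := by
    have := h.reflectsIsomorphisms
    have := (cellFamily_cells n).isIso (U.map f) hf
    exact isIso_of_reflects_iso f U

theorem isDistrib [CartesianMonoidalCategory V] (h : Good adj) : IsDistrib V :=
  have := h.hasCoproducts
  h.cellFamily.isDistrib

end Good

/-! ### The free `(n+1)`-category functor -/

namespace Gph

section

variable {V : Type (u + 1)} [Category.{u} V] [CartesianMonoidalCategory V] [IsDistrib V]
  (L : V ⥤ Type u) [PreservesFiniteProducts L]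

/-- `freeMap` composes the images of the edges, and composing edges of a free enriched category only
lists them; so the free functor acts on walks edge by edge. -/
theorem elMap_freeMap_freeEdge {X Y : Gph.{u} V} (o : X.vertex → Y.vertex)
    (m : ∀ x y, X.hom x y ⟶ Y.hom (o x) (o y)) {x z : X.vertex} (w : Walk (X.elEdge L) x z) :
    elMap L (freeMap (C := Y.free.carrier) o (fun x y => m x y ≫ Y.freeEdge (o x) (o y)) x z)
      (X.walkEl L w) = Y.walkEl L (w.map (K := Y.elEdge L) o fun {x y} a => elMap L (m x y) a) := by
  refine (elMap_freeMap (C := Y.free.carrier) L o _ w).trans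
    (Eq.trans ?_ (Y.walkEl_eq_elCompose L _).symm)
  refine congrArg (elCompose (C := Y.free.carrier) L) ?_
  refine Eq.trans ?_ (w.map_map (K := Y.elEdge L) (M := elHom L Y.free.carrier) o
    (fun {x y} a => elMap L (m x y) a) (fun x => x) (fun {x y} a => elMap L (Y.freeEdge x y) a)).symm
  induction w with
  | nil => rfl
  | cons e w ih => exact congrArg₂ Walk.cons (elMap_comp L _ _ e) ih

end

section

variable {n : ℕ} {V : Type (u + 1)} [Category.{u} V] [CartesianMonoidalCategory V] [IsDistrib V]
  {F : NGlobSet.{u} n ⥤ V} {U : V ⥤ NGlobSet.{u} n} (adj : F ⊣ U)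

/-- The free enriched category on a graph of globular sets. -/
def gphAdj : map F ⋙ freeFunctor V ⊣ VCat.toGph V ⋙ map U :=
  (mapAdj adj).comp (freeAdj V)

/-- The free enriched category on a globular set. -/
def stepAdj : ((toGlob n).inv ⋙ map F) ⋙ freeFunctor V ⊣ VCat.toGph V ⋙ map U ⋙ toGlob n :=
  ((globAdj n).comp (mapAdj adj)).comp (freeAdj V)

variable (F U) in
/-- Walks are cells of the free enriched category. -/
def walkCells (k : GlobeLE n) [PreservesFiniteProducts (U ⋙ cells n k)] :
    walkFunctor (F ⋙ U ⋙ cells n k) ⟶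
      ((map F ⋙ freeFunctor V) ⋙ VCat.toGph V ⋙ map U) ⋙ totalFunctor (cells n k) where
  app X := TypeCat.ofHom fun c => ⟨c.1, c.2.1, ((map F).obj X).walkEl (U ⋙ cells n k) c.2.2⟩
  naturality {X Y} f := by
    refine ConcreteCategory.hom_ext _ _ fun ⟨x, z, w⟩ => ?_
    have h := elMap_freeMap_freeEdge (U ⋙ cells n k) (X := (map F).obj X) (Y := (map F).obj Y)
      ((map F).map f).obj ((map F).map f).map w
    have e := congrArg (fun g : (freeFunctor V).obj ((map F).obj X) ⟶
      (freeFunctor V).obj ((map F).obj Y) => elMap (totalFunctor (cells n k)) ((map U).map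
      ((VCat.toGph V).map g)) (⟨x, z, ((map F).obj X).walkEl (U ⋙ cells n k) w⟩ : Σ x z : X.vertex,
      (U ⋙ cells n k).obj (((map F).obj X).freeHom x z)))
      (freeFunctor_map ((map F).map f))
    refine Eq.trans ?_ e.symm
    exact congrArg (fun t => (⟨f.obj x, f.obj z, t⟩ : Σ x z : Y.vertex,
      (U ⋙ cells n k).obj (((map F).obj Y).freeHom x z))) h.symm

theorem walkCells_bijective (k : GlobeLE n) [PreservesFiniteProducts (U ⋙ cells n k)]
    [∀ J : Type u, PreservesColimitsOfShape (Discrete J) (U ⋙ cells n k)]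
    (X : Gph.{u} (NGlobSet.{u} n)) : Function.Bijective ((walkCells F U k).app X) := by
  have h := ((map F).obj X).walkEl_bijective (U ⋙ cells n k)
  constructor
  · rintro ⟨x, y, c⟩ ⟨x', y', c'⟩ e
    obtain rfl : x = x' := congrArg (fun t => t.1) e
    obtain rfl : y = y' := congrArg (fun t => t.2.1) e
    obtain rfl := (h x y).1 (mk_injective
      (P := fun x y => (U ⋙ cells n k).obj (((map F).obj X).freeHom x y)) e)
    rfl
  · rintro ⟨x, y, c⟩
    obtain ⟨c, rfl⟩ := (h x y).2 c
    exact ⟨⟨x, y, c⟩, rfl⟩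

end

/-- The cells of the globular set of a graph. -/
def toGlobCellsIso (n : ℕ) (k : ℕ) (hk : k + 1 ≤ n + 1) :
    toGlob.{u} n ⋙ cells (n + 1) (globe (k + 1) hk) ≅
      totalFunctor (cells n (globe k (Nat.le_of_succ_le_succ hk))) :=
  NatIso.ofComponents (fun _ => Iso.refl _) fun _ => rfl

/-- The vertices of the globular set of a graph. -/
def toGlobZeroIso (n : ℕ) :
    toGlob.{u} n ⋙ cells (n + 1) (globe 0 (Nat.zero_le _)) ≅ vertexFunctor (NGlobSet.{u} n) :=
  NatIso.ofComponents (fun _ => Iso.refl _) fun _ => rfl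

/-- The classes of cells and vertices of a graph of globular sets. -/
def IsGphCell (n : ℕ) (G : Gph.{u} (NGlobSet.{u} n) ⥤ Type u) : Prop :=
  G = vertexFunctor _ ∨ ∃ k, G = totalFunctor (cells n k)

/-- Under the equivalence of graphs with globular sets, vertices become `0`-cells and total spaces
of `k`-cells become `(k+1)`-cells, so generators go to generators. -/
theorem fam_inv_comp {n : ℕ} {G : Gph.{u} (NGlobSet.{u} n) ⥤ Type u} (h : Fam (IsGphCell n) G) :
    Fam (IsEv (n + 1)) ((toGlob n).inv ⋙ G) := by
  have key : ∀ (k : GlobeLE (n + 1)) (H : Gph.{u} (NGlobSet.{u} n) ⥤ Type u),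
      (toGlob.{u} n ⋙ cells (n + 1) k ≅ H) → Fam (IsEv (n + 1)) ((toGlob n).inv ⋙ H) := by
    intro k H i
    refine .iso ?_ (.base _ ⟨k, rfl⟩)
    exact (Functor.leftUnitor _).symm ≪≫
      Functor.isoWhiskerRight (toGlob.{u} n).asEquivalence.counitIso.symm (cells (n + 1) k) ≪≫
      Functor.associator _ _ _ ≪≫ Functor.isoWhiskerLeft (toGlob n).inv i
  refine h.precomp _ ?_
  rintro _ (rfl | ⟨k, rfl⟩)
  · exact key _ _ (toGlobZeroIso n)
  · exact key _ _ (toGlobCellsIso n k.obj.dim (Nat.succ_le_succ k.property))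

end Gph

namespace Good

variable {n : ℕ} {V : Type (u + 1)} [Category.{u} V] [CartesianMonoidalCategory V] [IsDistrib V]
  {F : NGlobSet.{u} n ⥤ V} {U : V ⥤ NGlobSet.{u} n} {adj : F ⊣ U}

/-- The `0`-cells are the vertices of the given graph, and a `(k+1)`-cell is a walk whose edges are
`k`-cells of the globular sets `U (F X(x, y))`. Walks of fixed length are iterated pullbacks, and
the length is summed over, so the class is not left. -/
theorem stepAdj_fam (h : Good adj) (k : GlobeLE (n + 1)) : Fam (IsEv (n + 1))
    ((((Gph.toGlob n).inv ⋙ Gph.map F) ⋙ Gph.freeFunctor V) ⋙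
      (VCat.toGph V ⋙ Gph.map U ⋙ Gph.toGlob n) ⋙ cells (n + 1) k) := by
  have key : ∀ (H : Gph.{u} (NGlobSet.{u} n) ⥤ Type u), (Gph.toGlob.{u} n ⋙ cells (n + 1) k ≅ H) →
      Fam (Gph.IsGphCell n) (((Gph.map F ⋙ Gph.freeFunctor V) ⋙ VCat.toGph V ⋙ Gph.map U) ⋙ H) →
      Fam (IsEv (n + 1)) ((((Gph.toGlob n).inv ⋙ Gph.map F) ⋙ Gph.freeFunctor V) ⋙
        (VCat.toGph V ⋙ Gph.map U ⋙ Gph.toGlob n) ⋙ cells (n + 1) k) := by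
    intro H i hH
    refine .iso ?_ (Gph.fam_inv_comp hH)
    exact Functor.isoWhiskerLeft ((Gph.toGlob n).inv ⋙
      ((Gph.map F ⋙ Gph.freeFunctor V) ⋙ VCat.toGph V ⋙ Gph.map U)) i.symm
  obtain ⟨⟨_ | k⟩, hk⟩ := k
  · refine key _ (Gph.toGlobZeroIso n) (.iso ?_ (.base _ (.inl rfl)))
    refine NatIso.ofComponents (fun _ => Iso.refl _) fun {X Y} f => ?_
    exact (congrArg (fun g => (Gph.vertexFunctor _).map ((Gph.map U).map ((VCat.toGph V).map g)))
      (Gph.freeFunctor_map ((Gph.map F).map f))).symm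
  · refine key _ (Gph.toGlobCellsIso n k hk) ?_
    have hc := h.cellFamily
    have := hc.products (globe k (Nat.le_of_succ_le_succ hk))
    have := hc.coproducts (globe k (Nat.le_of_succ_le_succ hk))
    obtain ⟨i⟩ := nonempty_iso_of_bijective _
      (Gph.walkCells_bijective (F := F) (U := U) (globe k (Nat.le_of_succ_le_succ hk)))
    refine .iso i (Gph.walkFunctor_fam _ (.base _ (.inl rfl)) ((h.fam _).total ?_))
    rintro _ ⟨k, rfl⟩
    exact .base _ (.inr ⟨k, rfl⟩)

/-- Change of base along `U` carries free `V`-categories to free categories enriched in globular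
sets. Thus the free category monad on `V`-graphs lifts the one on graphs of globular sets, as the
monadicity of a composite requires. -/
theorem gphAdj_monadic (h : Good adj) : (Monad.comparison (Gph.gphAdj adj)).IsEquivalence := by
  have := h.monadic
  let _ : MonadicRightAdjoint (Gph.map U) := ⟨_, Gph.mapAdj adj, Gph.isEquivalence_comparison_mapAdj adj⟩
  have := adj.rightAdjoint_preservesLimits
  have hb := VCat.beckChevalley_changeBase U (cellFamily_cells n) h.cellFamily.coproducts
  exact isEquivalence_comparison_comp (VCat.toGph V) (Gph.map U) (Gph.gphAdj adj)
    hb.weakMonadMap.iso.symm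

theorem stepAdj_monadic (h : Good adj) : (Monad.comparison (Gph.stepAdj adj)).IsEquivalence := by
  let _ : MonadicRightAdjoint (VCat.toGph V ⋙ Gph.map U) := ⟨_, _, h.gphAdj_monadic⟩
  -- An equivalence is monadic because it is reflective, and every monad lifts along it by
  -- conjugation, which gives `P`.
  let _ : Reflective (Gph.toGlob.{u} n) := { L := _, adj := Gph.globAdj n }
  refine isEquivalence_comparison_comp (VCat.toGph V ⋙ Gph.map U) (Gph.toGlob n) (Gph.stepAdj adj)
    (P := (Gph.toGlob n).inv ⋙ ((Gph.map F ⋙ Gph.freeFunctor V) ⋙ (VCat.toGph V ⋙ Gph.map U)) ⋙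
      Gph.toGlob n) ?_
  exact Functor.isoWhiskerRight (Gph.toGlob.{u} n).asEquivalence.unitIso
    (((Gph.map F ⋙ Gph.freeFunctor V) ⋙ (VCat.toGph V ⋙ Gph.map U)) ⋙ Gph.toGlob n)

end Good

/-! ### Pullback squares in terms of elements -/

/-- The image of a square under a functor to types is a pullback, in terms of elements. -/
def ElPullback {C : Type*} [Category* C] (L : C ⥤ Type u) {P X Y Z : C} (p : P ⟶ X) (q : P ⟶ Y)
    (f : X ⟶ Z) (g : Y ⟶ Z) : Prop :=
  (∀ a b, L.map p a = L.map p b → L.map q a = L.map q b → a = b) ∧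
    ∀ a b, L.map f a = L.map g b → ∃ c, L.map p c = a ∧ L.map q c = b

theorem isPullback_of_elPullback {J : Type*} [Category* J] {P X Y Z : J ⥤ Type u} {p : P ⟶ X}
    {q : P ⟶ Y} {f : X ⟶ Z} {g : Y ⟶ Z} (w : p ≫ f = q ≫ g)
    (h : ∀ k, ElPullback ((evaluation J (Type u)).obj k) p q f g) : IsPullback p q f g := by
  refine ⟨⟨w⟩, ⟨evaluationJointlyReflectsLimits _ fun k => ?_⟩⟩
  refine (isLimitMapConePullbackConeEquiv ((evaluation J (Type u)).obj k) w).symm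
    (IsPullback.isLimit ?_)
  rw [Types.isPullback_iff]
  exact ⟨by rw [← Functor.map_comp, w, Functor.map_comp], fun a b h' => (h k).1 a b h'.1 h'.2,
    (h k).2⟩

theorem elPullback_of_isPullback {J : Type*} [Category* J] {P X Y Z : J ⥤ Type u} {p : P ⟶ X}
    {q : P ⟶ Y} {f : X ⟶ Z} {g : Y ⟶ Z} (h : IsPullback p q f g) (k : J) :
    ElPullback ((evaluation J (Type u)).obj k) p q f g := by
  have := (Types.isPullback_iff _ _ _ _).1 (h.map ((evaluation J (Type u)).obj k))
  exact ⟨fun a b h₁ h₂ => this.2.1 a b ⟨h₁, h₂⟩, this.2.2⟩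

namespace Walk

variable {α β : Type u}

theorem exists_cons_of_map_eq {K K' : β → β → Type u} {b : ∀ {x y}, K x y → K' x y} {x y z : β}
    (v : Walk K x z) (e' : K' x y) (w' : Walk K' y z)
    (h : v.map (fun x => x) b = cons e' w') :
    ∃ (e : K x y) (v' : Walk K y z), v = cons e v' ∧ b e = e' ∧ v'.map (fun x => x) b = w' := by
  cases v with
  | nil => cases h
  | cons e v =>
    cases h
    exact ⟨e, v, rfl, rfl, rfl⟩

theorem eq_nil_of_map_eq {K K' : β → β → Type u} {b : ∀ {x y}, K x y → K' x y} {x : β}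
    (v : Walk K x x) (h : v.map (fun x => x) b = nil x) : v = nil x := by
  cases v with
  | nil => rfl
  | cons e v => cases h

variable {H H' : α → α → Type u} {K K' : β → β → Type u} {o : α → β}
  {a : ∀ {x y}, H x y → H' x y} {b : ∀ {x y}, K x y → K' x y}
  {m : ∀ {x y}, H x y → K (o x) (o y)} {m' : ∀ {x y}, H' x y → K' (o x) (o y)}

/-- The uniqueness half of the fact that walks turn pullback squares of edges into pullback squares;
`pullback_exists` is the existence half. Two parallel sides are identities on vertices, so the
vertices of the walks match without transport. -/
theorem pullback_ext (h : ∀ {x y} (e e' : H x y), a e = a e' → m e = m e' → e = e') {x z : α}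
    (w w' : Walk H x z) (h₁ : w.map (fun x => x) a = w'.map (fun x => x) a)
    (h₂ : w.map o m = w'.map o m) : w = w' := by
  induction w with
  | nil x =>
    cases w' with
    | nil => rfl
    | cons => cases h₁
  | cons e w ih =>
    cases w' with
    | nil => cases h₁
    | cons e' w' =>
      simp only [map, cons.injEq] at h₁ h₂
      obtain ⟨rfl, h₃, h₄⟩ := h₁
      rw [h e e' (eq_of_heq h₃) (eq_of_heq h₂.2.1), ih w' (eq_of_heq h₄) (eq_of_heq h₂.2.2)]

theorem pullback_exists
    (h : ∀ {x y} (e : H' x y) (e' : K (o x) (o y)), m' e = b e' → ∃ d : H x y, a d = e ∧ m d = e')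
    {x z : α} (w : Walk H' x z) (v : Walk K (o x) (o z))
    (e : w.map o m' = v.map (fun x => x) b) :
    ∃ t : Walk H x z, t.map (fun x => x) a = w ∧ t.map o m = v := by
  induction w with
  | nil x => exact ⟨nil x, rfl, (eq_nil_of_map_eq v e.symm).symm⟩
  | cons d w ih =>
    obtain ⟨d', v', rfl, h₁, h₂⟩ := exists_cons_of_map_eq v _ _ e.symm
    obtain ⟨c, rfl, rfl⟩ := h d d' h₁.symm
    obtain ⟨t, rfl, rfl⟩ := ih v' h₂.symm
    exact ⟨cons c t, rfl, rfl⟩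

/-- Maps preserve lengths, so only a single edge can map to a single edge. This is the cartesianness
of the unit of the free category monad. -/
theorem exists_single_of_map_eq {x y : α} (w : Walk H x y) (e : K (o x) (o y))
    (h : w.map o m = cons e (nil _)) : ∃ d : H x y, w = cons d (nil y) ∧ m d = e := by
  have hl : w.length = 1 := (length_map o m w).symm.trans (congrArg length h)
  cases w with
  | nil => simp [length] at hl
  | cons d w =>
    cases w with
    | nil =>
      simp only [map, cons.injEq] at h
      exact ⟨d, rfl, eq_of_heq h.2.1⟩
    | cons => simp [length] at hl

end Walk

namespace Gph

variable {n : ℕ} {α β : Type u} {H H' : α → α → NGlobSet.{u} n} {K K' : β → β → NGlobSet.{u} n}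

/-- A square of graphs with horizontal maps that are identities on vertices is a pullback if the
squares of hom-objects are. -/
theorem isPullback_toGlob (o : α → β) (a : ∀ x y, H x y ⟶ H' x y) (b : ∀ x y, K x y ⟶ K' x y)
    (m : ∀ x y, H x y ⟶ K (o x) (o y)) (m' : ∀ x y, H' x y ⟶ K' (o x) (o y))
    (sq : ∀ x y, IsPullback (a x y) (m x y) (m' x y) (b (o x) (o y))) :
    IsPullback ((toGlob n).map (Hom.mk (X := ⟨α, H⟩) (Y := ⟨α, H'⟩) (fun x => x) a))
      ((toGlob n).map (Hom.mk (X := ⟨α, H⟩) (Y := ⟨β, K⟩) o m))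
      ((toGlob n).map (Hom.mk (X := ⟨α, H'⟩) (Y := ⟨β, K'⟩) o m'))
      ((toGlob n).map (Hom.mk (X := ⟨β, K⟩) (Y := ⟨β, K'⟩) (fun x => x) b)) := by
  have w : Hom.mk (X := ⟨α, H⟩) (Y := ⟨α, H'⟩) (fun x => x) a ≫
      Hom.mk (X := ⟨α, H'⟩) (Y := ⟨β, K'⟩) o m' =
      Hom.mk (X := ⟨α, H⟩) (Y := ⟨β, K⟩) o m ≫
      Hom.mk (X := ⟨β, K⟩) (Y := ⟨β, K'⟩) (fun x => x) b :=
    hom_ext' (X := ⟨α, H⟩) (Y := ⟨β, K'⟩) (o := o) (m := fun x y => a x y ≫ m' x y)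
      (m' := fun x y => m x y ≫ b (o x) (o y)) rfl rfl fun x y => (sq x y).w
  refine isPullback_of_elPullback ?_ ?_
  · exact ((toGlob n).map_comp _ _).symm.trans
      ((congrArg (toGlob n).map w).trans ((toGlob n).map_comp _ _))
  · rintro ⟨⟨k⟩, hk⟩
    obtain _ | k := k
    · exact ⟨fun x y h _ => h, fun x y h => ⟨x, rfl, h⟩⟩
    · have hsq := fun x y => elPullback_of_isPullback (sq x y)
        (globe k (Nat.le_of_succ_le_succ hk))
      constructor
      · rintro ⟨x, y, c⟩ ⟨x', y', c'⟩ h₁ h₂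
        obtain rfl : x = x' := congrArg (fun t => t.1) h₁
        obtain rfl : y = y' := congrArg (fun t => t.2.1) h₁
        have e₁ := mk_injective (P := fun x y => (H' x y).obj
          (globe k (Nat.le_of_succ_le_succ hk))) h₁
        have e₂ := mk_injective (P := fun x y => (K x y).obj
          (globe k (Nat.le_of_succ_le_succ hk))) h₂
        exact congrArg (fun t => (⟨x, y, t⟩ : Σ x y : α, (H x y).obj
          (globe k (Nat.le_of_succ_le_succ hk)))) ((hsq x y).1 c c' e₁ e₂)
      · rintro ⟨x, y, c⟩ ⟨x', y', c'⟩ h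
        obtain rfl : o x = x' := congrArg (fun t => t.1) h
        obtain rfl : o y = y' := congrArg (fun t => t.2.1) h
        obtain ⟨d, h₁, h₂⟩ := (hsq x y).2 c c' (mk_injective (P := fun x y => (K' x y).obj
          (globe k (Nat.le_of_succ_le_succ hk))) h)
        exact ⟨⟨x, y, d⟩, congrArg (fun t => (⟨x, y, t⟩ : Σ x y : α, (H' x y).obj
          (globe k (Nat.le_of_succ_le_succ hk)))) h₁, congrArg (fun t => (⟨_, _, t⟩ :
            Σ x y : β, (K x y).obj (globe k (Nat.le_of_succ_le_succ hk)))) h₂⟩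

end Gph

/-! ### Morphisms whose counit squares are cartesian -/

section CounitCartesian

variable {n : ℕ} {V : Type (u + 1)} [Category.{u} V] {F : NGlobSet.{u} n ⥤ V}
  {U : V ⥤ NGlobSet.{u} n} (adj : F ⊣ U)

/-- The underlying naturality square of the counit is a pullback. -/
def CounitCartesian {A B : V} (g : A ⟶ B) : Prop :=
  IsPullback (U.map (adj.counit.app A)) (U.map (F.map (U.map g))) (U.map g)
    (U.map (adj.counit.app B))

variable {adj}

theorem counit_square {A B : V} (g : A ⟶ B) :
    U.map (adj.counit.app A) ≫ U.map g = U.map (F.map (U.map g)) ≫ U.map (adj.counit.app B) := by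
  rw [← U.map_comp, ← U.map_comp]
  exact congrArg U.map (adj.counit_naturality g).symm

theorem CounitCartesian.comp {A B C : V} {g : A ⟶ B} {g' : B ⟶ C} (h : CounitCartesian adj g)
    (h' : CounitCartesian adj g') : CounitCartesian adj (g ≫ g') := by
  have := IsPullback.paste_vert h h'
  rw [← U.map_comp, ← F.map_comp, ← U.map_comp] at this
  exact this

theorem CounitCartesian.id (A : V) : CounitCartesian adj (𝟙 A) := by
  have : IsIso (U.map (𝟙 A)) := by rw [U.map_id]; infer_instance
  have : IsIso (U.map (F.map (U.map (𝟙 A)))) := by rw [U.map_id, F.map_id, U.map_id]; infer_instance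
  exact IsPullback.of_vert_isIso ⟨counit_square _⟩

/-- The multiplication at `X` is `U` applied to the counit at `F X`, so this is the cartesianness of
the multiplication. -/
theorem Good.counitCartesian_map (h : Good adj) {X Y : NGlobSet.{u} n} (f : X ⟶ Y) :
    CounitCartesian adj (F.map f) :=
  (h.mul f).flip

/-- Both `U` and `F ⋙ U` preserve pullbacks. Pasting the image of the given square under `U`, then
`F ⋙ U`, with the counit square of `g` gives a rectangle that naturality rewrites as the counit
square of `g'` followed by the image of the given square under `U`; the latter is cancelled. -/
theorem CounitCartesian.of_isPullback (h : Good adj) {A B A' B' : V} {p : A' ⟶ A} {g' : A' ⟶ B'}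
    {g : A ⟶ B} {q : B' ⟶ B} (sq : IsPullback p g' g q) (hg : CounitCartesian adj g) :
    CounitCartesian adj g' := by
  have := h.preservesPullbacks
  have := adj.rightAdjoint_preservesLimits
  have s₁ := sq.map U
  have s₂ := (s₁.map (F ⋙ U)).paste_horiz hg
  refine IsPullback.of_right (h₁₂ := U.map p) (h₂₂ := U.map q) (v₁₃ := U.map g) ?_ (counit_square g')
    s₁
  rw [counit_square, counit_square]
  exact s₂

/-- A product of maps is a composite of two whiskerings, each a base change of `g` or `g'` along a
projection. -/
theorem CounitCartesian.tensor [CartesianMonoidalCategory V] (h : Good adj) {A B A' B' : V}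
    {g : A ⟶ B} {g' : A' ⟶ B'} (hg : CounitCartesian adj g) (hg' : CounitCartesian adj g') :
    CounitCartesian adj (g ⊗ₘ g') := by
  rw [MonoidalCategory.tensorHom_def]
  refine .comp ?_ ?_
  · refine .of_isPullback h (p := fst A A') (q := fst B A') ?_ hg
    refine ⟨⟨(whiskerRight_fst _ _).symm⟩, ⟨PullbackCone.IsLimit.mk _
      (fun s => lift s.fst (s.snd ≫ snd _ _)) (fun s => lift_fst _ _) (fun s => ?_)
      (fun s m h₁ h₂ => ?_)⟩⟩
    · have := s.condition
      ext <;> simp [this]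
    · ext <;> simp [← h₁, ← h₂]
  · refine .of_isPullback h (p := snd B A') (q := snd B B') ?_ hg'
    refine ⟨⟨(whiskerLeft_snd _ _).symm⟩, ⟨PullbackCone.IsLimit.mk _
      (fun s => lift (s.snd ≫ fst _ _) s.fst) (fun s => lift_snd _ _) (fun s => ?_)
      (fun s m h₁ h₂ => ?_)⟩⟩
    · have := s.condition
      ext <;> simp [this]
    · ext <;> simp [← h₁, ← h₂]

/-- The action of the counit on cells. -/
def counitCell (adj : F ⊣ U) (k : GlobeLE n) {B : V} (t : (U ⋙ F ⋙ U ⋙ cells n k).obj B) :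
    (U ⋙ cells n k).obj B :=
  elMap (U ⋙ cells n k) (adj.counit.app B) t

theorem counitCell_naturality (k : GlobeLE n) {B C : V} (g : B ⟶ C)
    (t : (U ⋙ F ⋙ U ⋙ cells n k).obj B) :
    counitCell adj k (elMap (U ⋙ F ⋙ U ⋙ cells n k) g t) =
      elMap (U ⋙ cells n k) g (counitCell adj k t) :=
  (ConcreteCategory.congr_hom (congrArg (fun s => NatTrans.app s k) (counit_square (adj := adj) g))
    t).symm

theorem counitCartesian_iff {B C : V} (g : B ⟶ C) : CounitCartesian adj g ↔ ∀ k : GlobeLE n,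
    (∀ s t, counitCell adj k s = counitCell adj k t →
      elMap (U ⋙ F ⋙ U ⋙ cells n k) g s = elMap (U ⋙ F ⋙ U ⋙ cells n k) g t → s = t) ∧
    ∀ a t, elMap (U ⋙ cells n k) g a = counitCell adj k t →
      ∃ s, counitCell adj k s = a ∧ elMap (U ⋙ F ⋙ U ⋙ cells n k) g s = t :=
  ⟨fun h k => elPullback_of_isPullback h k, fun h => isPullback_of_elPullback (counit_square g) h⟩

section Coproducts

variable [HasCoproducts.{u} V] {J : Type u} (A : J → V)

theorem Good.bijective_monad (h : Good adj) (k : GlobeLE n) :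
    Function.Bijective fun p : Σ j, (U ⋙ F ⋙ U ⋙ cells n k).obj (A j) =>
      elMap (U ⋙ F ⋙ U ⋙ cells n k) (Sigma.ι A p.1) p.2 := by
  have := h.preservesCoproducts_forget
  have := fun J => (h.elPres k).preservesCoproducts J
  exact bijective_sigma _ A

theorem Good.bijective_forget (h : Good adj) (k : GlobeLE n) :
    Function.Bijective fun p : Σ j, (U ⋙ cells n k).obj (A j) =>
      elMap (U ⋙ cells n k) (Sigma.ι A p.1) p.2 := by
  have := h.preservesCoproducts_forget
  exact bijective_sigma _ A

/-- On cells, `U` and `U ⋙ F ⋙ U` turn coproducts into disjoint unions, and the counit respects the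
summands. Hence injections have cartesian counit squares, and `Good.counitCartesian_of_ι` may work
on each summand. -/
theorem Good.counitCartesian_ι (h : Good adj) (j : J) : CounitCartesian adj (Sigma.ι A j) := by
  rw [counitCartesian_iff]
  intro k
  have hm := h.bijective_monad A k
  have hf := h.bijective_forget A k
  constructor
  · intro s t _ e
    have := hm.1 (a₁ := ⟨j, s⟩) (a₂ := ⟨j, t⟩) e
    simpa using this
  · intro a t e
    obtain ⟨⟨i, s⟩, rfl⟩ := hm.2 t
    have := hf.1 (a₁ := ⟨j, a⟩) (a₂ := ⟨i, counitCell adj k s⟩)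
      (e.trans (counitCell_naturality k _ s))
    simp only [Sigma.mk.injEq] at this
    obtain ⟨rfl, e'⟩ := this
    exact ⟨s, (eq_of_heq e').symm, rfl⟩

theorem Good.counitCartesian_of_ι (h : Good adj) {B : V} (g : ∐ A ⟶ B)
    (hg : ∀ j, CounitCartesian adj (Sigma.ι A j ≫ g)) : CounitCartesian adj g := by
  simp only [counitCartesian_iff] at hg ⊢
  intro k
  have hm := h.bijective_monad A k
  have hf := h.bijective_forget A k
  constructor
  · intro s t e₁ e₂
    obtain ⟨⟨i, s⟩, rfl⟩ := hm.2 s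
    obtain ⟨⟨j, t⟩, rfl⟩ := hm.2 t
    have := hf.1 (a₁ := ⟨i, counitCell adj k s⟩) (a₂ := ⟨j, counitCell adj k t⟩)
      ((counitCell_naturality k _ s).symm.trans (e₁.trans (counitCell_naturality k _ t)))
    simp only [Sigma.mk.injEq] at this
    obtain ⟨rfl, e'⟩ := this
    refine congrArg _ ((hg i k).1 s t (eq_of_heq e') ?_)
    rw [elMap_comp, elMap_comp]
    exact e₂
  · intro a t e
    obtain ⟨⟨i, a⟩, rfl⟩ := hf.2 a
    obtain ⟨s, rfl, rfl⟩ := (hg i k).2 a t ((elMap_comp _ _ _ _).trans e)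
    exact ⟨elMap _ (Sigma.ι A i) s, counitCell_naturality k _ s, (elMap_comp _ _ _ _).symm⟩

end Coproducts

end CounitCartesian

/-! ### Cartesian squares of free enriched categories -/

theorem isPullback_of_cells {n : ℕ} {V : Type (u + 1)} [Category.{u} V] (U : V ⥤ NGlobSet.{u} n)
    {P X Y Z : V} {p : P ⟶ X} {q : P ⟶ Y} {f : X ⟶ Z} {g : Y ⟶ Z}
    (w : ∀ k a, elMap (U ⋙ cells n k) f (elMap (U ⋙ cells n k) p a) =
      elMap (U ⋙ cells n k) g (elMap (U ⋙ cells n k) q a))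
    (h : ∀ k, ElPullback (U ⋙ cells n k) p q f g) :
    IsPullback (U.map p) (U.map q) (U.map f) (U.map g) := by
  refine isPullback_of_elPullback ?_ h
  refine NatTrans.ext (funext fun k => ConcreteCategory.hom_ext _ _ fun a => w k a)

namespace Walk

theorem map_injective {α : Type u} {H K : α → α → Type u} {a : ∀ {x y}, H x y → K x y}
    (h : ∀ {x y} (e e' : H x y), a e = a e' → e = e') {x z : α} (w w' : Walk H x z)
    (e : w.map (fun x => x) a = w'.map (fun x => x) a) : w = w' :=
  pullback_ext (o := fun x => x) (m := a) (fun e e' h₁ _ => h e e' h₁) w w' e e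

theorem map_surjective {α : Type u} {H K : α → α → Type u} {a : ∀ {x y}, H x y → K x y}
    (h : ∀ {x y} (e : K x y), ∃ d : H x y, a d = e) {x z : α} (w : Walk K x z) :
    ∃ t : Walk H x z, t.map (fun x => x) a = w := by
  induction w with
  | nil x => exact ⟨nil x, rfl⟩
  | cons e w ih =>
    obtain ⟨d, rfl⟩ := h e
    obtain ⟨t, rfl⟩ := ih
    exact ⟨cons d t, rfl⟩

end Walk

namespace Gph

section

variable {V : Type (u + 1)} [Category.{u} V] [CartesianMonoidalCategory V] [IsDistrib V]

/-- The action on hom-objects of the enriched functor between free enriched categories induced by a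
map of graphs. -/
abbrev freeMor {X Y : Gph.{u} V} (o : X.vertex → Y.vertex)
    (m : ∀ x y, X.hom x y ⟶ Y.hom (o x) (o y)) (x z : X.vertex) :
    X.freeHom x z ⟶ Y.freeHom (o x) (o z) :=
  freeMap (C := Y.free.carrier) o (fun x y => m x y ≫ Y.freeEdge (o x) (o y)) x z

section Elements

variable (L : V ⥤ Type u) [PreservesFiniteProducts L]

variable {X Y : Gph.{u} V} (o : X.vertex → Y.vertex) (m : ∀ x y, X.hom x y ⟶ Y.hom (o x) (o y))

theorem elMap_freeEdge (X : Gph.{u} V) {x y : X.vertex} (a : L.obj (X.hom x y)) :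
    elMap L (X.freeEdge x y) a = X.walkEl L (.cons a (.nil y)) := by
  have h : X.freeEdge x y = (ρ_ _).inv ≫ X.hom x y ◁ X.freeNil y ≫ X.freePre x y y :=
    congrArg ((ρ_ _).inv ≫ ·) (X.ι_freePre (.nil y)).symm
  have e : elMap L (ρ_ (X.hom x y)).inv a = elPair L a (elUnit L) := by
    refine el_ext L ?_ (elUnit_ext L _ _)
    rw [elMap_fst_elPair, ← elMap_comp, rightUnitor_inv_fst, elMap_id]
  rw [h, elMap_comp, elMap_comp, e, elMap_whiskerLeft]
  rfl

theorem elCompose_walkEl (X : Gph.{u} V) {x z : X.vertex} (W : Walk (Walk (X.elEdge L)) x z) :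
    elCompose (C := X.free.carrier) L (W.map (K := elHom L X.free.carrier) (fun x => x)
      (X.walkEl L)) = X.walkEl L W.flatten := by
  refine Eq.trans ?_ (X.walkEl_eq_elCompose L _).symm
  refine Eq.trans ?_ (congrArg (elCompose (C := X.free.carrier) L)
    (Walk.flatten_map (K := elHom L X.free.carrier) (fun x => x)
      (fun {x y} a => elMap L (X.freeEdge x y) a) W))
  refine Eq.trans ?_ (elCompose_flatten (C := X.free.carrier) L _).symm
  refine congrArg (elCompose (C := X.free.carrier) L) ?_
  induction W with
  | nil => rfl
  | cons e w ih => exact congrArg₂ Walk.cons (X.walkEl_eq_elCompose L e) ih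

/-- The underlying graph of the free enriched category. -/
abbrev freeGph (X : Gph.{u} V) : Gph.{u} V := (VCat.toGph V).obj X.free

/-- The composition of the free enriched category, as a map out of the free enriched category on
its underlying graph. -/
abbrev freeMul (X : Gph.{u} V) (x z : X.vertex) : X.freeGph.freeHom x z ⟶ X.freeHom x z :=
  freeMap (X := X.freeGph) (C := X.free.carrier) (fun x => x) (fun _ _ => 𝟙 _) x z

/-- Reduces the multiplication of the free enriched category monad to concatenation of walks, whose
cartesianness is `Walk.existsUnique_flatten`. -/
theorem elMap_freeMul (X : Gph.{u} V) {x z : X.vertex} (W : Walk (Walk (X.elEdge L)) x z) :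
    elMap L (X.freeMul x z) (X.freeGph.walkEl L
      (W.map (K := X.freeGph.elEdge L) (fun x => x) (X.walkEl L))) = X.walkEl L W.flatten := by
  refine (elMap_freeMap (X := X.freeGph) (C := X.free.carrier) L (fun x => x) _ _).trans
    (Eq.trans (congrArg (elCompose (C := X.free.carrier) L) ?_) (X.elCompose_walkEl L W))
  induction W with
  | nil => rfl
  | cons e w ih => exact congrArg₂ Walk.cons (elMap_id L _) ih

theorem elMap_freeMor_freeMor {x z : X.vertex} (W : Walk (Walk (X.elEdge L)) x z) :
    elMap L (freeMor (X := X.freeGph) (Y := Y.freeGph) o (freeMor o m) x z) (X.freeGph.walkEl L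
      (W.map (K := X.freeGph.elEdge L) (fun x => x) (X.walkEl L))) =
    Y.freeGph.walkEl L (Walk.map (K := Y.freeGph.elEdge L) (fun x => x) (Y.walkEl L)
      (W.map (K := Walk (Y.elEdge L)) o fun w => w.map o fun {x y} a => elMap L (m x y) a)) := by
  refine (elMap_freeMap_freeEdge L (X := X.freeGph) (Y := Y.freeGph) o (freeMor o m) _).trans
    (congrArg (Y.freeGph.walkEl L) ?_)
  induction W with
  | nil => rfl
  | cons e w ih => exact congrArg₂ Walk.cons (elMap_freeMap_freeEdge L o m e) ih

variable [∀ J : Type u, PreservesColimitsOfShape (Discrete J) L]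

section

variable {α β : Type u} {H H' : α → α → V} {K K' : β → β → V} {o : α → β}
  {a : ∀ x y, H x y ⟶ H' x y} {b : ∀ x y, K x y ⟶ K' x y}
  {m : ∀ x y, H x y ⟶ K (o x) (o y)} {m' : ∀ x y, H' x y ⟶ K' (o x) (o y)}

/-- Elements of free hom-objects are walks, so this is the stability of pullback squares of edges
under the passage to walks. -/
theorem elPullback_freeMor
    (h : ∀ x y, ElPullback L (a x y) (m x y) (m' x y) (b (o x) (o y))) (x z : α) :
    ElPullback L (freeMor (X := ⟨α, H⟩) (Y := ⟨α, H'⟩) (fun x => x) a x z)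
      (freeMor (X := ⟨α, H⟩) (Y := ⟨β, K⟩) o m x z)
      (freeMor (X := ⟨α, H'⟩) (Y := ⟨β, K'⟩) o m' x z)
      (freeMor (X := ⟨β, K⟩) (Y := ⟨β, K'⟩) (fun x => x) b (o x) (o z)) := by
  have hH := walkEl_bijective L (⟨α, H⟩ : Gph.{u} V)
  have hH' := walkEl_bijective L (⟨α, H'⟩ : Gph.{u} V)
  have hK := walkEl_bijective L (⟨β, K⟩ : Gph.{u} V)
  have hK' := walkEl_bijective L (⟨β, K'⟩ : Gph.{u} V)
  have ea := elMap_freeMap_freeEdge L (X := ⟨α, H⟩) (Y := ⟨α, H'⟩) (fun x => x) a (x := x) (z := z)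
  have em := elMap_freeMap_freeEdge L (X := ⟨α, H⟩) (Y := ⟨β, K⟩) o m (x := x) (z := z)
  have em' := elMap_freeMap_freeEdge L (X := ⟨α, H'⟩) (Y := ⟨β, K'⟩) o m' (x := x) (z := z)
  have eb := elMap_freeMap_freeEdge L (X := ⟨β, K⟩) (Y := ⟨β, K'⟩) (fun x => x) b
    (x := o x) (z := o z)
  constructor
  · intro s t h₁ h₂
    obtain ⟨s, rfl⟩ := (hH x z).2 s
    obtain ⟨t, rfl⟩ := (hH x z).2 t
    have h₁ := (hH' x z).1 ((ea s).symm.trans (h₁.trans (ea t)))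
    have h₂ := (hK (o x) (o z)).1 ((em s).symm.trans (h₂.trans (em t)))
    exact congrArg _ (Walk.pullback_ext (fun {x y} e e' => (h x y).1 e e') s t h₁ h₂)
  · intro s t e
    obtain ⟨s, rfl⟩ := (hH' x z).2 s
    obtain ⟨t, rfl⟩ := (hK (o x) (o z)).2 t
    have e := (hK' (o x) (o z)).1 ((em' s).symm.trans (e.trans (eb t)))
    obtain ⟨w, h₁, h₂⟩ := Walk.pullback_exists (fun {x y} e e' => (h x y).2 e e') s t e
    exact ⟨_, (ea w).trans (congrArg _ h₁), (em w).trans (congrArg _ h₂)⟩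

theorem elMap_freeMor_comm
    (h : ∀ x y c, elMap L (m' x y) (elMap L (a x y) c) =
      elMap L (b (o x) (o y)) (elMap L (m x y) c)) (x z : α)
    (c : L.obj (freeHom (⟨α, H⟩ : Gph.{u} V) x z)) :
    elMap L (freeMor (X := ⟨α, H'⟩) (Y := ⟨β, K'⟩) o m' x z)
        (elMap L (freeMor (X := ⟨α, H⟩) (Y := ⟨α, H'⟩) (fun x => x) a x z) c) =
      elMap L (freeMor (X := ⟨β, K⟩) (Y := ⟨β, K'⟩) (fun x => x) b (o x) (o z))
        (elMap L (freeMor (X := ⟨α, H⟩) (Y := ⟨β, K⟩) o m x z) c) := by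
  obtain ⟨w, rfl⟩ := (walkEl_bijective L (⟨α, H⟩ : Gph.{u} V) x z).2 c
  refine (congrArg _ (elMap_freeMap_freeEdge L (X := ⟨α, H⟩) (Y := ⟨α, H'⟩) (fun x => x) a w)).trans
    ((elMap_freeMap_freeEdge L (X := ⟨α, H'⟩) (Y := ⟨β, K'⟩) o m' _).trans (Eq.symm ?_))
  refine (congrArg _ (elMap_freeMap_freeEdge L (X := ⟨α, H⟩) (Y := ⟨β, K⟩) o m w)).trans
    ((elMap_freeMap_freeEdge L (X := ⟨β, K⟩) (Y := ⟨β, K'⟩) (fun x => x) b _).trans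
      (congrArg (walkEl L (⟨β, K'⟩ : Gph.{u} V)) ?_))
  induction w with
  | nil => rfl
  | cons e w ih => exact congrArg₂ Walk.cons (h _ _ e).symm ih

end

theorem elPullback_freeEdge (x z : X.vertex) :
    ElPullback L (X.freeEdge x z) (m x z) (freeMor o m x z) (Y.freeEdge (o x) (o z)) := by
  constructor
  · intro a b h _
    have := (X.walkEl_bijective L x z).1
      ((X.elMap_freeEdge L a).symm.trans (h.trans (X.elMap_freeEdge L b)))
    cases this
    rfl
  · intro a b h
    obtain ⟨w, rfl⟩ := (X.walkEl_bijective L x z).2 a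
    have := (Y.walkEl_bijective L _ _).1
      ((elMap_freeMap_freeEdge L o m w).symm.trans (h.trans (Y.elMap_freeEdge L b)))
    obtain ⟨d, rfl, e⟩ := Walk.exists_single_of_map_eq (K := Y.elEdge L) (o := o)
      (m := fun {x y} a => elMap L (m x y) a) w b this
    exact ⟨d, X.elMap_freeEdge L d, e⟩

theorem exists_walk_walk (X : Gph.{u} V) {x z : X.vertex} (a : L.obj (X.freeGph.freeHom x z)) :
    ∃ W : Walk (Walk (X.elEdge L)) x z, a = X.freeGph.walkEl L
      (W.map (K := X.freeGph.elEdge L) (fun x => x) (X.walkEl L)) := by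
  obtain ⟨w, rfl⟩ := (X.freeGph.walkEl_bijective L x z).2 a
  obtain ⟨W, rfl⟩ := Walk.map_surjective (H := Walk (X.elEdge L)) (K := X.freeGph.elEdge L)
    (a := X.walkEl L) (fun {x y} e => (X.walkEl_bijective L x y).2 e) w
  exact ⟨W, rfl⟩

theorem elMap_freeMul_comm (x z : X.vertex) (c : L.obj (X.freeGph.freeHom x z)) :
    elMap L (freeMor o m x z) (elMap L (X.freeMul x z) c) =
      elMap L (Y.freeMul (o x) (o z))
        (elMap L (freeMor (X := X.freeGph) (Y := Y.freeGph) o (freeMor o m) x z) c) := by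
  obtain ⟨W, rfl⟩ := X.exists_walk_walk L c
  refine (congrArg _ (X.elMap_freeMul L W)).trans ((elMap_freeMap_freeEdge L o m _).trans
    (Eq.symm ?_))
  refine (congrArg _ (elMap_freeMor_freeMor L o m W)).trans ((Y.elMap_freeMul L _).trans
    (congrArg (Y.walkEl L) ?_))
  exact Walk.flatten_map o _ W

theorem elPullback_freeMul (x z : X.vertex) :
    ElPullback L (X.freeMul x z) (freeMor (X := X.freeGph) (Y := Y.freeGph) o (freeMor o m) x z)
      (freeMor o m x z) (Y.freeMul (o x) (o z)) := by
  constructor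
  · intro a b h₁ h₂
    obtain ⟨A, rfl⟩ := X.exists_walk_walk L a
    obtain ⟨B, rfl⟩ := X.exists_walk_walk L b
    have h₁ := (X.walkEl_bijective L x z).1
      ((X.elMap_freeMul L A).symm.trans (h₁.trans (X.elMap_freeMul L B)))
    have h₂ := Walk.map_injective (H := Walk (Y.elEdge L)) (K := Y.freeGph.elEdge L)
      (a := Y.walkEl L) (fun {x y} e e' => @(Y.walkEl_bijective L x y).1 e e') _ _
      ((Y.freeGph.walkEl_bijective L _ _).1 ((elMap_freeMor_freeMor L o m A).symm.trans
      (h₂.trans (elMap_freeMor_freeMor L o m B))))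
    have := (Walk.existsUnique_flatten (K := Y.elEdge L) o (fun {x y} a => elMap L (m x y) a)
      B.flatten (B.map o fun w => w.map o fun {x y} a => elMap L (m x y) a)
      (Walk.flatten_map o _ B)).unique ⟨h₁, h₂⟩ ⟨rfl, rfl⟩
    rw [this]
  · intro a b h
    obtain ⟨w, rfl⟩ := (X.walkEl_bijective L x z).2 a
    obtain ⟨B, rfl⟩ := Y.exists_walk_walk L b
    have h := (Y.walkEl_bijective L _ _).1
      ((elMap_freeMap_freeEdge L o m w).symm.trans (h.trans (Y.elMap_freeMul L B)))
    obtain ⟨W, ⟨h₁, h₂⟩, -⟩ := Walk.existsUnique_flatten (K := Y.elEdge L) o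
      (fun {x y} a => elMap L (m x y) a) w B h.symm
    exact ⟨_, (X.elMap_freeMul L W).trans (congrArg _ h₁),
      (elMap_freeMor_freeMor L o m W).trans (congrArg (fun t => Y.freeGph.walkEl L
        (Walk.map (K := Y.freeGph.elEdge L) (fun x => x) (Y.walkEl L) t)) h₂)⟩

end Elements

end

end Gph

/-- The image of a sequence under a map. -/
def VPath.map {α β : Type u} (o : α → β) : ∀ {x z : α}, VPath α x z → VPath β (o x) (o z)
  | _, _, .nil x => .nil (o x)
  | _, _, .cons x p => .cons (o x) (p.map o)

namespace Gph

section

variable {V : Type (u + 1)} [Category.{u} V] [CartesianMonoidalCategory V]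
  {X Y : Gph.{u} V} (o : X.vertex → Y.vertex) (m : ∀ x y, X.hom x y ⟶ Y.hom (o x) (o y))

/-- The product of the action of a map of graphs along a path. -/
def pathMap : ∀ {x z : X.vertex} (p : VPath X.vertex x z), X.pathObj p ⟶ Y.pathObj (p.map o)
  | _, _, .nil _ => 𝟙 (𝟙_ V)
  | _, _, .cons x (y := y) p => m x y ⊗ₘ pathMap p

/-- The free functor respects the decomposition into paths: it maps the summand of a path to that of
the image path by a product of maps on edges. This prepares the argument of
`counitCartesian_freeMor`. -/
theorem freeι_freeMor [IsDistrib V] {x z : X.vertex} (p : VPath X.vertex x z) :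
    X.freeι p ≫ freeMor o m x z = pathMap o m p ≫ Y.freeι (p.map o) := by
  refine (freeι_freeMap (C := Y.free.carrier) o _ p).trans ?_
  induction p with
  | nil x => exact (Category.id_comp _).symm
  | cons x p ih =>
    rename_i y t
    refine (congrArg (fun f => ((m x y ≫ Y.freeEdge (o x) (o y)) ⊗ₘ f) ≫
      Y.freeComp (o x) (o y) (o t)) ih).trans ?_
    change _ = (m x y ⊗ₘ pathMap o m p) ≫ Y.freeCons (o x) (p.map o)
    rw [← tensorHom_comp_tensorHom, Category.assoc, tensorHom_def' (Y.freeEdge (o x) (o y)),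
      Category.assoc, freeEdge_freeComp, ι_freePre]

end

section

variable {n : ℕ} {V : Type (u + 1)} [Category.{u} V] [CartesianMonoidalCategory V]
  {F : NGlobSet.{u} n ⥤ V} {U : V ⥤ NGlobSet.{u} n} {adj : F ⊣ U}
  {X Y : Gph.{u} V} (o : X.vertex → Y.vertex) (m : ∀ x y, X.hom x y ⟶ Y.hom (o x) (o y))

theorem counitCartesian_pathMap (h : Good adj) (hm : ∀ x y, CounitCartesian adj (m x y))
    {x z : X.vertex} (p : VPath X.vertex x z) : CounitCartesian adj (pathMap o m p) := by
  induction p with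
  | nil x => exact .id _
  | cons x p ih => exact .tensor h (hm _ _) ih

/-- Closure under products treats a single path, composition with an injection puts the result into
the coproduct, and cartesianness is then tested on summands. -/
theorem counitCartesian_freeMor [IsDistrib V] (h : Good adj)
    (hm : ∀ x y, CounitCartesian adj (m x y)) (x z : X.vertex) :
    CounitCartesian adj (freeMor o m x z) := by
  refine h.counitCartesian_of_ι _ _ fun p => ?_
  have := (counitCartesian_pathMap o m h hm p).comp (h.counitCartesian_ι
    (fun p : VPath Y.vertex (o x) (o z) => Y.pathObj p) (p.map o))
  exact (freeι_freeMor o m p) ▸ this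

end

end Gph

/-! ### The free `(n+1)`-category monad is cartesian -/

theorem isPullback_congr {C : Type*} [Category* C] {P X Y Z : C} {p p' : P ⟶ X} {q q' : P ⟶ Y}
    {f f' : X ⟶ Z} {g g' : Y ⟶ Z} (h : IsPullback p q f g) (hp : p' = p) (hq : q' = q)
    (hf : f' = f) (hg : g' = g) : IsPullback p' q' f' g' := by
  subst hp hq hf hg
  exact h

namespace Gph

variable {n : ℕ} {V : Type (u + 1)} [Category.{u} V] [CartesianMonoidalCategory V] [IsDistrib V]
  {F : NGlobSet.{u} n ⥤ V} {U : V ⥤ NGlobSet.{u} n} (adj : F ⊣ U)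

theorem gphAdj_unit_app (X : Gph.{u} (NGlobSet.{u} n)) :
    (gphAdj adj).unit.app X = Hom.mk (X := X)
      (Y := ⟨X.vertex, fun x y => U.obj (((map F).obj X).freeHom x y)⟩) (fun x => x)
      (fun x y => adj.unit.app (X.hom x y) ≫ U.map (((map F).obj X).freeEdge x y)) :=
  (Adjunction.comp_unit_app _ _ _).trans (congrArg (fun t => (mapAdj adj).unit.app X ≫ (map U).map t)
    (freeAdj_unit_app ((map F).obj X)))

theorem stepAdj_unit_app (X : NGlobSet.{u} (n + 1)) :
    (stepAdj adj).unit.app X =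
      (globAdj n).unit.app X ≫ (toGlob n).map ((gphAdj adj).unit.app ((toGlob n).inv.obj X)) := by
  refine (Adjunction.comp_unit_app _ _ _).trans ?_
  refine (congrArg (· ≫ _) (Adjunction.comp_unit_app _ _ _)).trans ?_
  refine (Category.assoc _ _ _).trans (congrArg ((globAdj n).unit.app X ≫ ·) ?_)
  refine ((toGlob n).map_comp _ _).symm.trans (congrArg (toGlob n).map ?_)
  exact (Adjunction.comp_unit_app _ _ _).symm

variable (U) in
theorem map_freeFunctor_map {X Y : Gph.{u} V} (φ : X ⟶ Y) :
    (VCat.toGph V ⋙ map U).map ((freeFunctor V).map φ) = Hom.mk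
      (X := ⟨X.vertex, fun x y => U.obj (X.freeHom x y)⟩)
      (Y := ⟨Y.vertex, fun x y => U.obj (Y.freeHom x y)⟩) φ.obj
      (fun x y => U.map (freeMor φ.obj φ.map x y)) :=
  congrArg (VCat.toGph V ⋙ map U).map (freeFunctor_map φ)

variable (U) in
theorem map_freeAdj_counit (C : VCat.{u} V) :
    (VCat.toGph V ⋙ map U).map ((freeAdj V).counit.app C) = Hom.mk
      (X := ⟨C.carrier, fun x y => U.obj (((VCat.toGph V).obj C).freeHom x y)⟩)
      (Y := ⟨C.carrier, fun x y => U.obj (x ⟶[V] y)⟩) (fun x => x)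
      (fun x y => U.map (freeMap (X := (VCat.toGph V).obj C) (C := C.carrier) (fun x => x)
        (fun _ _ => 𝟙 _) x y)) :=
  congrArg (VCat.toGph V ⋙ map U).map (freeAdj_counit_app C)

variable {adj}

/-- On hom-objects the unit is the unit of `adj` followed by the inclusion of edges, and the squares
of both factors are pullbacks. -/
theorem isPullback_unit (h : Good adj) {X Y : Gph.{u} (NGlobSet.{u} n)} (f : X ⟶ Y) :
    IsPullback ((toGlob n).map ((gphAdj adj).unit.app X)) ((toGlob n).map f)
      ((toGlob n).map ((VCat.toGph V ⋙ map U).map ((freeFunctor V).map ((map F).map f))))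
      ((toGlob n).map ((gphAdj adj).unit.app Y)) := by
  have hc := h.cellFamily
  have hp := hc.products
  have hcp := hc.coproducts
  refine isPullback_congr (isPullback_toGlob (H := X.hom)
    (H' := fun x y => U.obj (((map F).obj X).freeHom x y)) (K := Y.hom)
    (K' := fun x y => U.obj (((map F).obj Y).freeHom x y)) f.obj
    (fun x y => adj.unit.app (X.hom x y) ≫ U.map (((map F).obj X).freeEdge x y))
    (fun x y => adj.unit.app (Y.hom x y) ≫ U.map (((map F).obj Y).freeEdge x y)) f.map
    (fun x y => U.map (freeMor ((map F).map f).obj ((map F).map f).map x y)) fun x y => ?_)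
    (congrArg (toGlob n).map (gphAdj_unit_app adj X)) rfl
    (congrArg (toGlob n).map (map_freeFunctor_map U ((map F).map f)))
    (congrArg (toGlob n).map (gphAdj_unit_app adj Y))
  refine IsPullback.paste_horiz (h.unit (f.map x y)).flip (isPullback_of_cells U (fun k a => ?_)
    fun k => elPullback_freeEdge (U ⋙ cells n k) (X := (map F).obj X) (Y := (map F).obj Y)
      ((map F).map f).obj ((map F).map f).map x y)
  refine (elMap_comp (U ⋙ cells n k) _ _ _).symm.trans
    (Eq.trans ?_ (elMap_comp (U ⋙ cells n k) _ _ _))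
  exact congrArg (fun t => elMap (U ⋙ cells n k) t a)
    (freeEdge_freeMap (C := ((map F).obj Y).free.carrier) _ _)

/-- Cartesianness of the counit of `adj` is available only for suitable maps, whence `hg`. Forming
free enriched categories then preserves these pullbacks of hom-objects, by `elPullback_freeMor`. -/
theorem isPullback_freeFunctor_counit (h : Good adj) {C D : VCat.{u} V} (g : C ⟶ D)
    (hg : ∀ x y, CounitCartesian adj (g.map x y)) :
    IsPullback
      ((toGlob n).map ((VCat.toGph V ⋙ map U).map ((freeFunctor V).map
        ((mapAdj adj).counit.app ((VCat.toGph V).obj C)))))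
      ((toGlob n).map ((VCat.toGph V ⋙ map U).map ((freeFunctor V).map
        ((map F).map ((VCat.toGph V ⋙ map U).map g)))))
      ((toGlob n).map ((VCat.toGph V ⋙ map U).map ((freeFunctor V).map ((VCat.toGph V).map g))))
      ((toGlob n).map ((VCat.toGph V ⋙ map U).map ((freeFunctor V).map
        ((mapAdj adj).counit.app ((VCat.toGph V).obj D))))) := by
  have hc := h.cellFamily
  have hp := hc.products
  have hcp := hc.coproducts
  let X : Gph.{u} V := (map F).obj ((VCat.toGph V ⋙ map U).obj C)
  let Y : Gph.{u} V := (map F).obj ((VCat.toGph V ⋙ map U).obj D)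
  refine isPullback_congr (isPullback_toGlob (H := fun x y => U.obj (X.freeHom x y))
    (H' := fun x y => U.obj (((VCat.toGph V).obj C).freeHom x y))
    (K := fun x y => U.obj (Y.freeHom x y))
    (K' := fun x y => U.obj (((VCat.toGph V).obj D).freeHom x y)) g.obj
    (fun x y => U.map (freeMor (X := X) (Y := (VCat.toGph V).obj C) (fun x => x)
      (fun x y => adj.counit.app _) x y))
    (fun x y => U.map (freeMor (X := Y) (Y := (VCat.toGph V).obj D) (fun x => x)
      (fun x y => adj.counit.app _) x y))
    (fun x y => U.map (freeMor (X := X) (Y := Y) g.obj (fun x y => F.map (U.map (g.map x y))) x y))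
    (fun x y => U.map (freeMor (X := (VCat.toGph V).obj C) (Y := (VCat.toGph V).obj D) g.obj
      g.map x y)) fun x y => ?_)
    (congrArg (toGlob n).map (map_freeFunctor_map U _))
    (congrArg (toGlob n).map (map_freeFunctor_map U _))
    (congrArg (toGlob n).map (map_freeFunctor_map U _))
    (congrArg (toGlob n).map (map_freeFunctor_map U _))
  refine isPullback_of_cells U (fun k => ?_) fun k => ?_
  · refine elMap_freeMor_comm (U ⋙ cells n k) (H' := ((VCat.toGph V).obj C).hom)
      (K' := ((VCat.toGph V).obj D).hom) (fun x y c => ?_) x y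
    exact (counitCell_naturality (adj := adj) k (g.map x y) c).symm
  · refine elPullback_freeMor (U ⋙ cells n k) (H' := ((VCat.toGph V).obj C).hom)
      (K' := ((VCat.toGph V).obj D).hom) (fun x y => ?_) x y
    exact elPullback_of_isPullback (hg x y) k

theorem isPullback_freeAdj_counit (h : Good adj) {X Y : Gph.{u} V} (φ : X ⟶ Y) :
    IsPullback
      ((toGlob n).map ((VCat.toGph V ⋙ map U).map ((freeAdj V).counit.app X.free)))
      ((toGlob n).map ((VCat.toGph V ⋙ map U).map ((freeFunctor V).map ((VCat.toGph V).map
        ((freeFunctor V).map φ)))))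
      ((toGlob n).map ((VCat.toGph V ⋙ map U).map ((freeFunctor V).map φ)))
      ((toGlob n).map ((VCat.toGph V ⋙ map U).map ((freeAdj V).counit.app Y.free))) := by
  have hc := h.cellFamily
  have hp := hc.products
  have hcp := hc.coproducts
  refine isPullback_congr (isPullback_toGlob (H := fun x y => U.obj (X.freeGph.freeHom x y))
    (H' := fun x y => U.obj (X.freeHom x y)) (K := fun x y => U.obj (Y.freeGph.freeHom x y))
    (K' := fun x y => U.obj (Y.freeHom x y)) φ.obj
    (fun x y => U.map (X.freeMul x y)) (fun x y => U.map (Y.freeMul x y))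
    (fun x y => U.map (freeMor (X := X.freeGph) (Y := Y.freeGph) φ.obj (freeMor φ.obj φ.map) x y))
    (fun x y => U.map (freeMor φ.obj φ.map x y)) fun x y => ?_)
    (congrArg (toGlob n).map (map_freeAdj_counit U _)) ?_
    (congrArg (toGlob n).map (map_freeFunctor_map U _))
    (congrArg (toGlob n).map (map_freeAdj_counit U _))
  · exact isPullback_of_cells U (fun k => elMap_freeMul_comm (U ⋙ cells n k) φ.obj φ.map x y)
      fun k => elPullback_freeMul (U ⋙ cells n k) φ.obj φ.map x y
  · exact congrArg (toGlob n).map ((congrArg (fun g => (VCat.toGph V ⋙ map U).map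
      ((freeFunctor V).map ((VCat.toGph V).map g))) (freeFunctor_map φ)).trans
      (map_freeFunctor_map U _))

theorem counitCartesian_freeFunctor_map (h : Good adj) {X Y : Gph.{u} (NGlobSet.{u} n)} (f : X ⟶ Y)
    (x y : X.vertex) :
    CounitCartesian adj (EnrichedFunctor.map (C := ((map F).obj X).free.carrier)
      (D := ((map F).obj Y).free.carrier) ((freeFunctor V).map ((map F).map f)) x y) := by
  have := counitCartesian_freeMor (X := (map F).obj X) (Y := (map F).obj Y) ((map F).map f).obj
    ((map F).map f).map h (fun x y => h.counitCartesian_map (f.map x y)) x y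
  rw [freeFunctor_map]
  exact this

end Gph

/-! ### The inductive step for unit and multiplication -/

namespace Good

variable {n : ℕ} {V : Type (u + 1)} [Category.{u} V] [CartesianMonoidalCategory V] [IsDistrib V]
  {F : NGlobSet.{u} n ⥤ V} {U : V ⥤ NGlobSet.{u} n} {adj : F ⊣ U}

theorem stepAdj_unit (h : Good adj) : NatTrans.Equifibered (Gph.stepAdj adj).toMonad.η := by
  intro X Y f
  have sq : IsPullback ((Gph.globAdj n).unit.app X) f
      ((Gph.toGlob n).map ((Gph.toGlob n).inv.map f)) ((Gph.globAdj n).unit.app Y) :=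
    .of_horiz_isIso ⟨((Gph.globAdj n).unit.naturality f).symm⟩
  exact (isPullback_congr (sq.paste_horiz (Gph.isPullback_unit h ((Gph.toGlob n).inv.map f)))
    (Gph.stepAdj_unit_app adj X) rfl rfl (Gph.stepAdj_unit_app adj Y)).flip

/-- The counit of the composite adjunction is built from three: that of an equivalence, that of
`adj` on hom-objects, and that of the free enriched category. The square is the pasting of the three
corresponding squares. The middle one is a pullback because the map between free objects has
cartesian counit squares on hom-objects. -/
theorem stepAdj_mul (h : Good adj) : NatTrans.Equifibered (Gph.stepAdj adj).toMonad.μ := by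
  intro X Y f
  let W : VCat.{u} V ⥤ NGlobSet.{u} (n + 1) := VCat.toGph V ⋙ Gph.map U ⋙ Gph.toGlob n
  let G := (((Gph.toGlob n).inv ⋙ Gph.map F) ⋙ Gph.freeFunctor V).map f
  have sq : IsPullback
      (W.map ((Gph.freeFunctor V).map ((Gph.map F).map ((Gph.globAdj n).counit.app
        ((VCat.toGph V ⋙ Gph.map U).obj _)))))
      (W.map ((Gph.freeFunctor V).map ((Gph.map F).map ((Gph.toGlob n).inv.map (W.map G)))))
      (W.map ((Gph.freeFunctor V).map ((Gph.map F).map ((VCat.toGph V ⋙ Gph.map U).map G))))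
      (W.map ((Gph.freeFunctor V).map ((Gph.map F).map ((Gph.globAdj n).counit.app
        ((VCat.toGph V ⋙ Gph.map U).obj _))))) := by
    have : ∀ Z, IsIso ((Gph.globAdj n).counit.app Z) := fun Z => inferInstanceAs
      (IsIso ((Gph.toGlob.{u} n).asEquivalence.symm.counit.app Z))
    refine .of_horiz_isIso ⟨?_⟩
    have := congrArg ((Gph.map F ⋙ Gph.freeFunctor V) ⋙ W).map ((Gph.globAdj n).counit.naturality
      ((VCat.toGph V ⋙ Gph.map U).map G))
    rw [Functor.map_comp, Functor.map_comp] at this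
    exact this.symm
  have key : ∀ C, W.map ((Gph.stepAdj adj).counit.app C) =
      W.map ((Gph.freeFunctor V).map ((Gph.map F).map ((Gph.globAdj n).counit.app
        ((VCat.toGph V ⋙ Gph.map U).obj C)))) ≫
      W.map ((Gph.freeFunctor V).map ((Gph.mapAdj adj).counit.app ((VCat.toGph V).obj C))) ≫
      W.map ((Gph.freeAdj V).counit.app C) := by
    intro C
    rw [← W.map_comp, ← W.map_comp, ← Category.assoc]
    refine congrArg W.map ((Adjunction.comp_counit_app _ _ _).trans ?_)
    refine congrArg (· ≫ (Gph.freeAdj V).counit.app C) ?_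
    refine Eq.trans ?_ ((Gph.freeFunctor V).map_comp _ _)
    exact congrArg (Gph.freeFunctor V).map (Adjunction.comp_counit_app _ _ _)
  have sqA := Gph.isPullback_freeFunctor_counit h G
    (Gph.counitCartesian_freeFunctor_map h ((Gph.toGlob n).inv.map f))
  have sqB := Gph.isPullback_freeAdj_counit h ((Gph.map F).map ((Gph.toGlob n).inv.map f))
  exact (isPullback_congr (sq.paste_horiz (sqA.paste_horiz sqB)) (key _) rfl rfl (key _)).flip

theorem stepAdj (h : Good adj) : Good (Gph.stepAdj adj) where
  monadic := h.stepAdj_monadic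
  unit := h.stepAdj_unit
  mul := h.stepAdj_mul
  fam := h.stepAdj_fam

end Good

/-! ### Sets as `0`-globular sets -/

theorem eq_globe_zero (k : GlobeLE 0) : globe 0 le_rfl = k := by
  obtain ⟨⟨k⟩, hk⟩ := k
  obtain rfl : k = 0 := Nat.le_zero.1 hk
  rfl

theorem globeHom_zero : ∀ f : GlobeHom 0 0, f = .id 0
  | .id _ => rfl
  | .src h => absurd h (lt_irrefl _)
  | .tgt h => absurd h (lt_irrefl _)

instance isEquivalence_U_zero : (U.{u} 0).IsEquivalence where
  faithful :=
    { map_injective := fun {A B} f g h => congrArg (fun t => NatTrans.app t (globe 0 le_rfl)) h }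
  full :=
    { map_surjective := fun {A B} f => by
        refine ⟨NatTrans.app f (globe 0 le_rfl), NatTrans.ext (funext fun k => ?_)⟩
        obtain rfl := eq_globe_zero k
        rfl }
  essSurj :=
    { mem_essImage := fun X => by
        have hm : ∀ f : globe 0 (le_refl 0) ⟶ globe 0 (le_refl 0), f = 𝟙 _ := by
          rintro ⟨f⟩
          exact congrArg ObjectProperty.homMk (globeHom_zero f)
        refine ⟨X.obj (globe 0 le_rfl), ⟨NatIso.ofComponents
          (fun k => X.mapIso (eqToIso (eq_globe_zero k))) fun {k l} f => ?_⟩⟩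
        obtain rfl := eq_globe_zero k
        obtain rfl := eq_globe_zero l
        obtain rfl := hm f
        refine (Category.id_comp _).trans ?_
        change X.map (𝟙 _) = X.map (𝟙 _) ≫ X.map (𝟙 _)
        rw [X.map_id, Category.comp_id] }

/-- The inverse of `U 0`, as a left adjoint. -/
def zeroAdj : (U.{u} 0).inv ⊣ U.{u} 0 := (U.{u} 0).asEquivalence.symm.toAdjunction

theorem good_zeroAdj : Good zeroAdj.{u} where
  monadic := by
    let _ : Reflective (U.{u} 0) := { L := _, adj := zeroAdj }
    exact isEquivalence_comparison_of_monadic zeroAdj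
  unit X Y f := by
    have : ∀ X, IsIso (zeroAdj.toMonad.η.app X) := fun X =>
      inferInstanceAs (IsIso ((U.{u} 0).asEquivalence.symm.unit.app X))
    exact .of_vert_isIso ⟨zeroAdj.toMonad.η.naturality f⟩
  mul X Y f := by
    have : ∀ A, IsIso (zeroAdj.counit.app A) := fun A =>
      inferInstanceAs (IsIso ((U.{u} 0).asEquivalence.symm.counit.app A))
    have : ∀ X, IsIso (zeroAdj.toMonad.μ.app X) := fun X =>
      inferInstanceAs (IsIso ((U.{u} 0).map (zeroAdj.counit.app _)))
    exact .of_vert_isIso ⟨zeroAdj.toMonad.μ.naturality f⟩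
  fam k := .iso ((Functor.leftUnitor _).symm ≪≫ Functor.isoWhiskerRight
    (U.{u} 0).asEquivalence.counitIso.symm (cells 0 k) ≪≫ Functor.associator _ _ _)
    (.base _ ⟨k, rfl⟩)

/-! ### Free strict `n`-categories -/

/-- The free strict `n`-category functor, with its properties. -/
structure FreeNCat (n : ℕ) : Type (u + 1) where
  F : NGlobSet.{u} n ⥤ NCat.{u} n
  adj : F ⊣ U.{u} n
  good : Good adj

/-- The free strict `n`-category functor. -/
def freeNCat : ∀ n : ℕ, FreeNCat.{u} n
  | 0 => ⟨_, zeroAdj, good_zeroAdj⟩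
  | n + 1 =>
    -- The properties at level `n` are needed already to construct the next functor, since they
    -- supply distributivity; hence functor, adjunction and properties are defined by one recursion.
    haveI : IsDistrib (NCat.{u} n) := (freeNCat n).good.isDistrib
    { F := (((Gph.toGlob n).inv ⋙ Gph.map (freeNCat n).F) ⋙ Gph.freeFunctor (NCat.{u} n) :
        NGlobSet.{u} (n + 1) ⥤ VCat.{u} (NCat.{u} n))
      adj := Gph.stepAdj (V := NCat.{u} n) (freeNCat n).adj
      good := Good.stepAdj (V := NCat.{u} n) (freeNCat n).good }

instance (n : ℕ) : IsDistrib (NCat.{u} n) := (freeNCat n).good.isDistrib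

/-- The free strict `n`-category adjunction. -/
abbrev nCatAdj (n : ℕ) : (freeNCat.{u} n).F ⊣ U.{u} n := (freeNCat n).adj

theorem good_nCatAdj (n : ℕ) : Good (nCatAdj.{u} n) := (freeNCat n).good

/-! ### Truncation preserves free strict `n`-categories -/

/-- Through `UIso`, the cells of a truncation are the cells of dimension at most `n` of the original
object, and `U (n + 1)` preserves coproducts. -/
theorem preservesCoproducts_S_cells (n : ℕ) (k : GlobeLE n) (J : Type u) :
    PreservesColimitsOfShape (Discrete J) (S.{u} n ⋙ U.{u} n ⋙ cells n k) := by
  have := (good_nCatAdj.{u} (n + 1)).preservesCoproducts_forget J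
  have : PreservesColimitsOfShape (Discrete J)
      (U.{u} (n + 1) ⋙ cells (n + 1) ((globeIncl n).obj k)) := inferInstance
  exact preservesColimitsOfShape_of_natIso
    (show U.{u} (n + 1) ⋙ cells (n + 1) ((globeIncl n).obj k) ≅ S.{u} n ⋙ U.{u} n ⋙ cells n k from
      Functor.isoWhiskerRight (UIso.{u} n).symm (cells n k))

/-- As `U 0` is an equivalence, the unit need only be bijective on `0`-cells; it is, since a free
category has the vertices of its graph as objects. -/
theorem beckChevalley_UIso_zero :
    BeckChevalley (nCatAdj.{u} 1) (nCatAdj.{u} 0) (UIso.{u} 0) := by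
  refine BeckChevalley.of_isEquivalence fun X => ?_
  have h := Gph.stepAdj_unit_app (V := NCat.{u} 0) zeroAdj.{u} X
  have : ∀ k, IsIso (((R.{u} 0).map ((nCatAdj.{u} 1).unit.app X)).app k) := by
    intro k
    obtain rfl := eq_globe_zero k
    refine (isIso_iff_bijective _).2 ?_
    have e := (congrArg (fun t => NatTrans.app t (globe 0 (Nat.zero_le 1))) h).trans (congrArg
      (fun t => ((Gph.globAdj 0).unit.app X ≫ (Gph.toGlob 0).map t).app (globe 0 (Nat.zero_le 1)))
      (Gph.gphAdj_unit_app (V := NCat.{u} 0) zeroAdj.{u} _))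
    have hb : Function.Bijective (((Gph.globAdj 0).unit.app X).app (globe 0 (Nat.zero_le 1))) :=
      (isIso_iff_bijective _).1 inferInstance
    have : ⇑(ConcreteCategory.hom (((nCatAdj.{u} 1).unit.app X).app (globe 0 (Nat.zero_le 1)))) =
        ⇑(ConcreteCategory.hom (((Gph.globAdj 0).unit.app X).app (globe 0 (Nat.zero_le 1)))) :=
      funext fun a => ConcreteCategory.congr_hom e a
    exact this ▸ hb
  exact NatIso.isIso_of_isIso_app _

/-- Three squares are pasted: the equivalence with graphs, the square for `n` applied to
hom-objects, and change of base along `S n`, which preserves free enriched categories. -/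
theorem beckChevalley_UIso_succ (n : ℕ)
    (h : BeckChevalley (nCatAdj.{u} (n + 1)) (nCatAdj.{u} n) (UIso.{u} n)) :
    BeckChevalley (nCatAdj.{u} (n + 2)) (nCatAdj.{u} (n + 1)) (UIso.{u} (n + 1)) := by
  let k : Gph.map (S.{u} n) ⋙ Gph.map (U.{u} n) ⋙ Gph.toGlob n ≅
      (Gph.map (U.{u} (n + 1)) ⋙ Gph.toGlob (n + 1)) ⋙ R.{u} (n + 1) :=
    Functor.isoWhiskerRight (Gph.mapIso (UIso n)) (Gph.toGlob n) ≪≫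
      Functor.isoWhiskerLeft (Gph.map (U (n + 1))) (restrictIso n)
  have h₁ := (Gph.beckChevalley_toGlob n).comp (Gph.beckChevalley_map h) k fun X => rfl
  exact h₁.comp (VCat.beckChevalley_changeBase (V := NCat.{u} (n + 1)) (W := NCat.{u} n) (S.{u} n)
    (good_nCatAdj n).cellFamily (preservesCoproducts_S_cells n)) (UIso.{u} (n + 1)) fun X =>
      (Category.id_comp _).symm.trans
        (congrArg (· ≫ _) (CategoryTheory.Functor.map_id (Gph.map (U.{u} n) ⋙ Gph.toGlob n) _).symm)

theorem beckChevalley_UIso :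
    ∀ n : ℕ, BeckChevalley (nCatAdj.{u} (n + 1)) (nCatAdj.{u} n) (UIso.{u} n)
  | 0 => beckChevalley_UIso_zero
  | n + 1 => beckChevalley_UIso_succ n (beckChevalley_UIso n)

/-! ### Limits of towers of adjunctions -/

section Tower

variable {A : ℕ → Type*} [∀ n, Category* (A n)] {B : ℕ → Type*} [∀ n, Category* (B n)]
  {𝒜 : Type*} [Category* 𝒜] {ℬ : Type*} [Category* ℬ]

/-- A cone, commuting up to isomorphism, over a sequence of functors. -/
structure SeqCone (S : ∀ n, A (n + 1) ⥤ A n) (𝒜 : Type*) [Category* 𝒜] where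
  proj (n : ℕ) : 𝒜 ⥤ A n
  iso (n : ℕ) : proj (n + 1) ⋙ S n ≅ proj n

namespace SeqCone

variable {S : ∀ n, A (n + 1) ⥤ A n}

/-- The comparison functor to the pseudo-limit is fully faithful. -/
structure FullyFaithful (c : SeqCone S 𝒜) : Prop where
  ext {X Y : 𝒜} {f g : X ⟶ Y} : (∀ n, (c.proj n).map f = (c.proj n).map g) → f = g
  exists_map {X Y : 𝒜} (f : ∀ n, (c.proj n).obj X ⟶ (c.proj n).obj Y) :
    (∀ n, (S n).map (f (n + 1)) ≫ (c.iso n).hom.app Y = (c.iso n).hom.app X ≫ f n) →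
      ∃ g : X ⟶ Y, ∀ n, (c.proj n).map g = f n

/-- The comparison functor to the pseudo-limit is essentially surjective. -/
def EssSurj (c : SeqCone S 𝒜) : Prop :=
  ∀ (a : ∀ n, A n) (e : ∀ n, (S n).obj (a (n + 1)) ≅ a n),
    ∃ (X : 𝒜) (j : ∀ n, (c.proj n).obj X ≅ a n),
      ∀ n, (c.iso n).hom.app X ≫ (j n).hom = (S n).map (j (n + 1)).hom ≫ (e n).hom

theorem FullyFaithful.isIso {c : SeqCone S 𝒜} (hc : c.FullyFaithful) {X Y : 𝒜} (f : X ⟶ Y)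
    (h : ∀ n, IsIso ((c.proj n).map f)) : IsIso f := by
  obtain ⟨g, hg⟩ := hc.exists_map (X := Y) (Y := X) (fun n => inv ((c.proj n).map f)) fun n => by
    have : (S n).map ((c.proj (n + 1)).map f) ≫ (c.iso n).hom.app Y =
      (c.iso n).hom.app X ≫ (c.proj n).map f := (c.iso n).hom.naturality f
    rw [Functor.map_inv, IsIso.inv_comp_eq, ← Category.assoc, this]
    simp
  exact ⟨g, hc.ext fun n => by simp [hg], hc.ext fun n => by simp [hg]⟩

end SeqCone

variable {S : ∀ n, A (n + 1) ⥤ A n} {R : ∀ n, B (n + 1) ⥤ B n}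

/-- A functor between limits of sequences, with a sequence of adjunctions satisfying the
Beck-Chevalley condition that it restricts to. -/
structure LevelAdj (c : SeqCone S 𝒜) (d : SeqCone R ℬ) (Uω : 𝒜 ⥤ ℬ) where
  F (n : ℕ) : B n ⥤ A n
  U (n : ℕ) : A n ⥤ B n
  adj (n : ℕ) : F n ⊣ U n
  i (n : ℕ) : S n ⋙ U n ≅ U (n + 1) ⋙ R n
  bc (n : ℕ) : BeckChevalley (adj (n + 1)) (adj n) (i n)
  β (n : ℕ) : Uω ⋙ d.proj n ≅ c.proj n ⋙ U n
  hβ (n : ℕ) (X : 𝒜) : (R n).map ((β (n + 1)).hom.app X) ≫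
    (i n).inv.app ((c.proj (n + 1)).obj X) ≫ (U n).map ((c.iso n).hom.app X) =
      (d.iso n).hom.app (Uω.obj X) ≫ (β n).hom.app X

namespace LevelAdj

variable {c : SeqCone S 𝒜} {d : SeqCone R ℬ} {Uω : 𝒜 ⥤ ℬ} (L : LevelAdj c d Uω)

/-- The restriction of a map to the objects of a level. -/
def level {X : ℬ} {Y : 𝒜} (h : X ⟶ Uω.obj Y) (n : ℕ) :
    (d.proj n).obj X ⟶ (L.U n).obj ((c.proj n).obj Y) :=
  (d.proj n).map h ≫ (L.β n).hom.app Y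

theorem level_compat {X : ℬ} {Y : 𝒜} (h : X ⟶ Uω.obj Y) (n : ℕ) :
    (R n).map (L.level h (n + 1)) ≫ (L.i n).inv.app ((c.proj (n + 1)).obj Y) ≫
      (L.U n).map ((c.iso n).hom.app Y) = (d.iso n).hom.app X ≫ L.level h n := by
  have e : (R n).map ((d.proj (n + 1)).map h) ≫ (d.iso n).hom.app (Uω.obj Y) =
    (d.iso n).hom.app X ≫ (d.proj n).map h := (d.iso n).hom.naturality h
  rw [level, Functor.map_comp, Category.assoc, L.hβ, ← Category.assoc]
  exact (congrArg (· ≫ _) e).trans (Category.assoc _ _ _)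

theorem exists_of_level (hd : d.FullyFaithful) {X : ℬ} {Y : 𝒜}
    (h : ∀ n, (d.proj n).obj X ⟶ (L.U n).obj ((c.proj n).obj Y))
    (w : ∀ n, (R n).map (h (n + 1)) ≫ (L.i n).inv.app ((c.proj (n + 1)).obj Y) ≫
      (L.U n).map ((c.iso n).hom.app Y) = (d.iso n).hom.app X ≫ h n) :
    ∃ f : X ⟶ Uω.obj Y, ∀ n, L.level f n = h n := by
  obtain ⟨f, hf⟩ := hd.exists_map (X := X) (Y := Uω.obj Y)
    (fun n => h n ≫ (L.β n).inv.app Y) fun n => by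
      have e := L.hβ n Y
      have e' : (d.iso n).hom.app (Uω.obj Y) = (R n).map ((L.β (n + 1)).hom.app Y) ≫
        (L.i n).inv.app ((c.proj (n + 1)).obj Y) ≫ (L.U n).map ((c.iso n).hom.app Y) ≫
          (L.β n).inv.app Y := by
        have := congrArg (· ≫ (L.β n).inv.app Y) e
        simp only [Category.assoc] at this
        rw [this]
        exact ((congrArg _ ((L.β n).hom_inv_id_app Y)).trans (Category.comp_id _)).symm
      have t : (R n).map (h (n + 1) ≫ (L.β (n + 1)).inv.app Y) ≫ (R n).map ((L.β (n + 1)).hom.app Y) =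
          (R n).map (h (n + 1)) :=
        ((R n).map_comp _ _).symm.trans (congrArg (R n).map ((Category.assoc _ _ _).trans
          ((congrArg (h (n + 1) ≫ ·) ((L.β (n + 1)).inv_hom_id_app Y)).trans (Category.comp_id _))))
      rw [e', ← Category.assoc ((d.iso n).hom.app X), ← w]
      simp only [Category.assoc]
      exact (Category.assoc _ _ _).symm.trans (congrArg (· ≫ _) t)
  refine ⟨f, fun n => ?_⟩
  rw [level, hf, Category.assoc]
  exact (congrArg (h n ≫ ·) ((L.β n).inv_hom_id_app Y)).trans (Category.comp_id _)

theorem hom_ext (hd : d.FullyFaithful) {X : ℬ} {Y : 𝒜} {f g : X ⟶ Uω.obj Y}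
    (h : ∀ n, L.level f n = L.level g n) : f = g := by
  refine hd.ext fun n => ?_
  exact (cancel_mono ((L.β n).hom.app Y)).1 (h n)

theorem level_comp {X : ℬ} {Y Y' : 𝒜} (f : X ⟶ Uω.obj Y) (g : Y ⟶ Y') (n : ℕ) :
    L.level (f ≫ Uω.map g) n = L.level f n ≫ (L.U n).map ((c.proj n).map g) := by
  have e : (d.proj n).map (Uω.map g) ≫ (L.β n).hom.app Y' =
    (L.β n).hom.app Y ≫ (L.U n).map ((c.proj n).map g) := (L.β n).hom.naturality g
  rw [level, Functor.map_comp, Category.assoc, e, level, Category.assoc]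

/-- The transpose of the restriction of a map to the objects of a level. -/
def transpose {X : ℬ} {Y : 𝒜} (h : X ⟶ Uω.obj Y) (n : ℕ) :
    (L.F n).obj ((d.proj n).obj X) ⟶ (c.proj n).obj Y :=
  ((L.adj n).homEquiv _ _).symm (L.level h n)

theorem unit_transpose {X : ℬ} {Y : 𝒜} (h : X ⟶ Uω.obj Y) (n : ℕ) :
    (L.adj n).unit.app ((d.proj n).obj X) ≫ (L.U n).map (L.transpose h n) = L.level h n :=
  ((L.adj n).homEquiv_unit _ _ _).symm.trans (Equiv.apply_symm_apply _ _)

theorem unit_mate_comp (n : ℕ) {X : B (n + 1)} {a : A (n + 1)} (k : (L.F (n + 1)).obj X ⟶ a) :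
    (L.adj n).unit.app ((R n).obj X) ≫ (L.U n).map (mate (L.adj (n + 1)) (L.adj n) (L.i n) X ≫
      (S n).map k) = (R n).map ((L.adj (n + 1)).unit.app X ≫ (L.U (n + 1)).map k) ≫
        (L.i n).inv.app a := by
  have e : (R n).map ((L.U (n + 1)).map k) ≫ (L.i n).inv.app a =
    (L.i n).inv.app _ ≫ (L.U n).map ((S n).map k) := (L.i n).inv.naturality k
  rw [Functor.map_comp, ← Category.assoc, unit_mate, Category.assoc, ← e, Functor.map_comp,
    Category.assoc]

/-- This is `level_compat` carried across the adjunctions: the transposes at consecutive levels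
agree up to the mate. -/
theorem transpose_compat {X : ℬ} {Y : 𝒜} (h : X ⟶ Uω.obj Y) (n : ℕ) :
    mate (L.adj (n + 1)) (L.adj n) (L.i n) ((d.proj (n + 1)).obj X) ≫
      (S n).map (L.transpose h (n + 1)) ≫ (c.iso n).hom.app Y =
        (L.F n).map ((d.iso n).hom.app X) ≫ L.transpose h n := by
  refine free_hom_ext (L.adj n) ?_
  have e : (d.iso n).hom.app X ≫ (L.adj n).unit.app ((d.proj n).obj X) =
    (L.adj n).unit.app _ ≫ (L.U n).map ((L.F n).map ((d.iso n).hom.app X)) :=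
      (L.adj n).unit.naturality ((d.iso n).hom.app X)
  have e' := L.unit_mate_comp n (L.transpose h (n + 1))
  rw [unit_transpose] at e'
  rw [← Category.assoc (mate _ _ _ _), Functor.map_comp]
  refine Eq.trans ?_ (congrArg ((L.adj n).unit.app _ ≫ ·) ((L.U n).map_comp _ _).symm)
  refine (Category.assoc _ _ _).symm.trans ((congrArg (· ≫ _) e').trans ?_)
  refine (Category.assoc _ _ _).trans ((L.level_compat h n).trans ?_)
  refine Eq.trans ?_ (Category.assoc _ _ _)
  refine Eq.trans ?_ (congrArg (· ≫ _) e)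
  rw [Category.assoc, unit_transpose]

/-- A free object with its universal map. -/
structure FreeObj (X : ℬ) where
  Z : 𝒜
  η : X ⟶ Uω.obj Z
  isIso (n : ℕ) : IsIso (L.transpose η n)

/-- The free objects on the restrictions of `X` form a compatible sequence, through the inverses of
the mates, because every `S n` preserves free objects. The sequence comes from an object of the
limit, and the units of the levels glue to the universal map. -/
theorem exists_freeObj (hd : d.FullyFaithful) (hc : c.EssSurj) (X : ℬ) : Nonempty (L.FreeObj X) := by
  have hm := fun n => (L.bc n).isIso_mate ((d.proj (n + 1)).obj X)
  obtain ⟨Z, j, hj⟩ := hc (fun n => (L.F n).obj ((d.proj n).obj X)) fun n =>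
    (asIso (mate (L.adj (n + 1)) (L.adj n) (L.i n) ((d.proj (n + 1)).obj X))).symm ≪≫
      (L.F n).mapIso ((d.iso n).app X)
  obtain ⟨η, hη⟩ := L.exists_of_level hd (X := X) (Y := Z)
    (fun n => (L.adj n).unit.app ((d.proj n).obj X) ≫ (L.U n).map (j n).inv) fun n => by
      have e : (d.iso n).hom.app X ≫ (L.adj n).unit.app ((d.proj n).obj X) =
        (L.adj n).unit.app _ ≫ (L.U n).map ((L.F n).map ((d.iso n).hom.app X)) :=
          (L.adj n).unit.naturality ((d.iso n).hom.app X)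
      have e' := L.unit_mate_comp n (j (n + 1)).inv
      have e'' : (mate (L.adj (n + 1)) (L.adj n) (L.i n) ((d.proj (n + 1)).obj X) ≫
          (S n).map (j (n + 1)).inv) ≫ (c.iso n).hom.app Z =
          (L.F n).map ((d.iso n).hom.app X) ≫ (j n).inv := by
        have h : (c.iso n).hom.app Z ≫ (j n).hom = (S n).map (j (n + 1)).hom ≫
          inv (mate (L.adj (n + 1)) (L.adj n) (L.i n) ((d.proj (n + 1)).obj X)) ≫
            (L.F n).map ((d.iso n).hom.app X) := hj n
        rw [Iso.eq_comp_inv, Category.assoc, Category.assoc, h, ← Functor.map_comp_assoc]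
        simp
      refine (Category.assoc _ _ _).symm.trans ((congrArg (· ≫ _) e'.symm).trans ?_)
      refine (Category.assoc _ _ _).trans ?_
      rw [← Functor.map_comp, e'', Functor.map_comp]
      exact (Category.assoc _ _ _).symm.trans ((congrArg (· ≫ _) e.symm).trans (Category.assoc _ _ _))
  refine ⟨⟨Z, η, fun n => ?_⟩⟩
  have : L.transpose η n = (j n).inv := by
    refine free_hom_ext (L.adj n) ?_
    rw [unit_transpose, hη]
  rw [this]
  infer_instance

variable {L} in
-- At each level the extension must be the transpose of `f`, read through the identification of
-- `P.Z` with a free object; `transpose_compat` for `f` and for `P.η` makes these maps compatible.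
theorem FreeObj.existsUnique (hc : c.FullyFaithful) (hd : d.FullyFaithful) {X : ℬ} (P : L.FreeObj X)
    {Y : 𝒜} (f : X ⟶ Uω.obj Y) : ∃! g : P.Z ⟶ Y, P.η ≫ Uω.map g = f := by
  have hi := P.isIso
  have key : ∀ n, (c.iso n).hom.app P.Z ≫ inv (L.transpose P.η n) =
      (S n).map (inv (L.transpose P.η (n + 1))) ≫
      (@inv _ _ _ _ (mate (L.adj (n + 1)) (L.adj n) (L.i n) ((d.proj (n + 1)).obj X))
        ((L.bc n).isIso_mate _)) ≫ (L.F n).map ((d.iso n).hom.app X) := by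
    intro n
    have := (L.bc n).isIso_mate ((d.proj (n + 1)).obj X)
    rw [IsIso.comp_inv_eq, Category.assoc, Category.assoc, ← transpose_compat, IsIso.inv_hom_id_assoc,
      ← Functor.map_comp_assoc, IsIso.inv_hom_id, CategoryTheory.Functor.map_id]
    exact (Category.id_comp _).symm
  obtain ⟨g, hg⟩ := hc.exists_map (X := P.Z) (Y := Y)
    (fun n => inv (L.transpose P.η n) ≫ L.transpose f n) fun n => by
      have := (L.bc n).isIso_mate ((d.proj (n + 1)).obj X)
      have h := L.transpose_compat f n
      rw [← Category.assoc ((c.iso n).hom.app P.Z), key, Category.assoc, Category.assoc, ← h,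
        IsIso.inv_hom_id_assoc, Functor.map_comp, Category.assoc]
  refine ⟨g, L.hom_ext hd fun n => ?_, fun g' hg' => hc.ext fun n => ?_⟩
  · rw [level_comp, hg, ← unit_transpose, Category.assoc, ← Functor.map_comp,
      IsIso.hom_inv_id_assoc, unit_transpose]
  · have h : L.transpose P.η n ≫ (c.proj n).map g' = L.transpose f n := by
      refine free_hom_ext (L.adj n) ?_
      rw [Functor.map_comp, ← Category.assoc, unit_transpose, unit_transpose, ← level_comp, hg']
    rw [hg, ← h, IsIso.inv_hom_id_assoc]

end LevelAdj

end Tower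

/-! ### The adjunction between the limits and its monadicity -/

section Tower

variable {A : ℕ → Type*} [∀ n, Category* (A n)] {B : ℕ → Type*} [∀ n, Category* (B n)]
  {𝒜 : Type*} [Category* 𝒜] {ℬ : Type*} [Category* ℬ]
  {S : ∀ n, A (n + 1) ⥤ A n} {R : ∀ n, B (n + 1) ⥤ B n}

namespace LevelAdj

variable {c : SeqCone S 𝒜} {d : SeqCone R ℬ} {Uω : 𝒜 ⥤ ℬ} (L : LevelAdj c d Uω)

/-- Besides the left adjoint, the statement records that each projection carries free objects to
free objects of its level. Monadicity and, for strict `ω`-categories, the properties of the monad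
are deduced from this alone. -/
theorem exists_adjunction (hc : c.FullyFaithful) (hc' : c.EssSurj) (hd : d.FullyFaithful) :
    ∃ (F : ℬ ⥤ 𝒜) (adj : F ⊣ Uω), ∀ n, BeckChevalley adj (L.adj n) (L.β n).symm := by
  let P (X : ℬ) : L.FreeObj X := (L.exists_freeObj hd hc' X).some
  let e (X : ℬ) (Y : 𝒜) : ((P X).Z ⟶ Y) ≃ (X ⟶ Uω.obj Y) :=
    Equiv.ofBijective (fun g => (P X).η ≫ Uω.map g)
      ((Function.bijective_iff_existsUnique _).2 fun f => (P X).existsUnique hc hd f)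
  have he : ∀ X Y Y' (g : Y ⟶ Y') (h : (P X).Z ⟶ Y), e X Y' (h ≫ g) = e X Y h ≫ Uω.map g := by
    intro X Y Y' g h
    simp [e]
  let adj := Adjunction.adjunctionOfEquivLeft e he
  refine ⟨_, adj, fun n X => ?_⟩
  have hu : adj.unit.app X = (P X).η := by
    have h : adj.unit.app X = (P X).η ≫ Uω.map (𝟙 (P X).Z) := by
      simp [adj, Adjunction.adjunctionOfEquivLeft, e]
    exact h.trans ((congrArg ((P X).η ≫ ·) (Uω.map_id _)).trans (Category.comp_id _))
  have := (P X).isIso n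
  refine ⟨asIso (L.transpose (P X).η n), ?_⟩
  rw [hu]
  refine (Category.assoc _ _ _).symm.trans
    ((congrArg (· ≫ _) (L.unit_transpose (P X).η n)).trans ?_)
  exact (Category.assoc _ _ _).trans
    ((congrArg ((d.proj n).map (P X).η ≫ ·) ((L.β n).hom_inv_id_app _)).trans (Category.comp_id _))

variable {L} {F : ℬ ⥤ 𝒜} {adj : F ⊣ Uω}

/-- The maps `f n` are compatible because their underlying maps are the restrictions of `ψ` and
every `U n` is faithful. -/
theorem exists_map_eq (hc : c.FullyFaithful) (hd : d.FullyFaithful) (hU : ∀ n, (L.U n).Faithful)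
    {X Y : 𝒜} (ψ : Uω.obj X ⟶ Uω.obj Y) (f : ∀ n, (c.proj n).obj X ⟶ (c.proj n).obj Y)
    (hf : ∀ n, (L.β n).hom.app X ≫ (L.U n).map (f n) = L.level ψ n) : ∃ g : X ⟶ Y, Uω.map g = ψ := by
  obtain ⟨g, hg⟩ := hc.exists_map f fun n => by
    refine (L.U n).map_injective ((cancel_epi ((L.i n).inv.app _)).1
      ((cancel_epi ((R n).map ((L.β (n + 1)).hom.app X))).1 ?_))
    have e : (R n).map ((L.U (n + 1)).map (f (n + 1))) ≫ (L.i n).inv.app _ =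
      (L.i n).inv.app _ ≫ (L.U n).map ((S n).map (f (n + 1))) := (L.i n).inv.naturality (f (n + 1))
    have h := L.level_compat ψ n
    rw [← hf, ← hf, CategoryTheory.Functor.map_comp (R n)] at h
    have h' := congrArg (· ≫ (L.U n).map (f n)) (L.hβ n X)
    simp only [Category.assoc] at h h'
    rw [CategoryTheory.Functor.map_comp (L.U n), CategoryTheory.Functor.map_comp (L.U n)]
    refine Eq.trans ?_ (h.trans h'.symm)
    exact congrArg (_ ≫ ·) ((Category.assoc _ _ _).symm.trans
      ((congrArg (· ≫ _) e.symm).trans (Category.assoc _ _ _)))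
  refine ⟨g, hd.ext fun n => (cancel_mono ((L.β n).hom.app Y)).1 ?_⟩
  refine Eq.trans ?_ (hf n)
  rw [← hg]
  exact (L.β n).hom.naturality g

variable (L) in
-- The computation behind `restrict_algebra`, for an arbitrary `m` in place of a structure map; no
-- algebra law enters.
theorem transpose_unit_compat (adj : F ⊣ Uω) (n : ℕ) {X Y : ℬ} (m : Uω.obj (F.obj X) ⟶ Y) :
    (L.U n).map ((L.F n).map ((d.iso n).hom.app X)) ≫
      ((L.U n).map (L.transpose (adj.unit.app X) n) ≫ (L.β n).inv.app (F.obj X)) ≫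
        (d.proj n).map m =
    (((L.U n).map (mate (L.adj (n + 1)) (L.adj n) (L.i n) ((d.proj (n + 1)).obj X)) ≫
      (L.i n).hom.app ((L.F (n + 1)).obj ((d.proj (n + 1)).obj X))) ≫
      (R n).map (((L.U (n + 1)).map (L.transpose (adj.unit.app X) (n + 1)) ≫
        (L.β (n + 1)).inv.app (F.obj X)) ≫ (d.proj (n + 1)).map m)) ≫ (d.iso n).hom.app Y := by
  have e₁ := L.transpose_compat (adj.unit.app X) n
  have e₂ : (R n).map ((d.proj (n + 1)).map m) ≫ (d.iso n).hom.app Y =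
    (d.iso n).hom.app (Uω.obj (F.obj X)) ≫ (d.proj n).map m := (d.iso n).hom.naturality m
  have e₃ := L.hβ n (F.obj X)
  have e₄ : (L.i n).hom.app _ ≫ (R n).map ((L.U (n + 1)).map
      (L.transpose (adj.unit.app X) (n + 1))) = (L.U n).map ((S n).map
        (L.transpose (adj.unit.app X) (n + 1))) ≫ (L.i n).hom.app _ :=
    ((L.i n).hom.naturality _).symm
  have e₅ : (L.i n).hom.app ((c.proj (n + 1)).obj (F.obj X)) ≫
      (R n).map ((L.β (n + 1)).inv.app (F.obj X)) ≫ (d.iso n).hom.app (Uω.obj (F.obj X)) =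
      (L.U n).map ((c.iso n).hom.app (F.obj X)) ≫ (L.β n).inv.app (F.obj X) := by
    refine (cancel_mono ((L.β n).hom.app (F.obj X))).1 ?_
    have t₁ : (L.β n).inv.app (F.obj X) ≫ (L.β n).hom.app (F.obj X) = 𝟙 _ :=
      (L.β n).inv_hom_id_app _
    have t₂ : (R n).map ((L.β (n + 1)).inv.app (F.obj X)) ≫
        (R n).map ((L.β (n + 1)).hom.app (F.obj X)) = 𝟙 _ := by
      refine ((R n).map_comp _ _).symm.trans ?_
      exact (congrArg (R n).map ((L.β (n + 1)).inv_hom_id_app _)).trans ((R n).map_id _)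
    have t₃ : (L.i n).hom.app ((c.proj (n + 1)).obj (F.obj X)) ≫ (L.i n).inv.app _ = 𝟙 _ :=
      (L.i n).hom_inv_id_app _
    simp only [Category.assoc]
    rw [← e₃]
    refine (congrArg (_ ≫ ·) (Category.assoc _ _ _).symm).trans ?_
    refine (congrArg (fun t => _ ≫ t ≫ _) t₂).trans ?_
    refine (congrArg (_ ≫ ·) (Category.id_comp _)).trans ?_
    refine (Category.assoc _ _ _).symm.trans ((congrArg (· ≫ _) t₃).trans ?_)
    refine (Category.id_comp _).trans ?_
    exact ((congrArg (_ ≫ ·) t₁).trans (Category.comp_id _)).symm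
  have e₆ := congrArg (fun t => (L.U n).map t ≫ (L.β n).inv.app (F.obj X) ≫ (d.proj n).map m) e₁
  rw [CategoryTheory.Functor.map_comp (L.U n), CategoryTheory.Functor.map_comp (L.U n)] at e₆
  refine Eq.trans ?_ (e₆.symm.trans ?_)
  · refine Eq.trans ?_ (congrArg (· ≫ _) ((L.U n).map_comp _ _).symm)
    exact (congrArg (_ ≫ ·) (Category.assoc _ _ _)).trans (Category.assoc _ _ _).symm
  · simp only [Category.assoc, CategoryTheory.Functor.map_comp (R n)]
    refine congrArg (_ ≫ ·) ?_
    refine Eq.trans ?_ (congrArg (fun t => _ ≫ _ ≫ _ ≫ t) e₂.symm)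
    refine Eq.trans ?_ (Category.assoc _ _ _)
    refine Eq.trans ?_ (congrArg (· ≫ _) e₄.symm)
    refine Eq.trans ?_ (Category.assoc _ _ _).symm
    refine congrArg (_ ≫ ·) ?_
    refine (Category.assoc _ _ _).symm.trans ((congrArg (· ≫ _) e₅.symm).trans ?_)
    simp only [Category.assoc]

/-- The algebra structure on the restriction of an algebra to a level is the restriction of that of
the next level. -/
theorem restrict_algebra (hb : ∀ n, BeckChevalley adj (L.adj n) (L.β n).symm) (n : ℕ)
    (M : adj.toMonad.Algebra) :
    (L.adj n).toMonad.map ((d.iso n).hom.app M.A) ≫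
        ((hb n).weakMonadMap.algebraFunctor.obj M).a =
      ((L.bc n).weakMonadMap.algebraFunctor.obj
        ((hb (n + 1)).weakMonadMap.algebraFunctor.obj M)).a ≫ (d.iso n).hom.app M.A :=
  L.transpose_unit_compat adj n M.a

/-- An algebra for the monad on the limit restricts to an algebra at each level, compatibly with the
functors induced by the weak maps of monads. Monadicity at the levels turns these algebras into
objects and their morphisms into morphisms, which glue in the limit. -/
theorem isEquivalence_comparison (hc : c.FullyFaithful) (hc' : c.EssSurj) (hd : d.FullyFaithful)
    (hm : ∀ n, (Monad.comparison (L.adj n)).IsEquivalence)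
    (hb : ∀ n, BeckChevalley adj (L.adj n) (L.β n).symm) :
    (Monad.comparison adj).IsEquivalence := by
  have hU : ∀ n, (L.U n).Faithful := fun n => by
    have := hm n
    exact Functor.Faithful.of_iso (Monad.comparisonForget (L.adj n))
  have hfaith : (Monad.comparison adj).Faithful := by
    refine ⟨fun {X Y} f g h => hc.ext fun n => (L.U n).map_injective ?_⟩
    have h' : Uω.map f = Uω.map g := congrArg Monad.Algebra.Hom.f h
    refine (cancel_epi ((L.β n).hom.app X)).1 ?_
    refine ((L.β n).hom.naturality f).symm.trans (Eq.trans ?_ ((L.β n).hom.naturality g))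
    exact congrArg (fun t => (d.proj n).map t ≫ _) h'
  have hfull : (Monad.comparison adj).Full := by
    refine ⟨fun {X Y} ψ => ?_⟩
    let α (n : ℕ) := (hb n).comparisonIso
    let φ (n : ℕ) : (Monad.comparison (L.adj n)).obj ((c.proj n).obj X) ⟶
        (Monad.comparison (L.adj n)).obj ((c.proj n).obj Y) :=
      (α n).hom.app X ≫ (hb n).weakMonadMap.algebraFunctor.map ψ ≫ (α n).inv.app Y
    have hφ : ∀ n, (φ n).f = (L.β n).inv.app X ≫ (d.proj n).map ψ.f ≫ (L.β n).hom.app Y :=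
      fun n => rfl
    obtain ⟨g, hg⟩ := exists_map_eq (L := L) hc hd hU ψ.f
      (fun n => (Monad.comparison (L.adj n)).preimage (φ n)) fun n => by
        have h := congrArg Monad.Algebra.Hom.f ((Monad.comparison (L.adj n)).map_preimage (φ n))
        refine (congrArg ((L.β n).hom.app X ≫ ·) (h.trans (hφ n))).trans ?_
        exact (Category.assoc _ _ _).symm.trans ((congrArg (· ≫ _)
          ((L.β n).hom_inv_id_app X)).trans (Category.id_comp _))
    exact ⟨g, Monad.Algebra.Hom.ext hg⟩
  have hess : (Monad.comparison adj).EssSurj := by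
    refine ⟨fun M => ?_⟩
    -- The restrictions `N n` of `M` are realized by objects `a n`. The isomorphisms `ρ n` between
    -- consecutive restrictions lift along the fully faithful comparison functors to `e n`, so the
    -- `a n` form a compatible sequence, realized by `Z`.
    let N (n : ℕ) : (L.adj n).toMonad.Algebra := (hb n).weakMonadMap.algebraFunctor.obj M
    let k (n : ℕ) := (Monad.comparison (L.adj n)).objObjPreimageIso (N n)
    let a (n : ℕ) : A n := (Monad.comparison (L.adj n)).objPreimage (N n)
    let ρ (n : ℕ) : (L.bc n).weakMonadMap.algebraFunctor.obj (N (n + 1)) ≅ N n :=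
      Monad.Algebra.isoMk ((d.iso n).app M.A) (restrict_algebra hb n M)
    let ζ (n : ℕ) := (L.bc n).comparisonIso.app (a (n + 1)) ≪≫
      (L.bc n).weakMonadMap.algebraFunctor.mapIso (k (n + 1)) ≪≫ ρ n ≪≫ (k n).symm
    let e (n : ℕ) : (S n).obj (a (n + 1)) ≅ a n := (Monad.comparison (L.adj n)).preimageIso (ζ n)
    have he : ∀ n, (L.U n).map (e n).hom = (L.i n).hom.app (a (n + 1)) ≫
        (R n).map (k (n + 1)).hom.f ≫ (d.iso n).hom.app M.A ≫ (k n).inv.f := fun n =>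
      congrArg Monad.Algebra.Hom.f ((Monad.comparison (L.adj n)).map_preimage (ζ n).hom)
    obtain ⟨Z, j, hj⟩ := hc' a e
    have hk : ∀ n, (k n).inv.f ≫ (k n).hom.f = 𝟙 _ := fun n =>
      congrArg Monad.Algebra.Hom.f (k n).inv_hom_id
    obtain ⟨θ, hθ⟩ := L.exists_of_level hd (X := M.A) (Y := Z)
      (fun n => (k n).inv.f ≫ (L.U n).map (j n).inv) fun n => by
        have t₁ : (R n).map ((L.U (n + 1)).map (j (n + 1)).inv) ≫ (L.i n).inv.app _ =
          (L.i n).inv.app _ ≫ (L.U n).map ((S n).map (j (n + 1)).inv) :=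
            (L.i n).inv.naturality (j (n + 1)).inv
        have t₂ : (S n).map (j (n + 1)).inv ≫ (c.iso n).hom.app Z = (e n).hom ≫ (j n).inv := by
          rw [Iso.eq_comp_inv, Category.assoc, hj, ← Functor.map_comp_assoc]
          simp
        have t₃ : (L.i n).inv.app (a (n + 1)) ≫ (L.i n).hom.app (a (n + 1)) = 𝟙 _ :=
          (L.i n).inv_hom_id_app _
        have t₄ : (R n).map (k (n + 1)).inv.f ≫ (R n).map (k (n + 1)).hom.f = 𝟙 _ :=
          ((R n).map_comp _ _).symm.trans ((congrArg (R n).map (hk (n + 1))).trans ((R n).map_id _))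
        have t₅ : (L.i n).inv.app (a (n + 1)) ≫ (L.U n).map (e n).hom =
            (R n).map (k (n + 1)).hom.f ≫ (d.iso n).hom.app M.A ≫ (k n).inv.f := by
          rw [he]
          exact (Category.assoc _ _ _).symm.trans
            ((congrArg (· ≫ _) t₃).trans (Category.id_comp _))
        calc _ = (R n).map (k (n + 1)).inv.f ≫ (R n).map ((L.U (n + 1)).map (j (n + 1)).inv) ≫
              (L.i n).inv.app _ ≫ (L.U n).map ((c.iso n).hom.app Z) :=
              (congrArg (· ≫ _) ((R n).map_comp _ _)).trans (Category.assoc _ _ _)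
          _ = (R n).map (k (n + 1)).inv.f ≫ (L.i n).inv.app (a (n + 1)) ≫
              (L.U n).map ((S n).map (j (n + 1)).inv ≫ (c.iso n).hom.app Z) := by
              refine congrArg (_ ≫ ·) ((Category.assoc _ _ _).symm.trans
                ((congrArg (· ≫ _) t₁).trans ((Category.assoc _ _ _).trans (congrArg (_ ≫ ·) ?_))))
              exact ((L.U n).map_comp _ _).symm
          _ = (R n).map (k (n + 1)).inv.f ≫ (R n).map (k (n + 1)).hom.f ≫
              (d.iso n).hom.app M.A ≫ (k n).inv.f ≫ (L.U n).map (j n).inv := by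
              rw [t₂, CategoryTheory.Functor.map_comp (L.U n)]
              refine congrArg (_ ≫ ·) ((Category.assoc _ _ _).symm.trans
                ((congrArg (· ≫ _) t₅).trans ?_))
              exact (Category.assoc _ _ _).trans (congrArg (_ ≫ ·) (Category.assoc _ _ _))
          _ = _ := (Category.assoc _ _ _).symm.trans ((congrArg (· ≫ _) t₄).trans
              (Category.id_comp _))
    -- These isomorphisms of algebras have the restrictions of `θ` as underlying maps. Hence `θ` is
    -- invertible, and it respects the structure maps because it does so at every level.
    let χ (n : ℕ) : N n ⟶ (hb n).weakMonadMap.algebraFunctor.obj ((Monad.comparison adj).obj Z) :=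
      (k n).inv ≫ (Monad.comparison (L.adj n)).map (j n).inv ≫ (hb n).comparisonIso.hom.app Z
    have hχ : ∀ n, (χ n).f = (d.proj n).map θ := by
      intro n
      have h : (d.proj n).map θ ≫ (L.β n).hom.app Z = (k n).inv.f ≫ (L.U n).map (j n).inv := hθ n
      refine (Category.assoc _ _ _).symm.trans ((congrArg (· ≫ (L.β n).inv.app Z) h.symm).trans ?_)
      exact (Category.assoc _ _ _).trans ((congrArg (_ ≫ ·) ((L.β n).hom_inv_id_app Z)).trans
        (Category.comp_id _))
    have hi : IsIso θ := hd.isIso θ fun n => by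
      rw [← hχ]
      have : IsIso (χ n) := inferInstance
      exact inferInstanceAs (IsIso ((Monad.forget _).map (χ n)))
    refine ⟨Z, ⟨(Monad.Algebra.isoMk (@asIso _ _ _ _ θ hi) ?_).symm⟩⟩
    refine hd.ext fun n => ?_
    have h := (χ n).h
    rw [hχ] at h
    have t : (L.adj n).toMonad.map ((d.proj n).map θ) ≫ (hb n).weakMonadMap.iso.hom.app _ =
      (hb n).weakMonadMap.iso.hom.app _ ≫ (d.proj n).map (adj.toMonad.map θ) :=
        (hb n).weakMonadMap.iso.hom.naturality θ
    refine (cancel_epi ((hb n).weakMonadMap.iso.hom.app M.A)).1 ?_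
    rw [CategoryTheory.Functor.map_comp, CategoryTheory.Functor.map_comp]
    refine Eq.trans ?_ (h.trans (Category.assoc _ _ _))
    exact (Category.assoc _ _ _).symm.trans ((congrArg (· ≫ _) t.symm).trans (Category.assoc _ _ _))
  exact { }

end LevelAdj

end Tower

/-! ### Transport of enriched categories along isomorphisms -/

theorem Gph.eq_id {V : Type (u + 1)} [Category.{u} V] {X : Gph.{u} V} (f : X ⟶ X)
    (ho : ∀ x, f.obj x = x) (hm : ∀ x y, f.map x y = eqToHom (by rw [ho, ho])) : f = 𝟙 X := by
  obtain ⟨o, m⟩ := f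
  obtain rfl : o = fun x => x := funext ho
  exact hom_ext' (o := fun x => x) rfl rfl hm

/-- The map factors as one that is the identity on vertices, followed by a relabelling of vertices
that is the identity on hom-objects. -/
theorem Gph.isIso_of_bijective {V : Type (u + 1)} [Category.{u} V] {X Y : Gph.{u} V} (f : X ⟶ Y)
    (ho : Function.Bijective f.obj) (hm : ∀ x y, IsIso (f.map x y)) : IsIso f := by
  obtain ⟨α, H⟩ := X
  obtain ⟨β, K⟩ := Y
  obtain ⟨o, m⟩ := f
  obtain ⟨e, rfl⟩ : ∃ e : α ≃ β, o = e := ⟨Equiv.ofBijective o ho, rfl⟩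
  have hm' : ∀ x y, IsIso (m x y) := hm
  have h₁ : @IsIso (Gph.{u} V) _ ⟨α, H⟩ ⟨α, fun x y => K (e x) (e y)⟩
      (Hom.mk (X := ⟨α, H⟩) (Y := ⟨α, fun x y => K (e x) (e y)⟩) (fun x => x) m) := isIso_mk m
  let q : (⟨α, fun x y => K (e x) (e y)⟩ : Gph.{u} V) ⟶ ⟨β, K⟩ :=
    Hom.mk (X := ⟨α, fun x y => K (e x) (e y)⟩) (Y := ⟨β, K⟩) e (fun x y => 𝟙 (K (e x) (e y)))
  let r : (⟨β, K⟩ : Gph.{u} V) ⟶ ⟨α, fun x y => K (e x) (e y)⟩ :=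
    Hom.mk (X := ⟨β, K⟩) (Y := ⟨α, fun x y => K (e x) (e y)⟩) e.symm
      (fun x y => eqToHom (congrArg₂ K (e.apply_symm_apply x) (e.apply_symm_apply y)).symm)
  have h₂ : IsIso q := ⟨r, eq_id _ (fun x => e.symm_apply_apply x) fun x y => Category.id_comp _,
    eq_id _ (fun x => e.apply_symm_apply x) fun x y => Category.comp_id _⟩
  have h₃ : Hom.mk (X := ⟨α, H⟩) (Y := ⟨β, K⟩) e m =
      Hom.mk (X := ⟨α, H⟩) (Y := ⟨α, fun x y => K (e x) (e y)⟩) (fun x => x) m ≫ q :=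
    hom_ext' (X := ⟨α, H⟩) (Y := ⟨β, K⟩) (o := e) (m' := fun x y => m x y ≫ 𝟙 _) rfl rfl
      fun x y => (Category.comp_id _).symm
  rw [h₃]
  exact @IsIso.comp_isIso _ _ _ _ _ _ _ h₁ h₂

namespace VCat

variable {V : Type (u + 1)} [Category.{u} V] [CartesianMonoidalCategory V]

/-- The hom-objects match only through an `eqToHom`, which is hidden in `k` because only its
invertibility is used. -/
theorem map_map_of_comp_eq_id {C D : VCat.{u} V} {f : C ⟶ D} {g : D ⟶ C} (h : f ≫ g = 𝟙 C)
    (x y : C.carrier) : ∃ k : (g.obj (f.obj x) ⟶[V] g.obj (f.obj y)) ⟶ (x ⟶[V] y), IsIso k ∧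
      f.map x y ≫ g.map (f.obj x) (f.obj y) ≫ k = 𝟙 _ :=
  ⟨eqToHom _, inferInstance, (Category.assoc _ _ _).symm.trans (map_of_eq h x y)⟩

theorem isIso_map {C D : VCat.{u} V} (i : C ≅ D) (x y : C.carrier) : IsIso (i.hom.map x y) := by
  obtain ⟨k, hk, e⟩ := map_map_of_comp_eq_id i.hom_inv_id x y
  obtain ⟨k', _, e'⟩ := map_map_of_comp_eq_id i.inv_hom_id (i.hom.obj x) (i.hom.obj y)
  have : IsSplitMono (i.inv.map (i.hom.obj x) (i.hom.obj y)) := ⟨⟨⟨_, e'⟩⟩⟩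
  have : IsSplitEpi (i.inv.map (i.hom.obj x) (i.hom.obj y) ≫ k) := ⟨⟨⟨_, e⟩⟩⟩
  have : IsIso (i.inv.map (i.hom.obj x) (i.hom.obj y) ≫ k) := isIso_of_mono_of_isSplitEpi _
  rw [IsIso.eq_inv_of_inv_hom_id e]
  infer_instance

/-- Monadicity over graphs makes the forgetful functor reflect isomorphisms, so no inverse enriched
functor has to be constructed. -/
theorem isIso_of_bijective {C D : VCat.{u} V} [IsDistrib V] (f : C ⟶ D)
    (ho : Function.Bijective f.obj) (hm : ∀ x y, IsIso (f.map x y)) : IsIso f := by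
  have : (toGph V).ReflectsIsomorphisms :=
    reflectsIsomorphisms_of_iso (Monad.comparisonForget (Gph.freeAdj V))
  have : IsIso ((toGph V).map f) := Gph.isIso_of_bijective ((toGph V).map f) ho hm
  exact isIso_of_reflects_iso f (toGph V)

theorem bijective_obj {C D : VCat.{u} V} (i : C ≅ D) : Function.Bijective i.hom.obj :=
  Function.bijective_iff_has_inverse.2 ⟨i.inv.obj,
    fun x => congrArg (fun t => EnrichedFunctor.obj t x) i.hom_inv_id,
    fun x => congrArg (fun t => EnrichedFunctor.obj t x) i.inv_hom_id⟩

/-- Transport of an enriched category along a map of objects and isomorphisms of hom-objects. -/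
def transport (D : VCat.{u} V) {α : Type u} (o : α → D.carrier) (H : α → α → V)
    (j : ∀ x y, H x y ≅ (o x ⟶[V] o y)) : VCat.{u} V where
  carrier := α
  str :=
    { Hom := H
      id := fun x => eId V (o x) ≫ (j x x).inv
      comp := fun x y z => ((j x y).hom ⊗ₘ (j y z).hom) ≫ eComp V _ _ _ ≫ (j x z).inv
      id_comp := fun x y => by
        have h := e_id_comp V (o x) (o y)
        rw [Iso.inv_comp_eq, Category.comp_id] at h
        rw [Iso.inv_comp_eq, Category.comp_id, ← tensorHom_id, tensorHom_comp_tensorHom_assoc,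
          Category.assoc, Iso.inv_hom_id, Category.comp_id, Category.id_comp, tensorHom_def'_assoc,
          reassoc_of% h, leftUnitor_naturality_assoc, Iso.hom_inv_id, Category.comp_id]
      comp_id := fun x y => by
        have h := e_comp_id V (o x) (o y)
        rw [Iso.inv_comp_eq, Category.comp_id] at h
        rw [Iso.inv_comp_eq, Category.comp_id, ← id_tensorHom, tensorHom_comp_tensorHom_assoc,
          Category.assoc, Iso.inv_hom_id, Category.comp_id, Category.id_comp, tensorHom_def_assoc,
          reassoc_of% h, rightUnitor_naturality_assoc, Iso.hom_inv_id, Category.comp_id]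
      assoc := fun x y z w => by
        have h := e_assoc V (o x) (o y) (o z) (o w)
        rw [← tensorHom_id, ← id_tensorHom, tensorHom_comp_tensorHom_assoc,
          tensorHom_comp_tensorHom_assoc]
        simp only [Category.assoc, Iso.inv_hom_id, Category.comp_id, Category.id_comp]
        have e₁ : (((j x y).hom ⊗ₘ (j y z).hom) ≫ eComp V _ _ _ ⊗ₘ (j z w).hom) =
            (((j x y).hom ⊗ₘ (j y z).hom) ⊗ₘ (j z w).hom) ≫ eComp V (o x) (o y) (o z) ▷ _ := by
          rw [← tensorHom_id, tensorHom_comp_tensorHom, Category.comp_id]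
        have e₂ : ((j x y).hom ⊗ₘ ((j y z).hom ⊗ₘ (j z w).hom) ≫ eComp V _ _ _) =
            ((j x y).hom ⊗ₘ ((j y z).hom ⊗ₘ (j z w).hom)) ≫ _ ◁ eComp V (o y) (o z) (o w) := by
          rw [← id_tensorHom, tensorHom_comp_tensorHom, Category.comp_id]
        rw [e₁, e₂, Category.assoc, Category.assoc, ← reassoc_of% h,
          associator_inv_naturality_assoc] }

/-- The comparison of a transported enriched category with the original one. -/
def transportMap (D : VCat.{u} V) {α : Type u} (o : α → D.carrier) (H : α → α → V)
    (j : ∀ x y, H x y ≅ (o x ⟶[V] o y)) : D.transport o H j ⟶ D :=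
  EnrichedFunctor.mk (V := V) (C := (D.transport o H j).carrier) (D := D.carrier) o
    (fun x y => (j x y).hom)
    (fun x => (Category.assoc _ _ _).trans ((congrArg (eId V (o x) ≫ ·) (j x x).inv_hom_id).trans
      (Category.comp_id _)))
    (fun x y z => (Category.assoc _ _ _).trans (congrArg (_ ≫ ·) ((Category.assoc _ _ _).trans
      ((congrArg (eComp V (o x) (o y) (o z) ≫ ·) (j x z).inv_hom_id).trans (Category.comp_id _)))))

/-- An enriched functor that is the identity on objects and given by equalities on hom-objects is an
equality. -/
theorem exists_eqToHom {α : Type u} (s t : EnrichedCategory V α)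
    (h : ∀ x y, @EnrichedCategory.Hom V _ _ α s x y = @EnrichedCategory.Hom V _ _ α t x y)
    (hi : ∀ x, @eId V _ _ α s x ≫ eqToHom (h x x) = @eId V _ _ α t x)
    (hc : ∀ x y z, @eComp V _ _ α s x y z ≫ eqToHom (h x z) =
      (eqToHom (h x y) ⊗ₘ eqToHom (h y z)) ≫ @eComp V _ _ α t x y z) :
    ∃ e : @VCat.mk V _ _ α s = @VCat.mk V _ _ α t,
      @EnrichedFunctor.mk V _ _ α s α t (fun x => x) (fun x y => eqToHom (h x y)) hi hc =
        eqToHom e := by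
  obtain ⟨H, i, c, a₁, a₂, a₃⟩ := s
  obtain ⟨H', i', c', a₁', a₂', a₃'⟩ := t
  obtain rfl : H = H' := funext fun x => funext fun y => h x y
  obtain rfl : i = i' := funext fun x => (Category.comp_id _).symm.trans (hi x)
  obtain rfl : c = c' := funext fun x => funext fun y => funext fun z =>
    (Category.comp_id _).symm.trans ((hc x y z).trans
      ((congrArg (· ≫ _) (id_tensorHom_id _ _)).trans (Category.id_comp _)))
  exact ⟨rfl, rfl⟩

end VCat

/-! ### Truncation is an isofibration -/

/-- Isomorphisms onto images of objects lift along the functor. -/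
def Isofibration {C D : Type*} [Category* C] [Category* D] (S : C ⥤ D) : Prop :=
  ∀ (A : C) (B : D) (i : B ≅ S.obj A), ∃ (A' : C) (j : A' ≅ A) (h : S.obj A' = B),
    S.map j.hom = eqToHom h ≫ i.hom

instance : IsDistrib (Type u) := inferInstanceAs (IsDistrib (NCat.{u} 0))

theorem isofibration_objects : Isofibration VCat.objects.{u} := by
  intro A B i
  let o : B → A.carrier := ConcreteCategory.hom i.hom
  have ho : Function.Bijective o := (isIso_iff_bijective i.hom).1 inferInstance
  let A' := A.transport o (fun x y => (o x ⟶[Type u] o y)) fun x y => Iso.refl _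
  let f : A' ⟶ A := A.transportMap o (fun x y => (o x ⟶[Type u] o y)) fun x y => Iso.refl _
  have hf : IsIso f := VCat.isIso_of_bijective f ho fun x y =>
    inferInstanceAs (IsIso (𝟙 (o x ⟶[Type u] o y)))
  exact ⟨A', @asIso _ _ _ _ f hf, rfl, (Category.id_comp _).symm⟩

/-- The isomorphism is lifted on each hom-object separately, and the structure of `A` is transported
along these lifts. The base change of the result equals `B`: their identities and compositions agree
after the invertible hom components of `i`, which can be cancelled. -/
theorem isofibration_changeBase {V W : Type (u + 1)} [Category.{u} V] [CartesianMonoidalCategory V]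
    [Category.{u} W] [CartesianMonoidalCategory W] [IsDistrib V] (S : V ⥤ W)
    [PreservesFiniteProducts S] (hS : Isofibration S) : Isofibration (VCat.changeBase S) := by
  intro A B i
  let o : B.carrier → A.carrier := i.hom.obj
  have hi := VCat.isIso_map i
  choose H j h e using fun x y : B.carrier =>
    hS (o x ⟶[V] o y) (x ⟶[W] y) (@asIso _ _ _ _ (i.hom.map x y) (hi x y))
  let A' := A.transport o H j
  let f : A' ⟶ A := A.transportMap o H j
  let g := (VCat.changeBase S).map f
  have hf : IsIso f := VCat.isIso_of_bijective f (VCat.bijective_obj i) fun x y =>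
    inferInstanceAs (IsIso (j x y).hom)
  have e' : ∀ x y : B.carrier, eqToHom (h x y) ≫ i.hom.map x y = S.map (j x y).hom := fun x y =>
    (e x y).symm
  obtain ⟨E, hE⟩ := VCat.exists_eqToHom (α := B.carrier) ((VCat.changeBase S).obj A').str B.str h
    (fun x => by
      refine (cancel_mono (i.hom.map x x)).1 ?_
      refine (Category.assoc _ _ _).trans ((congrArg (_ ≫ ·) (e' x x)).trans ?_)
      exact (EnrichedFunctor.map_id g x).trans (EnrichedFunctor.map_id i.hom x).symm)
    (fun x y z => by
      refine (cancel_mono (i.hom.map x z)).1 ?_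
      refine (Category.assoc _ _ _).trans ((congrArg (_ ≫ ·) (e' x z)).trans ?_)
      refine (EnrichedFunctor.map_comp g x y z).trans ?_
      refine Eq.trans ?_ (Category.assoc _ _ _).symm
      refine Eq.trans ?_ (congrArg (_ ≫ ·) (EnrichedFunctor.map_comp i.hom x y z)).symm
      refine Eq.trans ?_ (Category.assoc _ _ _)
      refine congrArg (· ≫ _) ?_
      exact (congrArg₂ (fun a b => a ⊗ₘ b) (e' x y).symm (e' y z).symm).trans
        (tensorHom_comp_tensorHom _ _ _ _).symm)
  refine ⟨A', @asIso _ _ _ _ f hf, E, ?_⟩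
  refine Eq.trans ?_ (congrArg (· ≫ i.hom) hE)
  exact VCat.hom_ext (fun _ => rfl) fun x y => (Category.comp_id _).trans (e x y)

theorem isofibration_S : ∀ n : ℕ, Isofibration (S.{u} n)
  | 0 => isofibration_objects
  | n + 1 => isofibration_changeBase (V := NCat.{u} (n + 1)) (W := NCat.{u} n) (S.{u} n)
      (isofibration_S n)

/-! ### Strict `ω`-categories as a pseudo-limit -/

namespace OmegaCat

/-- The truncations of a strict `ω`-category. -/
def proj (n : ℕ) : OmegaCat.{u} ⥤ NCat.{u} n where
  obj X := X.obj n
  map f := f.map n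

theorem map_comp_eqToHom {X Y : OmegaCat.{u}} (f : X ⟶ Y) (n : ℕ) :
    (S n).map (f.map (n + 1)) ≫ eqToHom (Y.trunc n) = eqToHom (X.trunc n) ≫ f.map n := by
  rw [f.trunc]
  simp

/-- The truncations of strict `ω`-categories form a cone. -/
def cone : SeqCone S.{u} OmegaCat.{u} where
  proj := proj
  iso n := NatIso.ofComponents (fun X => eqToIso (X.trunc n)) fun f => map_comp_eqToHom f n

theorem exists_hom {X Y : OmegaCat.{u}} (f : ∀ n, X.obj n ⟶ Y.obj n)
    (h : ∀ n, (S n).map (f (n + 1)) ≫ eqToHom (Y.trunc n) = eqToHom (X.trunc n) ≫ f n) :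
    ∃ g : X ⟶ Y, ∀ n, g.map n = f n := by
  refine ⟨⟨f, fun n => ?_⟩, fun n => rfl⟩
  rw [← Category.assoc, ← h]
  simp

theorem cone_fullyFaithful : cone.{u}.FullyFaithful where
  ext h := OmegaCat.Hom.ext (funext h)
  exists_map f h := exists_hom f h

theorem comp_eq_of_eq_comp_inv {C : Type*} [Category* C] {a b c d : C} {t : a ⟶ b} {f : b ⟶ c}
    (e : d ≅ c) {s : a ⟶ d} (h : s = t ≫ f ≫ e.inv) : t ≫ f = s ≫ e.hom := by
  rw [h]
  simp

/-- An object of `OmegaCat` must truncate on the nose. A sequence compatible up to isomorphism is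
rectified recursively: once level `n` has been replaced, the isofibration property replaces level `n
+ 1` by an isomorphic object truncating to it exactly. -/
theorem cone_essSurj : cone.{u}.EssSurj := by
  intro a e
  let step (n : ℕ) (p : Σ Z : NCat.{u} n, Z ≅ a n) :=
    isofibration_S n (a (n + 1)) p.1 (p.2 ≪≫ (e n).symm)
  let P : ∀ n, Σ Z : NCat.{u} n, Z ≅ a n := fun n => Nat.rec ⟨a 0, Iso.refl _⟩
    (fun n p => ⟨(step n p).choose, (step n p).choose_spec.choose⟩) n
  refine ⟨⟨fun n => (P n).1, fun n => (step n (P n)).choose_spec.choose_spec.choose⟩,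
    fun n => (P n).2, fun n => ?_⟩
  have h : (S n).map (P (n + 1)).2.hom = eqToHom _ ≫ (P n).2.hom ≫ (e n).inv :=
    (step n (P n)).choose_spec.choose_spec.choose_spec
  exact comp_eq_of_eq_comp_inv (e n) h

end OmegaCat

/-! ### Globular sets as a pseudo-limit -/

namespace GlobSet

/-- The restriction of globular sets to `n`-globular sets. -/
def res (n : ℕ) : GlobSet.{u} ⥤ NGlobSet.{u} n :=
  (Functor.whiskeringLeft _ _ _).obj (ObjectProperty.ι _)

instance (n : ℕ) : PreservesLimitsOfShape WalkingCospan (res.{u} n) :=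
  inferInstanceAs (PreservesLimitsOfShape WalkingCospan ((Functor.whiskeringLeft _ _ _).obj _))

instance (n : ℕ) (J : Type u) [Category.{u} J] : PreservesColimitsOfShape J (res.{u} n) :=
  inferInstanceAs (PreservesColimitsOfShape J ((Functor.whiskeringLeft _ _ _).obj _))

/-- The restrictions of globular sets form a cone. -/
def cone : SeqCone R.{u} GlobSet.{u} where
  proj := res
  iso _ := NatIso.ofComponents (fun _ => Iso.refl _) fun _ =>
    (Category.comp_id _).trans (Category.id_comp _).symm

theorem exists_hom {X Y : GlobSet.{u}} (f : ∀ n, (res n).obj X ⟶ (res n).obj Y)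
    (h : ∀ n, (R n).map (f (n + 1)) = f n) : ∃ g : X ⟶ Y, ∀ n, (res n).map g = f n := by
  have key : ∀ {k n : ℕ} (hk : k ≤ n),
      (f n).app (globe k hk) = (f k).app (globe k (le_refl k)) := by
    intro k n hk
    induction n, hk using Nat.le_induction with
    | base => rfl
    | succ n hk ih =>
      exact (congrArg (fun t => NatTrans.app t (globe k hk)) (h n)).trans ih
  refine ⟨⟨fun k => (f k.dim).app (globe k.dim le_rfl), fun k l g => ?_⟩, fun n => ?_⟩
  · have hl : l.dim ≤ k.dim := GlobeHom.le g
    have := (f k.dim).naturality (X := globe k.dim (le_refl _)) (Y := globe l.dim hl)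
      (globeHom g)
    rw [key hl] at this
    exact this
  · exact NatTrans.ext (funext fun k => (key k.property).symm)

theorem cone_fullyFaithful : cone.{u}.FullyFaithful where
  ext h := NatTrans.ext (funext fun k =>
    congrArg (fun t => NatTrans.app t (globe k.dim le_rfl)) (h k.dim))
  exists_map f h := exists_hom f fun n =>
    (Category.comp_id _).symm.trans ((h n).trans (Category.id_comp _))

theorem isPullback_of_res {P X Y Z : GlobSet.{u}} {p : P ⟶ X} {q : P ⟶ Y} {f : X ⟶ Z} {g : Y ⟶ Z}
    (h : ∀ n, IsPullback ((res n).map p) ((res n).map q) ((res n).map f) ((res n).map g)) :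
    IsPullback p q f g := by
  refine isPullback_of_elPullback (cone_fullyFaithful.ext fun n => ?_) fun k =>
    elPullback_of_isPullback (h k.dim) (globe k.dim le_rfl)
  exact ((res n).map_comp _ _).trans ((h n).w.trans ((res n).map_comp _ _).symm)

end GlobSet

/-! ### The underlying globular set of a strict `ω`-category, level by level -/

namespace OmegaCat

instance (X : OmegaCat.{u}) (n : ℕ) : IsIso (X.glue n) :=
  inferInstanceAs (IsIso ((UIso n).inv.app (X.obj (n + 1)) ≫ (U n).map (eqToHom (X.trunc n))))

/-- The components of `glue`. -/
def glueCell (X : OmegaCat.{u}) {k n : ℕ} (h : k ≤ n) :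
    ((U.{u} (n + 1)).obj (X.obj (n + 1))).obj (globe k (Nat.le_succ_of_le h)) ⟶
      ((U.{u} n).obj (X.obj n)).obj (globe k h) :=
  (X.glue n).app (globe k h)

instance (X : OmegaCat.{u}) {k n : ℕ} (h : k ≤ n) : IsIso (X.glueCell h) :=
  inferInstanceAs (IsIso ((X.glue n).app (globe k h)))

theorem map_glueCell (X : OmegaCat.{u}) {k l n : ℕ} (hk : k ≤ n) (hl : l ≤ n) (g : GlobeHom k l) :
    ((U.{u} (n + 1)).obj (X.obj (n + 1))).map (globeHom g) ≫ X.glueCell hl =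
      X.glueCell hk ≫ ((U.{u} n).obj (X.obj n)).map (globeHom g) :=
  (X.glue n).naturality (globeHom (hk := hk) (hl := hl) g)

theorem glueCell_naturality {X Y : OmegaCat.{u}} (f : X ⟶ Y) {k n : ℕ} (h : k ≤ n) :
    ((U.{u} (n + 1)).map (f.map (n + 1))).app (globe k (Nat.le_succ_of_le h)) ≫ Y.glueCell h =
      X.glueCell h ≫ ((U.{u} n).map (f.map n)).app (globe k h) :=
  congrArg (fun α => NatTrans.app α (globe k h)) (glue_naturality f n)

/-- The identification of the cells of the truncations of `X` with the cells of `X`. -/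
def descend (X : OmegaCat.{u}) {k n : ℕ} (h : k ≤ n) :
    ((U.{u} n).obj (X.obj n)).obj (globe k h) ⟶ X.Cell k :=
  Nat.leRec (motive := fun n h => ((U.{u} n).obj (X.obj n)).obj (globe k h) ⟶ X.Cell k) (𝟙 _)
    (fun _ h ih => X.glueCell h ≫ ih) h

theorem descend_self (X : OmegaCat.{u}) (k : ℕ) : X.descend (le_refl k) = 𝟙 _ :=
  Nat.leRec_self _ _

theorem descend_succ (X : OmegaCat.{u}) {k n : ℕ} (h : k ≤ n) :
    X.descend (Nat.le_succ_of_le h) = X.glueCell h ≫ X.descend h :=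
  Nat.leRec_succ _ _ h

theorem isIso_descend (X : OmegaCat.{u}) {k n : ℕ} (h : k ≤ n) : IsIso (X.descend h) := by
  induction n, h using Nat.le_induction with
  | base =>
    rw [descend_self]
    exact inferInstanceAs (IsIso (𝟙 _))
  | succ n h ih =>
    rw [X.descend_succ h]
    infer_instance

/-- `descend` as an isomorphism. -/
def descendIso (X : OmegaCat.{u}) {k n : ℕ} (h : k ≤ n) :
    ((U.{u} n).obj (X.obj n)).obj (globe k h) ≅ X.Cell k :=
  have := X.isIso_descend h
  asIso (X.descend h)

theorem descendIso_inv_succ (X : OmegaCat.{u}) {k n : ℕ} (h : k ≤ n) :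
    (X.descendIso (Nat.le_succ_of_le h)).inv ≫ X.glueCell h = (X.descendIso h).inv :=
  (Iso.inv_comp_eq _).2 ((Iso.eq_comp_inv _).2 (X.descend_succ h).symm)

theorem descend_naturality {X Y : OmegaCat.{u}} (f : X ⟶ Y) {k n : ℕ} (h : k ≤ n) :
    ((U.{u} n).map (f.map n)).app (globe k h) ≫ Y.descend h = X.descend h ≫ cellMap f k := by
  induction n, h using Nat.le_induction with
  | base =>
    rw [descend_self, descend_self]
    exact (Category.comp_id _).trans (Category.id_comp _).symm
  | succ n h ih =>
    rw [X.descend_succ h, Y.descend_succ h, Category.assoc, ← ih, ← Category.assoc,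
      glueCell_naturality, Category.assoc]

/-- The structure maps of the underlying globular set. -/
abbrev structMap (X : OmegaCat.{u}) {k l : ℕ} (g : GlobeHom k l) : X.Cell k ⟶ X.Cell l :=
  GlobSet.srcTgtMap (fun n => X.bdry (.src (Nat.lt_succ_self n)))
    (fun n => X.bdry (.tgt (Nat.lt_succ_self n))) g

theorem structMap_eq_bdry (X : OmegaCat.{u}) {k : ℕ} :
    ∀ f : GlobeHom (k + 1) k, X.structMap f = X.bdry f
  | .src _ => (congrArg (· ≫ _) (GlobSet.down_refl _ _)).trans (Category.id_comp _)
  | .tgt _ => (congrArg (· ≫ _) (GlobSet.down_refl _ _)).trans (Category.id_comp _)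

/-- If the target lies below `k`, the globular identities make the choice of the first step
immaterial, and `src` is taken. -/
theorem globeHom_factor {k l : ℕ} (h : l ≤ k) : ∀ g : GlobeHom (k + 1) l,
    ∃ (f : GlobeHom (k + 1) k) (g' : GlobeHom k l), g = f.comp g'
  | .id _ => absurd h (Nat.not_succ_le_self _)
  | .src h' => by
    obtain rfl | h := h.eq_or_lt
    · exact ⟨.src h', .id _, rfl⟩
    · exact ⟨.src (Nat.lt_succ_self _), .src h, rfl⟩
  | .tgt h' => by
    obtain rfl | h := h.eq_or_lt
    · exact ⟨.tgt h', .id _, rfl⟩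
    · exact ⟨.src (Nat.lt_succ_self _), .tgt h, rfl⟩

/-- `UOmega` assembles its structure maps from one-step boundaries taken at different levels,
whereas `U k` has them all at a single level. Splitting off the first step and descending one level
compares the two. -/
theorem map_descend_top (X : OmegaCat.{u}) {k l : ℕ} (hl : l ≤ k) (g : GlobeHom k l) :
    ((U.{u} k).obj (X.obj k)).map (globeHom (hk := le_rfl) (hl := hl) g) ≫ X.descend hl =
      X.structMap g := by
  induction k with
  | zero =>
    obtain rfl := Nat.le_zero.1 hl
    obtain rfl := globeHom_zero g
    rw [descend_self]
    exact (Category.comp_id _).trans (((U.{u} 0).obj (X.obj 0)).map_id _)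
  | succ k ih =>
    obtain rfl | hl' := hl.eq_or_lt
    · have : ∀ {m : ℕ} (g : GlobeHom m m), g = .id m
        | _, .id _ => rfl
        | _, .src h => absurd h (lt_irrefl _)
        | _, .tgt h => absurd h (lt_irrefl _)
      obtain rfl := this g
      rw [descend_self]
      exact (Category.comp_id _).trans (((U.{u} (k + 1)).obj (X.obj (k + 1))).map_id _)
    · have hlk := Nat.le_of_lt_succ hl'
      obtain ⟨f, g', rfl⟩ := globeHom_factor hlk g
      have e₁ : X.structMap (f.comp g') = X.structMap f ≫ X.structMap g' :=
        GlobSet.srcTgtMap_comp _ _ (fun _ => X.bdry_bdry (.src _) (.tgt _) (.src _) rfl)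
          (fun _ => X.bdry_bdry (.src _) (.tgt _) (.tgt _) rfl) f g'
      have e₂ := ((U.{u} (k + 1)).obj (X.obj (k + 1))).map_comp
        (globeHom (hk := le_refl (k + 1)) (hl := Nat.le_succ k) f)
        (globeHom (hl := Nat.le_succ_of_le hlk) g')
      have e₃ := X.map_glueCell (le_refl k) hlk g'
      rw [e₁, structMap_eq_bdry, ← ih hlk g', X.descend_succ hlk]
      refine (congrArg (· ≫ _) e₂).trans ?_
      refine (Category.assoc _ _ _).trans (Eq.trans ?_ (Category.assoc _ _ _).symm)
      refine congrArg (_ ≫ ·) ?_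
      exact (Category.assoc _ _ _).symm.trans ((congrArg (· ≫ _) e₃).trans (Category.assoc _ _ _))

theorem map_descend (X : OmegaCat.{u}) {k l n : ℕ} (hk : k ≤ n) (hl : l ≤ n) (g : GlobeHom k l) :
    ((U.{u} n).obj (X.obj n)).map (globeHom (hk := hk) (hl := hl) g) ≫ X.descend hl =
      X.descend hk ≫ X.structMap g := by
  induction n, hk using Nat.le_induction with
  | base =>
    rw [map_descend_top, descend_self]
    exact (Category.id_comp _).symm
  | succ n hk ih =>
    have hl' : l ≤ n := g.le.trans hk
    rw [X.descend_succ hk, X.descend_succ hl', Category.assoc, ← ih hl', ← Category.assoc,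
      map_glueCell, Category.assoc]

/-- The underlying globular set of a truncation of `X` is the restriction of that of `X`. -/
def cellsIso (X : OmegaCat.{u}) (n : ℕ) :
    (U.{u} n).obj (X.obj n) ≅ (GlobSet.res n).obj X.toGlobSet :=
  NatIso.ofComponents (fun k => X.descendIso k.property)
    fun {k l} g => X.map_descend k.property l.property g.hom

/-- The underlying globular sets of truncations are the restrictions of the underlying globular
set. -/
def resIso (n : ℕ) : UOmega.{u} ⋙ GlobSet.res n ≅ proj n ⋙ U.{u} n :=
  (NatIso.ofComponents (F := proj n ⋙ U.{u} n) (G := UOmega.{u} ⋙ GlobSet.res n)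
    (fun X => X.cellsIso n) fun f => NatTrans.ext (funext fun k =>
      descend_naturality f k.property)).symm

theorem resIso_compat (n : ℕ) (X : OmegaCat.{u}) :
    (R n).map ((resIso (n + 1)).hom.app X) ≫ X.glue n = (resIso n).hom.app X :=
  NatTrans.ext (funext fun k => X.descendIso_inv_succ k.property)

/-- The adjunctions between strict `n`-categories and `n`-globular sets as a tower. -/
def levelAdj : LevelAdj cone.{u} GlobSet.cone.{u} UOmega.{u} where
  F n := (freeNCat n).F
  U := U
  adj := nCatAdj
  i := UIso
  bc := beckChevalley_UIso
  β := resIso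
  hβ n X := (resIso_compat n X).trans (Category.id_comp _).symm

end OmegaCat

/-! ### The free strict `ω`-category monad is cartesian and finitary -/

section

variable {F : GlobSet.{u} ⥤ OmegaCat.{u}} {adj : F ⊣ UOmega.{u}}

/-- The cells of a free strict `ω`-category. -/
def omegaCellsIso (hb : ∀ n, BeckChevalley adj (nCatAdj.{u} n) (OmegaCat.resIso n).symm)
    (k : Globe) : adj.toMonad.toFunctor ⋙ (evaluation Globe (Type u)).obj k ≅
    GlobSet.res k.dim ⋙ (nCatAdj.{u} k.dim).toMonad.toFunctor ⋙ cells k.dim (globe k.dim le_rfl) :=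
  (Functor.isoWhiskerRight (hb k.dim).weakMonadMap.iso (cells k.dim (globe k.dim le_rfl))).symm

/-- Restriction to level `n` intertwines the monad with that of strict `n`-categories, and pullbacks
of globular sets are detected by the restrictions. Each square is thus isomorphic, at level `n`, to
one already known to be a pullback. -/
theorem isCartesianMonad_omega
    (hb : ∀ n, BeckChevalley adj (nCatAdj.{u} n) (OmegaCat.resIso n).symm) :
    IsCartesianMonad adj.toMonad where
  preserves := by
    refine preservesLimitsOfShape_of_evaluation _ _ fun k => ?_
    have : PreservesLimitsOfShape WalkingCospan (nCatAdj.{u} k.dim).toMonad.toFunctor :=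
      (good_nCatAdj k.dim).preservesPullbacks
    exact preservesLimitsOfShape_of_natIso (omegaCellsIso hb k).symm
  unit X Y f := by
    refine GlobSet.isPullback_of_res fun n => ?_
    let φ := (hb n).weakMonadMap
    have sq : IsPullback ((nCatAdj n).toMonad.map ((GlobSet.res n).map f)) (φ.iso.hom.app X)
        (φ.iso.hom.app Y) ((GlobSet.res n).map (adj.toMonad.map f)) :=
      .of_vert_isIso ⟨φ.iso.hom.naturality f⟩
    exact isPullback_congr (((good_nCatAdj n).unit ((GlobSet.res n).map f)).paste_vert sq) rfl
      (φ.unit X).symm (φ.unit Y).symm rfl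
  mul X Y f := by
    refine GlobSet.isPullback_of_res fun n => ?_
    let φ := (hb n).weakMonadMap
    let T := (nCatAdj.{u} n).toMonad
    -- This isomorphism compares the squares of the two monads; through it, `φ.mul` exhibits the
    -- restricted multiplication as a conjugate of that of `T`.
    let a (X : GlobSet.{u}) : T.obj (T.obj ((GlobSet.res n).obj X)) ⟶
        (GlobSet.res n).obj (adj.toMonad.obj (adj.toMonad.obj X)) :=
      T.map (φ.iso.hom.app X) ≫ φ.iso.hom.app (adj.toMonad.obj X)
    have ha : ∀ X, IsIso (a X) := fun X => inferInstance
    have nat : ∀ {X Y : GlobSet.{u}} (f : X ⟶ Y), T.map ((GlobSet.res n).map f) ≫ φ.iso.hom.app Y =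
        φ.iso.hom.app X ≫ (GlobSet.res n).map (adj.toMonad.map f) := fun f =>
      φ.iso.hom.naturality f
    have hn : T.map (T.map ((GlobSet.res n).map f)) ≫ a Y =
        a X ≫ (GlobSet.res n).map (adj.toMonad.map (adj.toMonad.map f)) := by
      have e := congrArg T.map (nat f)
      rw [Functor.map_comp, Functor.map_comp] at e
      refine (Category.assoc _ _ _).symm.trans ((congrArg (· ≫ _) e).trans ?_)
      refine (Category.assoc _ _ _).trans (Eq.trans ?_ (Category.assoc _ _ _).symm)
      exact congrArg (_ ≫ ·) (nat (adj.toMonad.map f))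
    have hμ : ∀ X, (GlobSet.res n).map (adj.toMonad.μ.app X) = inv (a X) ≫
        T.μ.app ((GlobSet.res n).obj X) ≫ φ.iso.hom.app X := fun X => by
      rw [IsIso.eq_inv_comp, φ.mul]
      exact Category.assoc _ _ _
    have sq₁ : IsPullback ((GlobSet.res n).map (adj.toMonad.map (adj.toMonad.map f))) (inv (a X))
        (inv (a Y)) (T.map (T.map ((GlobSet.res n).map f))) :=
      .of_vert_isIso ⟨by rw [IsIso.comp_inv_eq, Category.assoc, hn, IsIso.inv_hom_id_assoc]⟩
    have sq₂ : IsPullback (T.map ((GlobSet.res n).map f)) (φ.iso.hom.app X)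
        (φ.iso.hom.app Y) ((GlobSet.res n).map (adj.toMonad.map f)) :=
      .of_vert_isIso ⟨nat f⟩
    exact isPullback_congr (sq₁.paste_vert (((good_nCatAdj n).mul ((GlobSet.res n).map f)).paste_vert
      sq₂)) rfl (hμ X) (hμ Y) rfl

theorem preservesFiltered_omega
    (hb : ∀ n, BeckChevalley adj (nCatAdj.{u} n) (OmegaCat.resIso n).symm) :
    PreservesFilteredColimitsOfSize.{u, u} adj.toMonad.toFunctor := by
  refine ⟨fun J _ _ => preservesColimitsOfShape_of_evaluation _ _ fun k => ?_⟩
  have : PreservesColimitsOfShape J (nCatAdj.{u} k.dim).toMonad.toFunctor :=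
    (good_nCatAdj k.dim).preservesFiltered.preserves_filtered_colimits J
  exact preservesColimitsOfShape_of_natIso (omegaCellsIso hb k).symm

end

end
end StrictHigherCat

/-! ### The main theorem -/

theorem mainTheorem5 :
    -- strict `ω`-categories
    (∃ (F : StrictHigherCat.GlobSet.{u} ⥤ StrictHigherCat.OmegaCat.{u})
      (adj : F ⊣ StrictHigherCat.UOmega.{u}),
      (CategoryTheory.Monad.comparison adj).IsEquivalence ∧
      StrictHigherCat.IsCartesianMonad adj.toMonad ∧
      PreservesFilteredColimitsOfSize.{u, u} adj.toMonad.toFunctor) ∧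
    -- strict `n`-categories
    (∃ (F : ∀ n : ℕ, StrictHigherCat.NGlobSet.{u} n ⥤ StrictHigherCat.NCat.{u} n)
      (adj : ∀ n : ℕ, F n ⊣ StrictHigherCat.U.{u} n),
      (∀ n : ℕ,
        (CategoryTheory.Monad.comparison (adj n)).IsEquivalence ∧
        StrictHigherCat.IsCartesianMonad (adj n).toMonad ∧
        PreservesFilteredColimitsOfSize.{u, u} (adj n).toMonad.toFunctor) ∧
      -- `R_n` is a weak map of monads, and the functor it induces on algebras is `S_n`
      (∀ n : ℕ,
        ∃ (φ : StrictHigherCat.WeakMonadMap (adj (n + 1)).toMonad (adj n).toMonad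
            (StrictHigherCat.R.{u} n))
          (α : StrictHigherCat.S.{u} n ⋙ CategoryTheory.Monad.comparison (adj n) ≅
            CategoryTheory.Monad.comparison (adj (n + 1)) ⋙ φ.algebraFunctor),
          ∀ C : StrictHigherCat.NCat.{u} (n + 1),
            (α.hom.app C).f = (StrictHigherCat.UIso.{u} n).hom.app C)) := by
  obtain ⟨F, adj, hb⟩ := StrictHigherCat.OmegaCat.levelAdj.exists_adjunction
    StrictHigherCat.OmegaCat.cone_fullyFaithful StrictHigherCat.OmegaCat.cone_essSurj
    StrictHigherCat.GlobSet.cone_fullyFaithful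
  refine ⟨⟨F, adj, ?_, StrictHigherCat.isCartesianMonad_omega hb,
    StrictHigherCat.preservesFiltered_omega hb⟩, fun n => (StrictHigherCat.freeNCat n).F,
    fun n => StrictHigherCat.nCatAdj n, fun n => ⟨(StrictHigherCat.good_nCatAdj n).monadic,
      (StrictHigherCat.good_nCatAdj n).isCartesianMonad,
      (StrictHigherCat.good_nCatAdj n).preservesFiltered⟩,
    -- The isomorphism `comparisonIso` has the components of `UIso` as underlying maps by
    -- construction, so the last condition holds by definition.
    fun n => ⟨(StrictHigherCat.beckChevalley_UIso n).weakMonadMap,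
      (StrictHigherCat.beckChevalley_UIso n).comparisonIso, fun C => rfl⟩⟩
  exact StrictHigherCat.LevelAdj.isEquivalence_comparison (L := StrictHigherCat.OmegaCat.levelAdj)
    StrictHigherCat.OmegaCat.cone_fullyFaithful StrictHigherCat.OmegaCat.cone_essSurj
    StrictHigherCat.GlobSet.cone_fullyFaithful
    (fun n => (StrictHigherCat.good_nCatAdj n).monadic) hb
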